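/- **Setting.** Let $K:\mathbb R^N\times\mathbb R^N\to[0,\infty]$ and $j:\mathbb R^N\setminus\{0\}\to[0,\infty)$ be measurable, and suppose: * **(K)** for some $\Lambda\ge1$, $\Lambda^{-1}j(y-x)\le K(x,y)\le\Lambda j(y-x)$ for all $x\ne y$. * With $K_s(x,y)=\frac12(K(x,y)+K(y,x))$ and $K_a(x,y)=\frac12(K(x,y)-K(y,x))$, one of the following holds: * $(K_{as})$: $\ \sup_{x\in\mathbb R^N}\int_{\{K_s(x,y)\ne0\}}\frac{K_a(x,y)^2}{K_s(x,y)}\,dy<\infty$; * $(\tilde K_{as})$: there is a measurable symmetric $\tilde k:\mathbb R^N\times\mathbb R^N\to[0,\infty]$ with $|\{y:\tilde k(x,y)=0,\ K_a(x,y)\ne0\}|=0$ for all $x$, with $\iint(v(x)-v(y))^2\tilde k(x,y)\,dy\,dx\le\iint(v(x)-v(y))^2K_s(x,y)\,dy\,dx$ for all $v\in V(\mathbb R^N|\mathbb R^N)$ (defined below), and with $\sup_{x}\int_{\{\tilde k(x,y)\ne0\}}\frac{K_a(x,y)^2}{\tilde k(x,y)}\,dy<\infty$. * $(A1_\gamma)$: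 $\int_{\mathbb R^N}\min\{1,|z|^\gamma\}j(z)\,dz<\infty$ for some $\gamma\in(0,1)$. * $(A2)$: $\int_{\mathbb R^N}j(z)\,dz=\infty$. * For some $R_0>0$, one of the following holds: * $(A3_1)$: there are $c_0,\sigma\in(0,1)$ with $c_0\,j(y)\le j(z)\le c_0^{-1}j(y)$ for all $z,y\in B_{R_0}\setminus\{0\}$ with $1-\sigma\le|z|/|y|\le1+\sigma$; * $(A3_2)$: $j\in BV_{loc}(B_{R_0}\setminus\{0\})$ and there is $M>0$ with $\|Dj\|(B_R\setminus\overline{B_r})\le\frac Mr\int_{\mathbb R^N\setminus B_r}j(z)\,dz$ for $0<r<R<R_0$. Here $B_r=B_r(0)$. Let $\Omega\subset\mathbb R^N$ be open and $W,f\in L^\infty_{loc}(\Omega)$. **Weak solutions.** $V(\Omega|\mathbb R^N)$ is the space of $v\in L^2_{loc}(\mathbb R^N)$ with $\iint_{\mathbb R^{2N}\setminus(\Omega^c\times\Omega^c)}(v(x)-v(y))^2j(x-y)\,dx\,dy<\infty$. A function $u\in V(\Omega|\mathbb R^N)$ is a weak solution of $\mathscr Lu=Wu+f$ in $\Omega$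 if $\mathcal E(u,\varphi)=\int_\Omega(Wu+f)\varphi\,dx$ for all $\varphi\in C_c^\infty(\Omega)$. Here $\mathcal E(u,\varphi)=\iint(u(x)-u(y))\varphi(x)K(x,y)\,dy\,dx$ is understood after symmetrizing the part coming from $K_s$, that is, $$\mathcal E(u,\varphi)=\tfrac12\iint(u(x)-u(y))(\varphi(x)-\varphi(y))K_s(x,y)\,dy\,dx+\iint(u(x)-u(y))\varphi(x)K_a(x,y)\,dy\,dx .$$ Write $A\Subset B$ if $\overline A$ is compact and contained in $B$. **(a) Globally bounded solutions.** Every weak solution $u\in V(\Omega|\mathbb R^N)\cap L^\infty(\mathbb R^N)$ has a continuous representative on $\Omega$. Moreover, for all open sets $A\Subset B\Subset\Omega$ there is a nondecreasing continuous $\omega:[0,\infty)\to[0,\infty)$ with $\omega(0)=0$, independent of $f$ and $u$, such that the continuous representative satisfies $$|u(x)-u(y)|\le\omega(|x-y|)\bigl(\|u\|_{L^\infty(\mathbb R^N)}+\|f\|_{L^\infty(B)}\bigr)\qquad\text{for all }x,y\in A.$$ **(b) General form.** Let $u\in V(\Omega|\mathbb R^N)\cap L^\infty_{loc}(\Omega)$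 be a weak solution with bounded $j$-tail in $\Omega$, that is, $x\mapsto\int_{\mathbb R^N\setminus B_r(x)}|u(y)|j(y-x)\,dy$ belongs to $L^\infty_{loc}(\Omega)$ for every $r>0$. Then $u$ has a continuous representative on $\Omega$. Moreover, for all open sets $A\Subset B_*\Subset B\Subset\Omega$ there is a nondecreasing continuous $\omega:[0,\infty)\to[0,\infty)$ with $\omega(0)=0$, independent of $f$ and $u$, such that the continuous representative satisfies $$|u(x)-u(y)|\le\omega(|x-y|)\bigl(\|u\|_{L^\infty(B)}+\|f\|_{L^\infty(B_*)}+T(u,B_*,B)\bigr)\qquad\text{for all }x,y\in A,$$ where $T(u,B_*,B)=\operatorname*{ess\,sup}_{x\in B_*}\int_{\mathbb R^N\setminus B}|u(y)|j(y-x)\,dy$. -/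

import Mathlib

open MeasureTheory Set Filter Topology
open scoped NNReal ENNReal

noncomputable section

/-- `ℝ^N` with the Euclidean norm. -/
abbrev RN (N : ℕ) : Type := EuclideanSpace ℝ (Fin N)

/-- `A ⋐ B`: the closure of `A` is compact and contained in `B`. -/
def CompactlyIn {N : ℕ} (A B : Set (RN N)) : Prop :=
  IsCompact (closure A) ∧ closure A ⊆ B

/-- The local Lebesgue space `L^p_loc(Ω)`. -/
def MemLpLoc {N : ℕ} (p : ℝ≥0∞) (Ω : Set (RN N)) (g : RN N → ℝ) : Prop :=
  ∀ C : Set (RN N), IsCompact C → C ⊆ Ω → MemLp g p (volume.restrict C)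

/-- The comparability condition `Λ⁻¹ j(y - x) ≤ K(x,y) ≤ Λ j(y - x)` for `x ≠ y`, for some `Λ ≥ 1`. -/
def CondK {N : ℕ} (K : RN N → RN N → ℝ≥0∞) (j : RN N → ℝ≥0) : Prop :=
  ∃ Λ : ℝ≥0, 1 ≤ Λ ∧ ∀ x y : RN N, x ≠ y →
    ((Λ⁻¹ * j (y - x) : ℝ≥0) : ℝ≥0∞) ≤ K x y ∧ K x y ≤ ((Λ * j (y - x) : ℝ≥0) : ℝ≥0∞)

/-- The symmetric part of `K`. Under `CondK` the kernel is finite off the diagonal, so that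
`ENNReal.toReal` changes nothing there. -/
def symPart {N : ℕ} (K : RN N → RN N → ℝ≥0∞) (x y : RN N) : ℝ :=
  ((K x y).toReal + (K y x).toReal) / 2

/-- The antisymmetric part of `K`. -/
def antiPart {N : ℕ} (K : RN N → RN N → ℝ≥0∞) (x y : RN N) : ℝ :=
  ((K x y).toReal - (K y x).toReal) / 2

/-- The squared seminorm of `V(Ω|ℝ^N)`: the integral of `(v(x) - v(y))² j(x - y)` over
`ℝ^{2N} ∖ (Ωᶜ × Ωᶜ)`. -/
def seminormVSq {N : ℕ} (j : RN N → ℝ≥0) (Ω : Set (RN N)) (v : RN N → ℝ) : ℝ≥0∞ :=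
  ∫⁻ p in {p : RN N × RN N | p.1 ∈ Ω ∨ p.2 ∈ Ω},
    ENNReal.ofReal ((v p.1 - v p.2) ^ 2) * (j (p.1 - p.2) : ℝ≥0∞)

/-- The space `V(Ω|ℝ^N)`. -/
def MemV {N : ℕ} (j : RN N → ℝ≥0) (Ω : Set (RN N)) (v : RN N → ℝ) : Prop :=
  MemLpLoc 2 univ v ∧ seminormVSq j Ω v < ∞

/-- The condition `(K_as)`. -/
def CondKas {N : ℕ} (K : RN N → RN N → ℝ≥0∞) : Prop :=
  (⨆ x : RN N, ∫⁻ y in {y | symPart K x y ≠ 0},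
    ENNReal.ofReal ((antiPart K x y) ^ 2 / symPart K x y)) < ∞

/-- The relaxed condition `(K̃_as)`, where a symmetric kernel `k`, dominated by the symmetric part of
`K` in the sense of quadratic forms, takes the place of the symmetric part. -/
def CondKasTilde {N : ℕ} (K : RN N → RN N → ℝ≥0∞) (j : RN N → ℝ≥0) : Prop :=
  ∃ k : RN N → RN N → ℝ≥0∞,
    Measurable (Function.uncurry k) ∧
    (∀ x y, k x y = k y x) ∧
    (∀ x, volume {y | k x y = 0 ∧ antiPart K x y ≠ 0} = 0) ∧
    (∀ v : RN N → ℝ, MemV j univ v →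
      ∫⁻ p : RN N × RN N, ENNReal.ofReal ((v p.1 - v p.2) ^ 2) * k p.1 p.2 ≤
        ∫⁻ p : RN N × RN N,
          ENNReal.ofReal ((v p.1 - v p.2) ^ 2) * ENNReal.ofReal (symPart K p.1 p.2)) ∧
    (⨆ x : RN N, ∫⁻ y in {y | k x y ≠ 0}, ENNReal.ofReal ((antiPart K x y) ^ 2) / k x y) < ∞

/-- The condition `(A1_γ)`. -/
def CondA1 {N : ℕ} (γ : ℝ) (j : RN N → ℝ≥0) : Prop :=
  ∫⁻ z, ENNReal.ofReal (min 1 (‖z‖ ^ γ)) * (j z : ℝ≥0∞) < ∞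

/-- The condition `(A2)`: `j` is not integrable. -/
def CondA2 {N : ℕ} (j : RN N → ℝ≥0) : Prop :=
  ∫⁻ z, (j z : ℝ≥0∞) = ∞

/-- The annular doubling condition on the punctured ball of radius `R₀`; the quotient bounds are
multiplied out. -/
def CondA31 {N : ℕ} (R₀ : ℝ) (j : RN N → ℝ≥0) : Prop :=
  ∃ c₀ : ℝ≥0, ∃ σ : ℝ, 0 < c₀ ∧ c₀ < 1 ∧ 0 < σ ∧ σ < 1 ∧
    ∀ z y : RN N, z ≠ 0 → y ≠ 0 → ‖z‖ < R₀ → ‖y‖ < R₀ →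
      1 - σ ≤ ‖z‖ / ‖y‖ → ‖z‖ / ‖y‖ ≤ 1 + σ →
      c₀ * j y ≤ j z ∧ j z ≤ c₀⁻¹ * j y

/-- The divergence of a vector field. -/
def divergence {N : ℕ} (w : RN N → RN N) (x : RN N) : ℝ :=
  ∑ i : Fin N, (fderiv ℝ w x (EuclideanSpace.single i 1)) i

/-- The total variation `‖Dg‖(U)`. -/
def totalVar {N : ℕ} (g : RN N → ℝ) (U : Set (RN N)) : ℝ≥0∞ :=
  ⨆ (w : RN N → RN N) (_ : ContDiff ℝ 1 w ∧ HasCompactSupport w ∧ tsupport w ⊆ U ∧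
      ∀ x, ‖w x‖ ≤ 1),
    ENNReal.ofReal (∫ x in U, g x * divergence w x)

/-- The space `BV_loc(U)`. -/
def MemBVLoc {N : ℕ} (U : Set (RN N)) (g : RN N → ℝ) : Prop :=
  MemLpLoc 1 U g ∧ ∀ U' : Set (RN N), IsOpen U' → CompactlyIn U' U → totalVar g U' < ∞

/-- The BV condition on the punctured ball of radius `R₀`. -/
def CondA32 {N : ℕ} (R₀ : ℝ) (j : RN N → ℝ≥0) : Prop :=
  ∃ M : ℝ, 0 < M ∧
    MemBVLoc (Metric.ball (0 : RN N) R₀ \ {0}) (fun z => (j z : ℝ)) ∧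
    ∀ r R : ℝ, 0 < r → r < R → R < R₀ →
      totalVar (fun z => (j z : ℝ)) (Metric.ball (0 : RN N) R \ Metric.closedBall 0 r) ≤
        ENNReal.ofReal (M / r) * ∫⁻ z in (Metric.ball (0 : RN N) r)ᶜ, (j z : ℝ≥0∞)

/-- The bilinear form `𝓔(u,φ) = ∬ (u(x) - u(y)) φ(x) K(x,y) dy dx`. For `u ∈ V(Ω|ℝ^N)` and
`φ ∈ C_c^∞(Ω)` the contribution of the symmetric part of `K` need not converge absolutely in this
form; as usual it is symmetrized in `x` and `y`, after which both integrals converge absolutely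
(under the antisymmetry control). See `bilinForm_eq` for the agreement of the two formulas. -/
def bilinForm {N : ℕ} (K : RN N → RN N → ℝ≥0∞) (u φ : RN N → ℝ) : ℝ :=
  (1 / 2) * (∫ p : RN N × RN N, (u p.1 - u p.2) * (φ p.1 - φ p.2) * symPart K p.1 p.2) +
    ∫ p : RN N × RN N, (u p.1 - u p.2) * φ p.1 * antiPart K p.1 p.2

/-- The symmetrized form agrees with the plain double integral when the latter converges. -/
theorem bilinForm_eq {N : ℕ} (K : RN N → RN N → ℝ≥0∞) (u φ : RN N → ℝ)
    (h : Integrable (fun p : RN N × RN N => (u p.1 - u p.2) * φ p.1 * (K p.1 p.2).toReal))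
    (ha : Integrable (fun p : RN N × RN N => (u p.1 - u p.2) * φ p.1 * antiPart K p.1 p.2)) :
    bilinForm K u φ = ∫ p : RN N × RN N, (u p.1 - u p.2) * φ p.1 * (K p.1 p.2).toReal := by
  have hs : Integrable
      (fun p : RN N × RN N => (u p.1 - u p.2) * φ p.1 * symPart K p.1 p.2) := by
    refine (h.sub ha).congr (Eventually.of_forall fun p => ?_)
    simp only [Pi.sub_apply, symPart, antiPart]
    ring
  have hs' : Integrable
      (fun p : RN N × RN N => (u p.2 - u p.1) * φ p.2 * symPart K p.2 p.1) := hs.swap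
  have e1 : ∫ p : RN N × RN N, (u p.2 - u p.1) * φ p.2 * symPart K p.2 p.1 =
      ∫ p : RN N × RN N, (u p.1 - u p.2) * φ p.1 * symPart K p.1 p.2 :=
    integral_prod_swap (μ := (volume : Measure (RN N))) (ν := (volume : Measure (RN N)))
      (fun p : RN N × RN N => (u p.1 - u p.2) * φ p.1 * symPart K p.1 p.2)
  have e2 : ∫ p : RN N × RN N, (u p.1 - u p.2) * (φ p.1 - φ p.2) * symPart K p.1 p.2 =
      (∫ p : RN N × RN N, (u p.1 - u p.2) * φ p.1 * symPart K p.1 p.2) +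
        ∫ p : RN N × RN N, (u p.2 - u p.1) * φ p.2 * symPart K p.2 p.1 := by
    rw [← integral_add hs hs']
    refine integral_congr_ae (Eventually.of_forall fun p => ?_)
    simp only [symPart]
    ring
  have e3 : ∫ p : RN N × RN N, (u p.1 - u p.2) * φ p.1 * (K p.1 p.2).toReal =
      (∫ p : RN N × RN N, (u p.1 - u p.2) * φ p.1 * symPart K p.1 p.2) +
        ∫ p : RN N × RN N, (u p.1 - u p.2) * φ p.1 * antiPart K p.1 p.2 := by
    rw [← integral_add hs ha]
    refine integral_congr_ae (Eventually.of_forall fun p => ?_)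
    simp only [symPart, antiPart]
    ring
  rw [bilinForm, e2, e1, e3]
  ring

/-- `u ∈ V(Ω|ℝ^N)` is a weak solution of `𝓛 u = W u + f` in `Ω`. -/
def IsWeakSol {N : ℕ} (K : RN N → RN N → ℝ≥0∞) (j : RN N → ℝ≥0) (Ω : Set (RN N))
    (W f u : RN N → ℝ) : Prop :=
  MemV j Ω u ∧
    ∀ φ : RN N → ℝ, ContDiff ℝ ((⊤ : ℕ∞) : WithTop ℕ∞) φ → HasCompactSupport φ → tsupport φ ⊆ Ω →
      bilinForm K u φ = ∫ x in Ω, (W x * u x + f x) * φ x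

/-- `u` has a bounded `j`-tail in `Ω`: for every `r > 0` the function
`x ↦ ∫_{ℝ^N ∖ B_r(x)} |u(y)| j(y - x) dy` belongs to `L^∞_loc(Ω)`. -/
def BoundedTail {N : ℕ} (j : RN N → ℝ≥0) (Ω : Set (RN N)) (u : RN N → ℝ) : Prop :=
  ∀ r : ℝ, 0 < r → ∀ C : Set (RN N), IsCompact C → C ⊆ Ω →
    essSup (fun x => ∫⁻ y in (Metric.ball x r)ᶜ, ‖u y‖ₑ * (j (y - x) : ℝ≥0∞))
      (volume.restrict C) < ∞

/-- The tail term `T(u,A,B)`: the (essential) supremum over `x ∈ A` of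
`∫_{ℝ^N ∖ B} |u(y)| j(y - x) dy`. -/
def tailTerm {N : ℕ} (j : RN N → ℝ≥0) (u : RN N → ℝ) (A B : Set (RN N)) : ℝ≥0∞ :=
  essSup (fun x => ∫⁻ y in Bᶜ, ‖u y‖ₑ * (j (y - x) : ℝ≥0∞)) (volume.restrict A)

/-- `v` is a continuous representative of `u` on `Ω`. -/
def IsContRep {N : ℕ} (Ω : Set (RN N)) (u v : RN N → ℝ) : Prop :=
  ContinuousOn v Ω ∧ v =ᵐ[volume.restrict Ω] u

end

/-! After division by the size of the data, `|u| ≤ 1` on the whole space and `u` solves an equation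
in a smaller set `D` with bounded right-hand side. Continuity is then proved by doubling the
variables, as in coupling arguments for jump processes. The difference `u(x) - u(y)` is compared
with a barrier `Φ(x, y)`: with `y` frozen, the equation in `x` is tested against `(u(x) - u(y) -
Φ(x, y))₊`, the same is done with the roles exchanged, and both estimates are integrated over the
frozen variable. Everything stays in the weak formulation; the operator is never evaluated
pointwise.

The gain comes from coalescing jumps. Restricted to jumps longer than `ρ`, the kernels `j(w - x)`
and `j(w - y)` share their minimum. Sending both points to the same `w` turns `(u(x) - u(w)) + (u(w)
- u(y))` into `u(x) - u(y)`, so where the truncation is positive there is a restoring term of size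
`u(x) - u(y)` times the shared mass. The rest of the kernel has the good sign up to the cost of the
barrier. The antisymmetric part is absorbed by the energy through the control kernel, up to a
multiple of the squared truncation (`IsBoundedWeakSol.truncation_estimate`).

The gain has to beat the barrier. Write `S(ρ)` for the mass of `min(1, |z|/ρ) j(z)` and `T(r)` for
the mass of `j` off the ball of radius `r`. A barrier term `a min(1, |x - y|/(θρ))` costs a constant
times `a S(ρ)/θ`. The annular condition or the variation bound makes the shared mass at least a
multiple of `T(2ρ)` at scales with `S(ρ) ≤ C T(2ρ)`. Such scales exist arbitrarily close to zero:
otherwise `S` would grow under halving faster than the rate `ρ^(-γ)`, `γ < 1`, permits. There the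
gain and the cost are both proportional to `S(ρ)`, which tends to infinity, and a small `a` lets the
gain win (`exists_coalescing_scale`).

One application lowers the bound for `u(x) - u(y)` near the diagonal by `a/2` at the price of a
smaller radius (`OscBound.improve`). Since `a` depends on the target `ε` but neither on the current
bound nor on the solution, finitely many applications lead from `2` to `ε`. This is equicontinuity
up to null sets, from which a continuous representative and a modulus are built.

For the general form, the values of `u` outside `B` are moved to the right-hand side, where the tail
bounds them (`exists_isBoundedWeakSol`). The globally bounded case follows because the tail of a
bounded function is at most a constant times its norm. -/

open MeasureTheory Set Filter Topology
open scoped NNReal ENNReal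

noncomputable section

/-! ### Masses of the jump kernel across scales, and coalescence under annular doubling. -/

section JumpMass

variable {N : ℕ} {j : RN N → ℝ≥0}

/-- The mass of `min(1, |z|/ρ) j(z)`. -/
def scaleMass (j : RN N → ℝ≥0) (ρ : ℝ) : ℝ≥0∞ :=
  ∫⁻ z, ENNReal.ofReal (min 1 (‖z‖ / ρ)) * (j z : ℝ≥0∞)

/-- The mass of `j` outside the ball of radius `r`. -/
def tailMass (j : RN N → ℝ≥0) (r : ℝ) : ℝ≥0∞ :=
  ∫⁻ z in (Metric.ball (0 : RN N) r)ᶜ, (j z : ℝ≥0∞)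

/-- The jump kernel with jumps shorter than `ρ` removed. -/
def cutKernel (j : RN N → ℝ≥0) (ρ : ℝ) : RN N → ℝ≥0 :=
  (Metric.ball (0 : RN N) ρ)ᶜ.indicator j

theorem measurable_cutKernel (hj : Measurable j) (ρ : ℝ) : Measurable (cutKernel j ρ) :=
  hj.indicator Metric.isOpen_ball.measurableSet.compl

theorem cutKernel_le (j : RN N → ℝ≥0) (ρ : ℝ) (z : RN N) : cutKernel j ρ z ≤ j z :=
  indicator_le_self' (fun _ _ => zero_le) z

theorem lintegral_cutKernel (j : RN N → ℝ≥0) (ρ : ℝ) :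
    ∫⁻ z, (cutKernel j ρ z : ℝ≥0∞) = tailMass j ρ := by
  rw [tailMass, ← lintegral_indicator Metric.isOpen_ball.measurableSet.compl]
  refine lintegral_congr fun z => ?_
  by_cases hz : z ∈ (Metric.ball (0 : RN N) ρ)ᶜ <;> simp only [cutKernel, indicator, hz] <;> simp

theorem scaleMass_le_of_le {j : RN N → ℝ≥0} {ρ : ℝ} {c : ℝ} (hc : 0 ≤ c) {F : RN N → ℝ}
    (h : ∀ z, min 1 (‖z‖ / ρ) ≤ c * F z) :
    scaleMass j ρ ≤ ENNReal.ofReal c * ∫⁻ z, ENNReal.ofReal (F z) * (j z : ℝ≥0∞) := by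
  rw [← lintegral_const_mul' _ _ ENNReal.ofReal_ne_top, scaleMass]
  refine lintegral_mono fun z => ?_
  rw [← mul_assoc, ← ENNReal.ofReal_mul hc]
  gcongr
  exact h z

theorem min_div_le_rpow {γ : ℝ} (hγ0 : 0 < γ) (hγ1 : γ < 1) {ρ : ℝ} (hρ : 0 < ρ) (hρ1 : ρ ≤ 1)
    {t : ℝ} (ht : 0 ≤ t) : min 1 (t / ρ) ≤ (ρ⁻¹) ^ γ * min 1 (t ^ γ) := by
  have h1 : 1 ≤ (ρ⁻¹) ^ γ := Real.one_le_rpow ((one_le_inv₀ hρ).2 hρ1) hγ0.le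
  rw [mul_min_of_nonneg _ _ (by positivity), ← Real.mul_rpow (by positivity) ht,
    inv_mul_eq_div, mul_one]
  refine le_min ((min_le_left _ _).trans h1) ?_
  by_cases h : 1 ≤ t / ρ
  · exact (min_le_left _ _).trans (Real.one_le_rpow h hγ0.le)
  · push Not at h
    refine (min_le_right _ _).trans ?_
    calc t / ρ = (t / ρ) ^ (1 : ℝ) := (Real.rpow_one _).symm
      _ ≤ (t / ρ) ^ γ := by
        rcases (div_nonneg ht hρ.le).eq_or_lt with h0 | h0
        · rw [← h0, Real.zero_rpow hγ0.ne', Real.zero_rpow one_ne_zero]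
        · exact Real.rpow_le_rpow_of_exponent_ge h0 h.le hγ1.le

/-- This is where `γ < 1` enters: it caps the growth under halving of `ρ` at the factor `2 ^ γ < 2`,
which the choice of good scales contradicts. -/
theorem scaleMass_le_rpow {γ : ℝ} (hγ0 : 0 < γ) (hγ1 : γ < 1) {ρ : ℝ} (hρ : 0 < ρ)
    (hρ1 : ρ ≤ 1) : scaleMass j ρ ≤ ENNReal.ofReal ((ρ⁻¹) ^ γ) *
      ∫⁻ z, ENNReal.ofReal (min 1 (‖z‖ ^ γ)) * (j z : ℝ≥0∞) :=
  scaleMass_le_of_le (by positivity) fun z => min_div_le_rpow hγ0 hγ1 hρ hρ1 (norm_nonneg z)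

theorem scaleMass_mul_le {c ρ : ℝ} (hc : 0 < c) (hc1 : c ≤ 1) (hρ : 0 < ρ) :
    scaleMass j (c * ρ) ≤ ENNReal.ofReal c⁻¹ * scaleMass j ρ := by
  refine scaleMass_le_of_le (by positivity) fun z => ?_
  rw [mul_min_of_nonneg _ _ (by positivity), mul_one]
  refine min_le_min ((one_le_inv₀ hc).2 hc1) (le_of_eq ?_)
  field_simp

theorem scaleMass_anti {ρ ρ' : ℝ} (hρ : 0 < ρ) (h : ρ ≤ ρ') : scaleMass j ρ' ≤ scaleMass j ρ := by
  refine lintegral_mono fun z => ?_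
  gcongr

theorem scaleMass_lt_top {γ : ℝ} (hγ0 : 0 < γ) (hγ1 : γ < 1) (hA1 : CondA1 γ j) {ρ : ℝ}
    (hρ : 0 < ρ) : scaleMass j ρ < ∞ := by
  have h1 : scaleMass j (min ρ 1) < ∞ :=
    (scaleMass_le_rpow hγ0 hγ1 (lt_min hρ one_pos) (min_le_right _ _)).trans_lt
      (ENNReal.mul_lt_top ENNReal.ofReal_lt_top hA1)
  exact (scaleMass_anti (lt_min hρ one_pos) (min_le_left _ _)).trans_lt h1

theorem tailMass_le_scaleMass {ρ : ℝ} (hρ : 0 < ρ) : tailMass j ρ ≤ scaleMass j ρ := by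
  rw [← lintegral_cutKernel]
  refine lintegral_mono fun z => ?_
  by_cases hz : z ∈ (Metric.ball (0 : RN N) ρ)ᶜ
  · have : 1 ≤ ‖z‖ / ρ := by
      rw [one_le_div hρ]; simpa using hz
    simp [cutKernel, indicator, hz, this]
  · simp [cutKernel, indicator, hz]

theorem tailMass_anti {r r' : ℝ} (h : r ≤ r') : tailMass j r' ≤ tailMass j r :=
  lintegral_mono_set (compl_subset_compl.2 (Metric.ball_subset_ball h))

theorem tailMass_lt_top {γ : ℝ} (hγ0 : 0 < γ) (hγ1 : γ < 1) (hA1 : CondA1 γ j) {r : ℝ}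
    (hr : 0 < r) : tailMass j r < ∞ :=
  (tailMass_le_scaleMass hr).trans_lt (scaleMass_lt_top hγ0 hγ1 hA1 hr)

/-- Continuity from below along complements of shrinking balls. Their union misses only `0`, whose
mass is finite in every dimension, so the union still has infinite mass. -/
theorem exists_le_tailMass (hA2 : CondA2 j) (L : ℝ≥0) :
    ∃ r₀ > 0, ∀ r ≤ r₀, (L : ℝ≥0∞) ≤ tailMass j r := by
  have hU : (⋃ n : ℕ, (Metric.ball (0 : RN N) (1 / (n + 1 : ℝ)))ᶜ) = {0}ᶜ := by
    ext z
    simp only [mem_iUnion, mem_compl_iff, Metric.mem_ball, dist_zero_right, not_lt,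
      mem_singleton_iff]
    constructor
    · rintro ⟨n, hn⟩ rfl
      rw [norm_zero] at hn
      exact absurd hn (not_le.2 (by positivity))
    · intro hz
      obtain ⟨n, hn⟩ := exists_nat_one_div_lt (norm_pos_iff.2 hz)
      exact ⟨n, hn.le⟩
  have hmono : Monotone fun n : ℕ => (Metric.ball (0 : RN N) (1 / (n + 1 : ℝ)))ᶜ := by
    intro n m hnm
    refine compl_subset_compl.2 (Metric.ball_subset_ball ?_)
    gcongr
  set ν : Measure (RN N) := volume.withDensity fun z => (j z : ℝ≥0∞) with hν
  have hlim := tendsto_measure_iUnion_atTop (μ := ν) hmono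
  have hinf : ν {0}ᶜ = ∞ := by
    rw [hν, withDensity_apply _ (measurableSet_singleton _).compl]
    have h := lintegral_add_compl (μ := volume) (fun z => (j z : ℝ≥0∞))
      (measurableSet_singleton (0 : RN N))
    rw [hA2] at h
    by_contra hne
    refine ENNReal.add_ne_top.2 ⟨?_, hne⟩ h
    rw [lintegral_singleton]
    exact ENNReal.mul_ne_top ENNReal.coe_ne_top (isCompact_singleton.measure_lt_top.ne)
  rw [hU, hinf] at hlim
  obtain ⟨n, hn⟩ := (hlim.eventually (lt_mem_nhds (ENNReal.coe_lt_top (r := L)))).exists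
  refine ⟨1 / (n + 1 : ℝ), by positivity, fun r hr => hn.le.trans ?_⟩
  simp only [hν, Function.comp_apply]
  rw [withDensity_apply _ Metric.isOpen_ball.measurableSet.compl]
  exact tailMass_anti hr

/-- On `|z| < ρ/2` the weight `|z|/ρ` doubles exactly when `ρ` is halved; only the longer jumps
spoil the doubling, and the tail pays for them. -/
theorem two_scaleMass_le (hj : Measurable j) {ρ : ℝ} (hρ : 0 < ρ) :
    2 * scaleMass j ρ ≤ scaleMass j (ρ / 2) + 2 * tailMass j (ρ / 2) := by
  rw [← lintegral_cutKernel, scaleMass, scaleMass, ← lintegral_const_mul' _ _ (by simp),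
    ← lintegral_const_mul' _ _ (by simp), ← lintegral_add_left (by fun_prop)]
  refine lintegral_mono fun z => ?_
  have h2 : ∀ t : ℝ, (2 : ℝ≥0∞) * ENNReal.ofReal t = ENNReal.ofReal (2 * t) := fun t => by
    rw [ENNReal.ofReal_mul (by norm_num)]; simp
  by_cases hz : z ∈ (Metric.ball (0 : RN N) (ρ / 2))ᶜ
  · have hc : cutKernel j (ρ / 2) z = j z := by simp [cutKernel, indicator, hz]
    rw [hc]
    refine le_add_left ?_
    gcongr
    calc ENNReal.ofReal (min 1 (‖z‖ / ρ)) * (j z : ℝ≥0∞) ≤ 1 * (j z : ℝ≥0∞) := by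
          gcongr
          simp
      _ = j z := one_mul _
  · have hz' : ‖z‖ < ρ / 2 := by simpa using hz
    refine le_add_right ?_
    rw [← mul_assoc, h2]
    gcongr
    refine le_min ?_ ?_
    · calc 2 * min 1 (‖z‖ / ρ) ≤ 2 * (‖z‖ / ρ) := by gcongr; exact min_le_right _ _
        _ ≤ 2 * ((ρ / 2) / ρ) := by gcongr
        _ = 1 := by field_simp
    · calc 2 * min 1 (‖z‖ / ρ) ≤ 2 * (‖z‖ / ρ) := by gcongr; exact min_le_right _ _
        _ = ‖z‖ / (ρ / 2) := by field_simp

/-- At arbitrarily small scales `ρ`, the mass of `min(1, |z|/ρ) j(z)` is controlled by the mass of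
`j` outside the ball of radius `2ρ`. -/
theorem exists_scaleMass_le_tailMass (hj : Measurable j) {γ : ℝ} (hγ0 : 0 < γ) (hγ1 : γ < 1)
    (hA1 : CondA1 γ j) (hA2 : CondA2 j) :
    ∃ C : ℝ, 0 < C ∧ ∀ ρ₀ > 0, ∃ ρ, 0 < ρ ∧ ρ < ρ₀ ∧
      scaleMass j ρ ≤ ENNReal.ofReal C * tailMass j (2 * ρ) := by
  have h2γ : (2 : ℝ) ^ γ < 2 := by
    simpa using Real.rpow_lt_rpow_of_exponent_lt (x := 2) (by norm_num) hγ1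
  have h2γ0 : 0 < (2 : ℝ) ^ γ := by positivity
  -- Any growth rate strictly between `2 ^ γ` and `2` would do.
  set l : ℝ := (2 + 2 ^ γ) / 2 with hl
  have hl0 : 0 < l := by positivity
  have hl2 : l < 2 := by linarith
  -- Chosen so that a tail of size at most `2 g (k + 1) / C` reduces the doubling factor `2` only to
  -- `l`.
  set C : ℝ := 4 / (2 / l - 1) with hC
  have hden : 0 < 2 / l - 1 := by rw [sub_pos, one_lt_div hl0]; exact hl2
  have hC0 : 0 < C := by positivity
  refine ⟨C, hC0, fun ρ₀ hρ₀ => ?_⟩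
  by_contra! hcon
  obtain ⟨r₀, hr₀, htail⟩ := exists_le_tailMass hA2 1
  set s : ℝ := min (min r₀ 1) (ρ₀ / 2) with hs
  have hs0 : 0 < s := lt_min (lt_min hr₀ one_pos) (by positivity)
  have hs1 : s ≤ 1 := (min_le_left _ _).trans (min_le_right _ _)
  have hsr : s ≤ r₀ := (min_le_left _ _).trans (min_le_left _ _)
  have hsρ : s < ρ₀ := (min_le_right _ _).trans_lt (by linarith)
  set g : ℕ → ℝ := fun k => (scaleMass j (s / 2 ^ k)).toReal with hg
  have hfin : ∀ k : ℕ, scaleMass j (s / 2 ^ k) ≠ ∞ := fun k =>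
    (scaleMass_lt_top hγ0 hγ1 hA1 (by positivity)).ne
  have htfin : ∀ k : ℕ, tailMass j (s / 2 ^ k) ≠ ∞ := fun k =>
    (tailMass_lt_top hγ0 hγ1 hA1 (by positivity)).ne
  have hle : ∀ k : ℕ, s / 2 ^ k ≤ s := fun k => div_le_self hs0.le (one_le_pow₀ (by norm_num))
  have hhalf : ∀ k : ℕ, s / 2 ^ (k + 1) = s / 2 ^ k / 2 := fun k => by
    rw [pow_succ]; field_simp
  have hstep1 : ∀ k, g (k + 1) ≤ 2 * g k := by
    intro k
    have h := scaleMass_mul_le (j := j) (c := 1 / 2) (ρ := s / 2 ^ k) (by norm_num) (by norm_num)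
      (by positivity)
    have e : 1 / 2 * (s / 2 ^ k) = s / 2 ^ (k + 1) := by rw [hhalf]; ring
    rw [e] at h
    have h' := ENNReal.toReal_mono (ENNReal.mul_ne_top ENNReal.ofReal_ne_top (hfin k)) h
    rw [ENNReal.toReal_mul, ENNReal.toReal_ofReal (by norm_num)] at h'
    simpa [hg] using h'
  have hstep2 : ∀ k, 2 * g k ≤ g (k + 1) + 2 * (tailMass j (s / 2 ^ (k + 1))).toReal := by
    intro k
    have h := two_scaleMass_le hj (ρ := s / 2 ^ k) (by positivity)
    rw [← hhalf] at h
    have h' := ENNReal.toReal_mono (ENNReal.add_ne_top.2 ⟨hfin (k + 1),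
      ENNReal.mul_ne_top (by simp) (htfin (k + 1))⟩) h
    rw [ENNReal.toReal_mul, ENNReal.toReal_add (hfin (k + 1))
      (ENNReal.mul_ne_top (by simp) (htfin (k + 1))), ENNReal.toReal_mul] at h'
    simpa [hg] using h'
  have hstep3 : ∀ k, C * (tailMass j (s / 2 ^ k)).toReal ≤ g (k + 1) := by
    intro k
    have h := hcon (s / 2 ^ (k + 1)) (by positivity) ((hle _).trans_lt hsρ)
    have e : 2 * (s / 2 ^ (k + 1)) = s / 2 ^ k := by rw [hhalf]; ring
    rw [e] at h
    have h' := ENNReal.toReal_mono (hfin (k + 1)) h.le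
    rwa [ENNReal.toReal_mul, ENNReal.toReal_ofReal hC0.le] at h'
  have hgrow : ∀ k, l * g k ≤ g (k + 1) := by
    intro k
    have h1 := hstep2 k
    have h2 := hstep3 (k + 1)
    have h3 := hstep1 (k + 1)
    have h4 : (tailMass j (s / 2 ^ (k + 1))).toReal ≤ 2 * g (k + 1) / C := by
      rw [le_div_iff₀ hC0]; linarith
    have h5 : 2 * g k ≤ g (k + 1) * (2 / l) := by
      have : 2 * (2 * g (k + 1) / C) = g (k + 1) * (2 / l - 1) := by
        rw [hC]; field_simp; ring
      nlinarith
    rw [mul_div_assoc', le_div_iff₀ hl0] at h5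
    linarith
  have hlow : ∀ k, l ^ k * g 0 ≤ g k := by
    intro k
    induction k with
    | zero => simp
    | succ k ih =>
      calc l ^ (k + 1) * g 0 = l * (l ^ k * g 0) := by ring
        _ ≤ l * g k := by gcongr
        _ ≤ g (k + 1) := hgrow k
  have hg0 : 1 ≤ g 0 := by
    have h := (htail s hsr).trans (tailMass_le_scaleMass hs0)
    have h' := ENNReal.toReal_mono (by simpa using hfin 0) h
    simpa [hg] using h'
  set A : ℝ := (s⁻¹) ^ γ * (∫⁻ z, ENNReal.ofReal (min 1 (‖z‖ ^ γ)) * (j z : ℝ≥0∞)).toReal with hA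
  have hup : ∀ k, g k ≤ A * ((2 : ℝ) ^ γ) ^ k := by
    intro k
    have h := scaleMass_le_rpow (j := j) hγ0 hγ1 (ρ := s / 2 ^ k) (by positivity)
      ((hle k).trans hs1)
    have h' := ENNReal.toReal_mono (ENNReal.mul_ne_top ENNReal.ofReal_ne_top hA1.ne) h
    rw [ENNReal.toReal_mul, ENNReal.toReal_ofReal (by positivity)] at h'
    refine h'.trans (le_of_eq ?_)
    have e : ((s / 2 ^ k)⁻¹) ^ γ = (s⁻¹) ^ γ * ((2 : ℝ) ^ γ) ^ k := by
      rw [inv_div, div_eq_inv_mul, Real.mul_rpow (by positivity) (by positivity),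
        ← Real.rpow_natCast, ← Real.rpow_natCast, ← Real.rpow_mul (by norm_num),
        ← Real.rpow_mul (by norm_num), mul_comm (k : ℝ)]
    rw [e, hA]; ring
  have hq : 1 < l / 2 ^ γ := by rw [one_lt_div h2γ0]; linarith
  -- Growth like `l ^ k` from below is incompatible with `(2 ^ γ) ^ k` from above.
  obtain ⟨k, hk⟩ := pow_unbounded_of_one_lt A hq
  rw [div_pow, lt_div_iff₀ (by positivity)] at hk
  have h1 := hlow k
  have h2 := hup k
  have h3 : l ^ k * 1 ≤ l ^ k * g 0 := by gcongr
  linarith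

/-- The coalescence alternative under the annular doubling condition. -/
theorem coalescence_of_condA31 (hjm : Measurable j) {σ R₀ : ℝ} {c₀ : ℝ≥0} (hσ0 : 0 < σ) (hσ1 : σ < 1)
    (h : ∀ z y : RN N, z ≠ 0 → y ≠ 0 → ‖z‖ < R₀ → ‖y‖ < R₀ →
      1 - σ ≤ ‖z‖ / ‖y‖ → ‖z‖ / ‖y‖ ≤ 1 + σ → c₀ * j y ≤ j z ∧ j z ≤ c₀⁻¹ * j y)
    (hc : c₀ < 1) {ρ : ℝ} (hρ : 0 < ρ) (hρR : ρ < R₀ / 4) {x : RN N}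
    (hx : ‖x‖ ≤ σ * ρ) :
    (c₀ : ℝ≥0∞) * tailMass j (2 * ρ) ≤
      (∫⁻ z, ((min (cutKernel j ρ z) (cutKernel j ρ (z + x)) : ℝ≥0) : ℝ≥0∞)) +
        tailMass j (R₀ / 2) := by
  have hxρ : ‖x‖ ≤ ρ := hx.trans (by nlinarith)
  rw [← lintegral_cutKernel, ← lintegral_const_mul' _ _ (by simp), tailMass,
    ← lintegral_indicator Metric.isOpen_ball.measurableSet.compl]
  have hmin : Measurable fun z =>
      ((min (cutKernel j ρ z) (cutKernel j ρ (z + x)) : ℝ≥0) : ℝ≥0∞) :=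
    ((measurable_cutKernel hjm ρ).min
      ((measurable_cutKernel hjm ρ).comp (measurable_id.add_const x))).coe_nnreal_ennreal
  rw [← lintegral_add_left hmin]
  refine lintegral_mono fun z => ?_
  by_cases hz : z ∈ (Metric.ball (0 : RN N) (2 * ρ))ᶜ
  · have hz2 : 2 * ρ ≤ ‖z‖ := by simpa using hz
    have e : cutKernel j (2 * ρ) z = j z := by simp [cutKernel, indicator, hz]
    have e1 : cutKernel j ρ z = j z := by
      have : ¬ ‖z‖ < ρ := by push Not; linarith
      simp [cutKernel, indicator, this]
    rw [e]
    by_cases hzR : z ∈ (Metric.ball (0 : RN N) (R₀ / 2))ᶜ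
    · rw [indicator_of_mem hzR]
      refine le_add_left ?_
      rw [← ENNReal.coe_mul]
      exact ENNReal.coe_le_coe.2 (mul_le_of_le_one_left zero_le hc.le)
    · have hzR' : ‖z‖ < R₀ / 2 := by simpa using hzR
      have hzx : ρ ≤ ‖z + x‖ := by
        have := norm_sub_norm_le z (-x)
        rw [sub_neg_eq_add, norm_neg] at this
        linarith
      have hzx' : ‖z + x‖ ≤ ‖z‖ + ‖x‖ := norm_add_le _ _
      have e2 : cutKernel j ρ (z + x) = j (z + x) := by
        have : ¬ ‖z + x‖ < ρ := by push Not; linarith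
        simp [cutKernel, indicator, this]
      have hz0 : 0 < ‖z‖ := by linarith
      have hlow : ‖z‖ - ‖x‖ ≤ ‖z + x‖ := by
        have := norm_sub_norm_le z (-x)
        rwa [sub_neg_eq_add, norm_neg] at this
      -- Since `|x| ≤ σρ ≤ σ|z|`, the ratio of `|z + x|` to `|z|` lies in the range of the annular
      -- condition.
      have hxz : ‖x‖ ≤ σ * ‖z‖ := hx.trans (by nlinarith)
      have hj := (h (z + x) z (norm_pos_iff.1 (by linarith)) (norm_pos_iff.1 hz0) (by linarith)
        (by linarith) (by rw [le_div_iff₀ hz0]; nlinarith) (by rw [div_le_iff₀ hz0]; nlinarith)).1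
      rw [e1, e2]
      refine le_add_right ?_
      rw [← ENNReal.coe_mul]
      exact ENNReal.coe_le_coe.2 (le_min (mul_le_of_le_one_left zero_le hc.le) hj)
  · have e : cutKernel j (2 * ρ) z = 0 := by
      simp only [cutKernel, indicator, hz, if_false]
    rw [e]
    simp

end JumpMass

/-! ### Mollification as averaging of translates. -/

section Mollification

variable {N : ℕ}

/-- Mollification of a bounded measurable function with compact support, written as an average of
translates. -/
theorem exists_mollification {φ : RN N → ℝ} (hφ : Measurable φ) {b : ℝ} (hb : ∀ x, |φ x| ≤ b)
    {S : Set (RN N)} (hS : IsCompact S) (hφS : ∀ x ∉ S, φ x = 0) {δ : ℝ} (hδ : 0 < δ) :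
    ∃ (ψ : ℕ → RN N → ℝ) (P : ℕ → Measure (RN N)),
      (∀ n, IsProbabilityMeasure (P n)) ∧ (∀ n, ContDiff ℝ ((⊤ : ℕ∞) : WithTop ℕ∞) (ψ n)) ∧
      (∀ n x, ψ n x = ∫ t, φ (x - t) ∂P n) ∧ (∀ n x, |ψ n x| ≤ b) ∧
      (∀ n, tsupport (ψ n) ⊆ Metric.cthickening δ S) ∧ (∀ n, HasCompactSupport (ψ n)) ∧
      ∀ᵐ x, Tendsto (fun n => ψ n x) atTop (𝓝 (φ x)) := by
  have hφint : Integrable φ := by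
    refine Integrable.mono' (g := S.indicator fun _ => b) ?_ hφ.aestronglyMeasurable ?_
    · exact (integrable_indicator_iff hS.measurableSet).2 (integrableOn_const hS.measure_lt_top.ne)
    · refine Eventually.of_forall fun x => ?_
      by_cases hx : x ∈ S
      · simpa [hx] using hb x
      · simp [hx, hφS x hx]
  -- The ratio of outer to inner radius stays equal to `2`; this is what gives convergence almost
  -- everywhere for a merely integrable function.
  set f : ℕ → ContDiffBump (0 : RN N) := fun n =>
    ⟨δ / (n + 1) / 2, δ / (n + 1), by positivity, half_lt_self (by positivity)⟩ with hf
  have hP : ∀ n, ∀ F : RN N → ℝ, ∫ t, F t ∂(volume.withDensity fun t =>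
      ENNReal.ofReal ((f n).normed volume t)) = ∫ t, (f n).normed volume t * F t := by
    intro n F
    rw [integral_withDensity_eq_integral_toReal_smul
      ((f n).continuous_normed.measurable.ennreal_ofReal)
      (Eventually.of_forall fun _ => ENNReal.ofReal_lt_top)]
    refine integral_congr_ae (Eventually.of_forall fun t => ?_)
    simp only [smul_eq_mul]
    rw [ENNReal.toReal_ofReal ((f n).nonneg_normed t)]
  have hprob : ∀ n, IsProbabilityMeasure (volume.withDensity fun t =>
      ENNReal.ofReal ((f n).normed volume t)) := by
    intro n
    refine ⟨?_⟩
    rw [withDensity_apply _ MeasurableSet.univ, setLIntegral_univ,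
      ← ofReal_integral_eq_lintegral_ofReal (f n).integrable_normed
        (Eventually.of_forall (f n).nonneg_normed), (f n).integral_normed, ENNReal.ofReal_one]
  have heq : ∀ n x, convolution ((f n).normed volume) φ (ContinuousLinearMap.lsmul ℝ ℝ) volume x =
      ∫ t, φ (x - t) ∂(volume.withDensity fun t => ENNReal.ofReal ((f n).normed volume t)) := by
    intro n x
    rw [hP]
    rfl
  have hsupp : ∀ n, Function.support
      (convolution ((f n).normed volume) φ (ContinuousLinearMap.lsmul ℝ ℝ) volume) ⊆
        Metric.cthickening δ S := by
    intro n x hx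
    obtain ⟨t, ht, y, hy, rfl⟩ := support_convolution_subset _ hx
    have hyS : y ∈ S := by
      by_contra h
      exact hy (hφS y h)
    rw [(f n).support_normed_eq, mem_ball_zero_iff] at ht
    refine Metric.mem_cthickening_of_dist_le _ y _ _ hyS ?_
    rw [dist_eq_norm]
    simp only [add_sub_cancel_right]
    exact ht.le.trans (div_le_self hδ.le (by simp))
  have htsupp : ∀ n, tsupport
      (convolution ((f n).normed volume) φ (ContinuousLinearMap.lsmul ℝ ℝ) volume) ⊆
        Metric.cthickening δ S := fun n =>
    closure_minimal (hsupp n) Metric.isClosed_cthickening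
  refine ⟨fun n => convolution ((f n).normed volume) φ (ContinuousLinearMap.lsmul ℝ ℝ) volume,
    fun n => volume.withDensity fun t => ENNReal.ofReal ((f n).normed volume t), hprob,
    fun n => ?_, heq, fun n x => ?_, htsupp, fun n => ?_, ?_⟩
  · exact (f n).hasCompactSupport_normed.contDiff_convolution_left _ (f n).contDiff_normed
      hφint.locallyIntegrable
  · beta_reduce
    rw [heq]
    have := hprob n
    simpa using norm_integral_le_of_norm_le_const (C := b) (f := fun t => φ (x - t))
      (μ := volume.withDensity fun t => ENNReal.ofReal ((f n).normed volume t))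
      (Eventually.of_forall fun t => hb (x - t))
  · exact hS.cthickening.of_isClosed_subset (isClosed_tsupport _) (htsupp n)
  · refine ContDiffBump.ae_convolution_tendsto_right_of_locallyIntegrable (K := 2) ?_ ?_
      hφint.locallyIntegrable
    · simp only [hf]
      exact tendsto_const_div_atTop_nhds_zero_nat δ |>.comp (tendsto_add_atTop_nat 1) |>.congr
        fun n => by simp
    · refine Eventually.of_forall fun n => ?_
      simp only [hf]
      exact le_of_eq (by ring)

end Mollification

/-! ### Increments in `L¹` and total variation. -/

section Variation

variable {N : ℕ}

/-- The average of `φ` over the segment from `x - h` to `x` is `C¹` and its derivative in the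
direction `h` is the increment of `φ`. -/
theorem contDiff_segment_average {φ : RN N → ℝ} (hφ : ContDiff ℝ 1 φ) (h : RN N) :
    ContDiff ℝ 1 (fun x => ∫ t in (0 : ℝ)..1, φ (x - t • h)) ∧
      ∀ x, fderiv ℝ (fun x => ∫ t in (0 : ℝ)..1, φ (x - t • h)) x h = φ x - φ (x - h) := by
  have hd : Continuous (fderiv ℝ φ) := hφ.continuous_fderiv one_ne_zero
  have hder : ∀ x, HasFDerivAt (fun x => ∫ t in (0 : ℝ)..1, φ (x - t • h))
      (∫ t in (0 : ℝ)..1, fderiv ℝ φ (x - t • h)) x := by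
    intro x
    have hc : Continuous fun p : RN N × ℝ => fderiv ℝ φ (p.1 - p.2 • h) := by fun_prop
    obtain ⟨b, hb⟩ := ((isCompact_closedBall x 1).prod (isCompact_Icc (a := (0 : ℝ)) (b := 1))
      ).exists_bound_of_continuousOn hc.continuousOn
    have hbs := (intervalIntegral.hasFDerivAt_integral_of_dominated_of_fderiv_le (𝕜 := ℝ)
      (μ := volume) (a := (0 : ℝ)) (b := 1) (F := fun x t => φ (x - t • h))
      (F' := fun x t => fderiv ℝ φ (x - t • h)) (x₀ := x) (s := Metric.ball x 1)
      (bound := fun _ => b) (Metric.ball_mem_nhds x one_pos) ?_ ?_ ?_ ?_ ?_ ?_)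
    · exact hbs
    · refine Eventually.of_forall fun y => Continuous.aestronglyMeasurable ?_
      have := hφ.continuous
      fun_prop
    · have := hφ.continuous
      exact Continuous.intervalIntegrable (by fun_prop) _ _
    · exact Continuous.aestronglyMeasurable (by fun_prop)
    · refine Eventually.of_forall fun t ht y hy => hb (y, t) ⟨Metric.ball_subset_closedBall hy, ?_⟩
      rw [uIoc_of_le zero_le_one] at ht
      exact ⟨ht.1.le, ht.2⟩
    · exact intervalIntegrable_const
    · refine Eventually.of_forall fun t _ y _ => ?_
      have h1 := ((hφ.differentiable one_ne_zero) (y - t • h)).hasFDerivAt.comp y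
        ((hasFDerivAt_id y).sub_const (t • h))
      simpa [Function.comp_def] using h1
  refine ⟨contDiff_one_iff_hasFDerivAt.2 ⟨_, ?_, hder⟩, fun x => ?_⟩
  · exact intervalIntegral.continuous_parametric_intervalIntegral_of_continuous' (by fun_prop) 0 1
  · rw [(hder x).fderiv, ContinuousLinearMap.intervalIntegral_apply
      (Continuous.intervalIntegrable (by fun_prop) _ _)]
    have hft : ∀ t ∈ uIcc (0 : ℝ) 1, HasDerivAt (fun t : ℝ => -φ (x - t • h))
        (fderiv ℝ φ (x - t • h) h) t := by
      intro t _
      have h1 : HasDerivAt (fun t : ℝ => x - t • h) (-h) t := by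
        simpa using ((hasDerivAt_id t).smul_const h).const_sub x
      have h2 := (((hφ.differentiable one_ne_zero) (x - t • h)).hasFDerivAt.comp_hasDerivAt t h1).neg
      simpa [Function.comp_def, Pi.neg_def] using h2
    rw [intervalIntegral.integral_eq_sub_of_hasDerivAt hft
      (Continuous.intervalIntegrable (by fun_prop) _ _)]
    simp
    ring

/-- The `L¹` norm of an increment is bounded by the total variation. -/
theorem lintegral_increment_le_totalVar {g : RN N → ℝ} (hg : Measurable g) {U V : Set (RN N)}
    (hU : IsOpen U) (hgU : IntegrableOn g U) (hV : IsCompact V) {δ : ℝ} (hδ : 0 < δ) {h : RN N}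
    (hVU : ∀ z ∈ Metric.cthickening δ V, ∀ t ∈ Icc (0 : ℝ) 1, z + t • h ∈ U) :
    ∫⁻ z in V, ENNReal.ofReal |g (z + h) - g z| ≤ ENNReal.ofReal ‖h‖ * totalVar g U := by
  rcases eq_or_ne h 0 with rfl | hh
  · simp
  have hh0 : 0 < ‖h‖ := norm_pos_iff.2 hh
  set W := Metric.cthickening δ V with hW
  have hWc : IsCompact W := hV.cthickening
  have hVW : V ⊆ W := Metric.self_subset_cthickening V
  set G : RN N → ℝ := U.indicator g with hG
  have hGint : Integrable G := (integrable_indicator_iff hU.measurableSet).2 hgU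
  have hGm : Measurable G := hg.indicator hU.measurableSet
  set D : RN N → ℝ := fun z => G (z + h) - G z with hD
  have hDint : Integrable D := (hGint.comp_add_right h).sub hGint
  have hDm : Measurable D := (hGm.comp (measurable_id.add_const h)).sub hGm
  have hDeq : ∀ z ∈ W, D z = g (z + h) - g z := by
    intro z hz
    have h0 := hVU z hz 0 (by simp)
    have h1 := hVU z hz 1 (by simp)
    rw [zero_smul, add_zero] at h0
    rw [one_smul] at h1
    simp [hD, hG, h0, h1]
  -- Duality: `D * s` is `|D|` on `V`. The sign is then mollified so that it can enter an admissible
  -- vector field.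
  set s : RN N → ℝ := V.indicator fun z => if 0 ≤ D z then 1 else -1 with hs
  have hsm : Measurable s := by
    refine Measurable.indicator ?_ hV.measurableSet
    exact Measurable.ite (measurableSet_le measurable_const hDm) measurable_const measurable_const
  have hsb : ∀ z, |s z| ≤ 1 := by
    intro z
    by_cases hz : z ∈ V
    · simp only [hs, indicator_of_mem hz]
      split_ifs <;> simp
    · simp [hs, hz]
  obtain ⟨ψ, P, -, hψ, -, hψb, hψs, hψc, hψlim⟩ := exists_mollification hsm hsb hV
    (fun x hx => indicator_of_notMem hx _) hδ
  have key : ∀ n, ENNReal.ofReal (∫ z, D z * ψ n z) ≤ ENNReal.ofReal ‖h‖ * totalVar g U := by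
    intro n
    have hψ1 : ContDiff ℝ 1 (ψ n) := (hψ n).of_le (mod_cast le_top)
    obtain ⟨hA1, hA2⟩ := contDiff_segment_average hψ1 h
    set A : RN N → ℝ := fun x => ∫ t in (0 : ℝ)..1, ψ n (x - t • h) with hA
    -- Directed along `h`, with the segment average as coefficient: its divergence is a finite
    -- difference of `ψ n` with step `h` divided by `‖h‖`, and averaging preserves the bound `1`.
    set w : RN N → RN N := fun x => (-‖h‖⁻¹ * A x) • h with hw
    have hAb : ∀ x, |A x| ≤ 1 := by
      intro x
      have := intervalIntegral.norm_integral_le_of_norm_le_const (a := (0 : ℝ)) (b := 1) (C := 1)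
        (f := fun t => ψ n (x - t • h)) (fun t _ => hψb n _)
      simpa using this
    have hwd : ContDiff ℝ 1 w := (contDiff_const.mul hA1).smul contDiff_const
    set W' : Set (RN N) := (fun p : RN N × ℝ => p.1 + p.2 • h) '' (W ×ˢ Icc (0 : ℝ) 1) with hW'
    have hW'c : IsCompact W' := (hWc.prod isCompact_Icc).image (by fun_prop)
    have hW'U : W' ⊆ U := by
      rintro _ ⟨⟨z, t⟩, ⟨hz, ht⟩, rfl⟩
      exact hVU z hz t ht
    have hwsupp : Function.support w ⊆ W' := by
      intro x hx
      by_contra hxW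
      refine hx ?_
      have : A x = 0 := by
        simp only [hA]
        refine (intervalIntegral.integral_congr (g := fun _ => 0) fun t ht => ?_).trans (by simp)
        rw [uIcc_of_le zero_le_one] at ht
        refine image_eq_zero_of_notMem_tsupport fun hmem => hxW ?_
        exact ⟨(x - t • h, t), ⟨hψs n hmem, ht⟩, by simp⟩
      simp [hw, this]
    have hwts : tsupport w ⊆ W' := closure_minimal hwsupp hW'c.isClosed
    have hwc : HasCompactSupport w := hW'c.of_isClosed_subset (isClosed_tsupport _) hwts
    have hwb : ∀ x, ‖w x‖ ≤ 1 := by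
      intro x
      simp only [hw, norm_smul, norm_mul, norm_neg, norm_inv, abs_norm, Real.norm_eq_abs]
      calc ‖h‖⁻¹ * |A x| * ‖h‖ = |A x| := by field_simp
        _ ≤ 1 := hAb x
    have hdiv : ∀ x, divergence w x = ‖h‖⁻¹ * (ψ n (x - h) - ψ n x) := by
      intro x
      have hAd : HasFDerivAt A (fderiv ℝ A x) x :=
        ((hA1.differentiable one_ne_zero) x).hasFDerivAt
      have h1 := ((hAd.const_mul (-‖h‖⁻¹)).smul_const h).fderiv
      have e : ∀ i : Fin N, (fderiv ℝ w x (EuclideanSpace.single i 1)) i =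
          -‖h‖⁻¹ * (fderiv ℝ A x (h i • EuclideanSpace.single i 1)) := by
        intro i
        have h1' : fderiv ℝ w x = _ := h1
        rw [h1']
        simp
        ring
      have hsum : ∑ i : Fin N, h i • EuclideanSpace.single i (1 : ℝ) = h := by
        ext k
        simp [Finset.sum_apply, Pi.single_apply]
      rw [divergence, Finset.sum_congr rfl fun i _ => e i, ← Finset.mul_sum, ← map_sum, hsum, hA2]
      ring
    have hle : ENNReal.ofReal (∫ x in U, g x * divergence w x) ≤ totalVar g U :=
      le_iSup₂_of_le w ⟨hwd, hwc, hwts.trans hW'U, hwb⟩ le_rfl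
    -- A translation by `h` moves the finite difference from `ψ n` onto `G`.
    have hint : ∫ x in U, g x * divergence w x = ‖h‖⁻¹ * ∫ z, D z * ψ n z := by
      have hψm := (hψ n).continuous.aestronglyMeasurable (μ := (volume : Measure (RN N)))
      have i1 : Integrable fun z => G z * ψ n z :=
        hGint.mul_bdd (c := 1) hψm (Eventually.of_forall (hψb n))
      have i2 : Integrable fun z => G (z + h) * ψ n z :=
        (hGint.comp_add_right h).mul_bdd (c := 1) hψm (Eventually.of_forall (hψb n))
      have i3 : Integrable fun z => G z * ψ n (z - h) := by
        simpa using i2.comp_sub_right h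
      have e1 : ∫ z, G (z + h) * ψ n z = ∫ z, G z * ψ n (z - h) := by
        rw [← integral_sub_right_eq_self (fun z => G (z + h) * ψ n z) h]
        simp
      have e2 : ∫ z, D z * ψ n z = ∫ z, G z * (ψ n (z - h) - ψ n z) := by
        simp only [hD, sub_mul, mul_sub]
        rw [integral_sub i2 i1, integral_sub i3 i1, e1]
      rw [e2, ← integral_const_mul, ← integral_indicator hU.measurableSet]
      refine integral_congr_ae (Eventually.of_forall fun z => ?_)
      by_cases hz : z ∈ U
      · simp only [indicator_of_mem hz, hG, hdiv]; ring
      · simp [indicator_of_notMem hz, hG]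
    rw [hint, ENNReal.ofReal_mul (by positivity)] at hle
    calc ENNReal.ofReal (∫ z, D z * ψ n z)
        = ENNReal.ofReal ‖h‖ * (ENNReal.ofReal ‖h‖⁻¹ * ENNReal.ofReal (∫ z, D z * ψ n z)) := by
          rw [← mul_assoc, ← ENNReal.ofReal_mul (by positivity), mul_inv_cancel₀ hh0.ne',
            ENNReal.ofReal_one, one_mul]
      _ ≤ _ := by gcongr
  have hlim : Tendsto (fun n => ∫ z, D z * ψ n z) atTop (𝓝 (∫ z, D z * s z)) := by
    refine tendsto_integral_of_dominated_convergence (fun z => |D z|) (fun n => ?_) hDint.abs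
      (fun n => Eventually.of_forall fun z => ?_) ?_
    · exact hDm.aestronglyMeasurable.mul (hψ n).continuous.aestronglyMeasurable
    · rw [Real.norm_eq_abs, abs_mul]
      exact mul_le_of_le_one_right (abs_nonneg _) (hψb n z)
    · filter_upwards [hψlim] with z hz using hz.const_mul _
  have hfin := le_of_tendsto (ENNReal.tendsto_ofReal hlim) (Eventually.of_forall key)
  refine le_trans (le_of_eq ?_) hfin
  have e : ∀ z, D z * s z = V.indicator (fun z => |g (z + h) - g z|) z := by
    intro z
    by_cases hz : z ∈ V
    · rw [indicator_of_mem hz, ← hDeq z (hVW hz)]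
      simp only [hs, indicator_of_mem hz]
      split_ifs with h0
      · rw [mul_one, abs_of_nonneg h0]
      · rw [abs_of_neg (not_le.1 h0)]; ring
    · simp [hs, hz]
  simp_rw [e]
  rw [integral_indicator hV.measurableSet, ofReal_integral_eq_lintegral_ofReal ?_
    (Eventually.of_forall fun _ => abs_nonneg _)]
  refine (integrableOn_congr_fun (fun z hz => ?_) hV.measurableSet).1 hDint.abs.integrableOn
  simp only [hDeq z (hVW hz)]

end Variation

/-! ### Coalescence under bounded variation, and the choice of good scales. -/

section Coalescence

variable {N : ℕ} {j : RN N → ℝ≥0}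

/-- The coalescence alternative under the bounded variation condition. -/
theorem coalescence_of_condA32 (hjm : Measurable j) {M R₀ : ℝ}
    (h : ∀ r R : ℝ, 0 < r → r < R → R < R₀ →
      totalVar (fun z => (j z : ℝ)) (Metric.ball (0 : RN N) R \ Metric.closedBall 0 r) ≤
        ENNReal.ofReal (M / r) * ∫⁻ z in (Metric.ball (0 : RN N) r)ᶜ, (j z : ℝ≥0∞))
    {θ : ℝ} (hθ : 0 < θ) (hθ1 : θ ≤ 1 / 4)
    {ρ : ℝ} (hρ : 0 < ρ) (hρR : ρ < R₀ / 4) (hfin : tailMass j ρ < ∞) {x : RN N}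
    (hx : ‖x‖ ≤ θ * ρ) :
    tailMass j (2 * ρ) ≤
      (∫⁻ z, ((min (cutKernel j ρ z) (cutKernel j ρ (z + x)) : ℝ≥0) : ℝ≥0∞)) +
        (tailMass j (R₀ / 2) + ENNReal.ofReal (θ * M) * tailMass j ρ) := by
  have hxρ : ‖x‖ ≤ ρ / 4 := hx.trans (by nlinarith)
  have hgm : Measurable fun z => (j z : ℝ) := hjm.coe_nnreal_real
  set V : Set (RN N) := Metric.closedBall 0 (R₀ / 2) ∩ (Metric.ball 0 (2 * ρ))ᶜ with hV
  have hVc : IsCompact V := (isCompact_closedBall _ _).inter_right Metric.isOpen_ball.isClosed_compl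
  -- The gap between `V` and `U` leaves room for a thickening by `ρ/4` followed by a shift of length
  -- at most `ρ/4`.
  set U : Set (RN N) := Metric.ball 0 (3 * R₀ / 4) \ Metric.closedBall 0 ρ with hU
  have hUo : IsOpen U := Metric.isOpen_ball.sdiff Metric.isClosed_closedBall
  have hVU : ∀ z ∈ Metric.cthickening (ρ / 4) V, ∀ t ∈ Icc (0 : ℝ) 1, z + t • x ∈ U := by
    intro z hz t ht
    rw [hVc.cthickening_eq_biUnion_closedBall (by positivity)] at hz
    simp only [mem_iUnion, Metric.mem_closedBall, exists_prop] at hz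
    obtain ⟨y, ⟨hy1, hy2⟩, hzy⟩ := hz
    rw [mem_closedBall_zero_iff] at hy1
    have hy2' : 2 * ρ ≤ ‖y‖ := by simpa using hy2
    rw [dist_eq_norm] at hzy
    have htx : ‖t • x‖ ≤ ρ / 4 := by
      rw [norm_smul, Real.norm_eq_abs, abs_of_nonneg ht.1]
      exact (mul_le_of_le_one_left (norm_nonneg _) ht.2).trans hxρ
    have hd : ‖(z + t • x) - y‖ ≤ ρ / 2 := by
      have : (z + t • x) - y = (z - y) + t • x := by abel
      rw [this]
      exact (norm_add_le _ _).trans (by linarith)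
    have h1 := norm_sub_norm_le (z + t • x) y
    have h2 := norm_sub_norm_le y (z + t • x)
    rw [norm_sub_rev] at h2
    refine ⟨?_, ?_⟩
    · rw [mem_ball_zero_iff]; linarith
    · rw [mem_closedBall_zero_iff]; push Not; linarith
  have hjU : IntegrableOn (fun z => (j z : ℝ)) U := by
    refine ⟨hgm.aestronglyMeasurable, ?_⟩
    rw [hasFiniteIntegral_iff_enorm]
    refine lt_of_le_of_lt ?_ hfin
    rw [tailMass]
    refine (lintegral_mono_set (t := (Metric.ball 0 ρ)ᶜ) fun z hz => ?_).trans
      (lintegral_mono fun z => ?_)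
    · exact fun hz' => hz.2 (Metric.ball_subset_closedBall hz')
    · simp
  have hvar := lintegral_increment_le_totalVar hgm hUo hjU hVc (by positivity) hVU
  have hA := h ρ (3 * R₀ / 4) hρ (by linarith) (by linarith)
  -- The factor `‖x‖ ≤ θρ` cancels the `1/ρ` of the variation bound, so the error is a small
  -- multiple of the tail at every scale.
  have hvar2 : ∫⁻ z in V, ENNReal.ofReal |(j (z + x) : ℝ) - j z| ≤
      ENNReal.ofReal (θ * M) * tailMass j ρ := by
    refine hvar.trans ?_
    calc ENNReal.ofReal ‖x‖ * totalVar (fun z => (j z : ℝ)) U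
        ≤ ENNReal.ofReal (θ * ρ) * (ENNReal.ofReal (M / ρ) * tailMass j ρ) := by
          gcongr
          exact hA
      _ = ENNReal.ofReal (θ * M) * tailMass j ρ := by
          rw [← mul_assoc, ← ENNReal.ofReal_mul (by positivity)]
          congr 2
          field_simp
  refine le_trans ?_ (add_le_add_right (add_le_add_right hvar2 _) _)
  have hmin : Measurable fun z =>
      ((min (cutKernel j ρ z) (cutKernel j ρ (z + x)) : ℝ≥0) : ℝ≥0∞) :=
    ((measurable_cutKernel hjm ρ).min
      ((measurable_cutKernel hjm ρ).comp (measurable_id.add_const x))).coe_nnreal_ennreal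
  have hind : Measurable ((Metric.ball (0 : RN N) (R₀ / 2))ᶜ.indicator
      fun z => (j z : ℝ≥0∞)) :=
    hjm.coe_nnreal_ennreal.indicator Metric.isOpen_ball.measurableSet.compl
  rw [← lintegral_cutKernel, tailMass,
    ← lintegral_indicator Metric.isOpen_ball.measurableSet.compl,
    ← lintegral_indicator hVc.measurableSet, ← lintegral_add_left hind,
    ← lintegral_add_left hmin]
  refine lintegral_mono fun z => ?_
  by_cases hz : z ∈ (Metric.ball (0 : RN N) (2 * ρ))ᶜ
  · have hz2 : 2 * ρ ≤ ‖z‖ := by simpa using hz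
    have e : cutKernel j (2 * ρ) z = j z := by simp [cutKernel, indicator, hz]
    have e1 : cutKernel j ρ z = j z := by
      have : ¬ ‖z‖ < ρ := by push Not; linarith
      simp [cutKernel, indicator, this]
    rw [e]
    by_cases hzR : z ∈ (Metric.ball (0 : RN N) (R₀ / 2))ᶜ
    · rw [indicator_of_mem hzR]
      exact le_add_left (le_add_right le_rfl)
    · have hzR' : ‖z‖ < R₀ / 2 := by simpa using hzR
      have hzV : z ∈ V := ⟨by rw [mem_closedBall_zero_iff]; exact hzR'.le, hz⟩
      have hlow := norm_sub_norm_le z (-x)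
      rw [sub_neg_eq_add, norm_neg] at hlow
      have e2 : cutKernel j ρ (z + x) = j (z + x) := by
        have : ¬ ‖z + x‖ < ρ := by push Not; linarith
        simp [cutKernel, indicator, this]
      rw [indicator_of_mem hzV, e1, e2]
      refine le_trans ?_ (add_le_add_right (le_add_left le_rfl) _)
      rw [← ENNReal.ofReal_coe_nnreal, ← ENNReal.ofReal_coe_nnreal,
        ← ENNReal.ofReal_add (NNReal.coe_nonneg _) (abs_nonneg _)]
      refine ENNReal.ofReal_le_ofReal ?_
      rw [NNReal.coe_min]
      rcases le_total (j z : ℝ) (j (z + x)) with h' | h'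
      · rw [min_eq_left h']
        linarith [abs_nonneg ((j (z + x) : ℝ) - j z)]
      · rw [min_eq_right h']
        linarith [neg_abs_le ((j (z + x) : ℝ) - j z)]
  · have e : cutKernel j (2 * ρ) z = 0 := by
      simp only [cutKernel, indicator, hz, if_false]
    rw [e]
    simp

/-- Absorption: an error of at most half the left side is moved across, which in `ℝ≥0∞` requires
that side to be finite. -/
theorem half_mul_le_of_mul_le_add {c : ℝ} (hc : 0 ≤ c) {T I b : ℝ≥0∞} (hT : T ≠ ∞)
    (h : ENNReal.ofReal c * T ≤ I + b) (hb : b ≤ ENNReal.ofReal (c / 2) * T) :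
    ENNReal.ofReal (c / 2) * T ≤ I := by
  have e : ENNReal.ofReal c = ENNReal.ofReal (c / 2) + ENNReal.ofReal (c / 2) := by
    rw [← ENNReal.ofReal_add (by positivity) (by positivity), add_halves]
  rw [e, add_mul] at h
  exact (ENNReal.add_le_add_iff_right (ENNReal.mul_ne_top ENNReal.ofReal_ne_top hT)).1
    (h.trans (add_le_add_right hb I))

/-- At suitable small scales `ρ`, the jumps longer than `ρ` from two points at distance at most
`θρ` share a fixed portion of the mass of `min(1, |z|/ρ) j(z)`. -/
theorem exists_coalescing_scale (hjm : Measurable j) {γ : ℝ} (hγ0 : 0 < γ) (hγ1 : γ < 1)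
    (hA1 : CondA1 γ j) (hA2 : CondA2 j) {R₀ : ℝ} (hR₀ : 0 < R₀)
    (hA3 : CondA31 R₀ j ∨ CondA32 R₀ j) :
    ∃ θ κ : ℝ, 0 < θ ∧ θ ≤ 1 ∧ 0 < κ ∧ ∀ ρ₀ > 0, ∀ L : ℝ≥0, ∃ ρ, 0 < ρ ∧ ρ < ρ₀ ∧
      (L : ℝ≥0∞) ≤ scaleMass j ρ ∧ ∀ x : RN N, ‖x‖ ≤ θ * ρ →
        ENNReal.ofReal κ * scaleMass j ρ ≤
          ∫⁻ z, ((min (cutKernel j ρ z) (cutKernel j ρ (z + x)) : ℝ≥0) : ℝ≥0∞) := by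
  obtain ⟨C, hC, hscale⟩ := exists_scaleMass_le_tailMass hjm hγ0 hγ1 hA1 hA2
  have hRfin : tailMass j (R₀ / 2) ≠ ∞ :=
    (tailMass_lt_top hγ0 hγ1 hA1 (by positivity)).ne
  obtain ⟨θ, c, hθ0, hθ1, hc0, hcoal⟩ : ∃ θ c : ℝ, 0 < θ ∧ θ ≤ 1 ∧ 0 < c ∧ ∀ ρ, 0 < ρ →
      ρ < R₀ / 4 → scaleMass j ρ ≤ ENNReal.ofReal C * tailMass j (2 * ρ) →
      tailMass j (R₀ / 2) ≤ ENNReal.ofReal (c / 2) * tailMass j (2 * ρ) →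
      ∀ x : RN N, ‖x‖ ≤ θ * ρ → ENNReal.ofReal (c / 2) * tailMass j (2 * ρ) ≤
        ∫⁻ z, ((min (cutKernel j ρ z) (cutKernel j ρ (z + x)) : ℝ≥0) : ℝ≥0∞) := by
    rcases hA3 with ⟨c₀, σ, hc0, hc1, hσ0, hσ1, h⟩ | ⟨M, hM, -, h⟩
    · refine ⟨σ, c₀, hσ0, hσ1.le, hc0, fun ρ hρ hρR _ hb x hx => ?_⟩
      refine half_mul_le_of_mul_le_add c₀.coe_nonneg (tailMass_lt_top hγ0 hγ1 hA1 (by positivity)).ne ?_ hb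
      rw [ENNReal.ofReal_coe_nnreal]
      exact coalescence_of_condA31 hjm hσ0 hσ1 h hc1 hρ hρR hx
    -- The variation error is `θM T(ρ) ≤ θMC T(2ρ) ≤ T(2ρ)/4` at a good scale; with the other
    -- quarter, coming from jumps beyond `R₀/2`, half of `T(2ρ)` survives.
    · set θ : ℝ := min (1 / 4) (1 / (4 * M * C)) with hθ
      have hθ0 : 0 < θ := by positivity
      have hθM : θ * M * C ≤ 1 / 4 := by
        calc θ * M * C ≤ 1 / (4 * M * C) * M * C := by gcongr; exact min_le_right _ _
          _ = 1 / 4 := by field_simp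
      refine ⟨θ, 1 / 2, hθ0, (min_le_left _ _).trans (by norm_num), by norm_num,
        fun ρ hρ hρR hs hb x hx => ?_⟩
      have hT : tailMass j (2 * ρ) ≠ ∞ := (tailMass_lt_top hγ0 hγ1 hA1 (by positivity)).ne
      have hle : tailMass j ρ ≤ ENNReal.ofReal C * tailMass j (2 * ρ) :=
        (tailMass_le_scaleMass hρ).trans hs
      have h1 := coalescence_of_condA32 hjm h hθ0 (min_le_left _ _) hρ hρR
        (tailMass_lt_top hγ0 hγ1 hA1 hρ) hx
      have h2 : ENNReal.ofReal (1 / 2) * tailMass j (2 * ρ) ≤ _ :=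
        half_mul_le_of_mul_le_add (c := 1) zero_le_one hT (by simpa using h1) ?_
      · refine le_trans ?_ h2
        gcongr
        norm_num
      · have e : ENNReal.ofReal (1 / 2) =
            ENNReal.ofReal (1 / 2 / 2) + ENNReal.ofReal (1 / 4) := by
          rw [← ENNReal.ofReal_add (by norm_num) (by norm_num)]; norm_num
        rw [e, add_mul]
        refine add_le_add hb ?_
        calc ENNReal.ofReal (θ * M) * tailMass j ρ
            ≤ ENNReal.ofReal (θ * M) * (ENNReal.ofReal C * tailMass j (2 * ρ)) := by gcongr
          _ = ENNReal.ofReal (θ * M * C) * tailMass j (2 * ρ) := by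
              rw [← mul_assoc, ← ENNReal.ofReal_mul (by positivity)]
          _ ≤ _ := by gcongr
  -- The shared mass is at least `(c/2) T(2ρ)`, and passing from `T(2ρ)` to `S(ρ)` loses the factor
  -- `C`.
  refine ⟨θ, c / (2 * C), hθ0, hθ1, by positivity, fun ρ₀ hρ₀ L => ?_⟩
  obtain ⟨r, hr, hrL⟩ := exists_le_tailMass hA2
    -- The second entry makes the fixed mass beyond `R₀/2` negligible against `T(2ρ)`.
    (max L ((ENNReal.ofReal (2 / c) * tailMass j (R₀ / 2)).toNNReal))
  have hne : ENNReal.ofReal (2 / c) * tailMass j (R₀ / 2) ≠ ∞ :=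
    ENNReal.mul_ne_top ENNReal.ofReal_ne_top hRfin
  obtain ⟨ρ, hρ, hρm, hs⟩ := hscale (min ρ₀ (min (r / 2) (R₀ / 4))) (by positivity)
  have hρr : 2 * ρ ≤ r := by
    have := hρm.trans_le ((min_le_right _ _).trans (min_le_left _ _))
    linarith
  have hbig := hrL (2 * ρ) hρr
  refine ⟨ρ, hρ, hρm.trans_le (min_le_left _ _), ?_, fun x hx => ?_⟩
  · refine le_trans ?_ (tailMass_le_scaleMass hρ)
    refine le_trans ?_ (hrL ρ (by linarith))
    exact ENNReal.coe_le_coe.2 (le_max_left _ _)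
  · have hb : tailMass j (R₀ / 2) ≤ ENNReal.ofReal (c / 2) * tailMass j (2 * ρ) := by
      have h1 : ENNReal.ofReal (2 / c) * tailMass j (R₀ / 2) ≤ tailMass j (2 * ρ) := by
        rw [← ENNReal.coe_toNNReal hne]
        exact (ENNReal.coe_le_coe.2 (le_max_right _ _)).trans hbig
      calc tailMass j (R₀ / 2)
          = ENNReal.ofReal (c / 2) * (ENNReal.ofReal (2 / c) * tailMass j (R₀ / 2)) := by
            rw [← mul_assoc, ← ENNReal.ofReal_mul (by positivity)]
            have : c / 2 * (2 / c) = 1 := by field_simp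
            rw [this, ENNReal.ofReal_one, one_mul]
        _ ≤ _ := by gcongr
    refine le_trans ?_ (hcoal ρ hρ
      (hρm.trans_le ((min_le_right _ _).trans (min_le_right _ _))) hs hb x hx)
    calc ENNReal.ofReal (c / (2 * C)) * scaleMass j ρ
        ≤ ENNReal.ofReal (c / (2 * C)) * (ENNReal.ofReal C * tailMass j (2 * ρ)) := by gcongr
      _ = ENNReal.ofReal (c / 2) * tailMass j (2 * ρ) := by
          rw [← mul_assoc, ← ENNReal.ofReal_mul (by positivity)]
          congr 2
          field_simp

end Coalescence

/-! ### Symmetric and antisymmetric parts, and the control kernel. -/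

section Kernel

variable {N : ℕ} {K : RN N → RN N → ℝ≥0∞} {j : RN N → ℝ≥0} {Λ : ℝ≥0}

theorem symPart_nonneg (K : RN N → RN N → ℝ≥0∞) (x y : RN N) : 0 ≤ symPart K x y := by
  unfold symPart; positivity

theorem symPart_comm (K : RN N → RN N → ℝ≥0∞) (x y : RN N) : symPart K x y = symPart K y x := by
  unfold symPart; ring

theorem antiPart_comm (K : RN N → RN N → ℝ≥0∞) (x y : RN N) :
    antiPart K x y = -antiPart K y x := by
  unfold antiPart; ring

theorem abs_antiPart_le (K : RN N → RN N → ℝ≥0∞) (x y : RN N) :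
    |antiPart K x y| ≤ symPart K x y := by
  have h1 : 0 ≤ (K x y).toReal := ENNReal.toReal_nonneg
  have h2 : 0 ≤ (K y x).toReal := ENNReal.toReal_nonneg
  unfold antiPart symPart
  rw [abs_le]
  constructor <;> linarith

theorem toReal_eq_symPart_add (K : RN N → RN N → ℝ≥0∞) (x y : RN N) :
    (K x y).toReal = symPart K x y + antiPart K x y := by
  unfold antiPart symPart; ring

theorem measurable_toReal_kernel (hK : Measurable (Function.uncurry K)) :
    Measurable fun p : RN N × RN N => (K p.1 p.2).toReal :=
  hK.ennreal_toReal

theorem measurable_toReal_kernel_swap (hK : Measurable (Function.uncurry K)) :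
    Measurable fun p : RN N × RN N => (K p.2 p.1).toReal :=
  (measurable_toReal_kernel hK).comp measurable_swap

theorem measurable_symPart (hK : Measurable (Function.uncurry K)) :
    Measurable fun p : RN N × RN N => symPart K p.1 p.2 :=
  ((measurable_toReal_kernel hK).add (measurable_toReal_kernel_swap hK)).div_const 2

theorem measurable_antiPart (hK : Measurable (Function.uncurry K)) :
    Measurable fun p : RN N × RN N => antiPart K p.1 p.2 :=
  ((measurable_toReal_kernel hK).sub (measurable_toReal_kernel_swap hK)).div_const 2

/-- The upper and lower bounds of a kernel by `j`. -/
def KernelBounds (K : RN N → RN N → ℝ≥0∞) (j : RN N → ℝ≥0) (Λ : ℝ≥0) : Prop :=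
  ∀ x y : RN N, x ≠ y →
    ((Λ⁻¹ * j (y - x) : ℝ≥0) : ℝ≥0∞) ≤ K x y ∧ K x y ≤ ((Λ * j (y - x) : ℝ≥0) : ℝ≥0∞)

theorem KernelBounds.toReal_le (hK : KernelBounds K j Λ) {x y : RN N} (h : x ≠ y) :
    (K x y).toReal ≤ Λ * j (y - x) := by
  have := ENNReal.toReal_mono ENNReal.coe_ne_top (hK x y h).2
  simpa using this

theorem KernelBounds.le_toReal (hK : KernelBounds K j Λ) {x y : RN N} (h : x ≠ y) :
    (Λ : ℝ)⁻¹ * j (y - x) ≤ (K x y).toReal := by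
  have := ENNReal.toReal_mono ((hK x y h).2.trans_lt ENNReal.coe_lt_top).ne (hK x y h).1
  simpa using this

theorem KernelBounds.symPart_le (hK : KernelBounds K j Λ) {x y : RN N} (h : x ≠ y) :
    symPart K x y ≤ Λ * ((j (y - x) + j (x - y)) / 2) := by
  have h1 := hK.toReal_le h
  have h2 := hK.toReal_le h.symm
  unfold symPart
  linarith

/-- `k` is a symmetric kernel, dominated by the symmetric part of `K` as a quadratic form, which
controls the antisymmetric part of `K`. -/
structure IsControlKernel (K : RN N → RN N → ℝ≥0∞) (j : RN N → ℝ≥0) (k : RN N → RN N → ℝ≥0∞)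
    (C : ℝ≥0) : Prop where
  measurable : Measurable (Function.uncurry k)
  symm : ∀ x y, k x y = k y x
  form_le : ∀ v : RN N → ℝ, MemV j univ v →
      ∫⁻ p : RN N × RN N, ENNReal.ofReal ((v p.1 - v p.2) ^ 2) * k p.1 p.2 ≤
        ∫⁻ p : RN N × RN N,
          ENNReal.ofReal ((v p.1 - v p.2) ^ 2) * ENNReal.ofReal (symPart K p.1 p.2)
  control : ∀ x, ∫⁻ y, ENNReal.ofReal ((antiPart K x y) ^ 2) / k x y ≤ C

/-- The first antisymmetry condition is the case of the relaxed one in which the symmetric part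
controls itself; this is admissible because `|K_a| ≤ K_s`. -/
theorem exists_isControlKernel (hKm : Measurable (Function.uncurry K))
    (h : CondKas K ∨ CondKasTilde K j) : ∃ k C, IsControlKernel K j k C := by
  have htilde : CondKasTilde K j := by
    rcases h with h | h
    · refine ⟨fun x y => ENNReal.ofReal (symPart K x y), (measurable_symPart hKm).ennreal_ofReal,
        fun x y => congrArg ENNReal.ofReal (symPart_comm K x y), fun x => ?_, fun v _ => le_rfl, ?_⟩
      · convert measure_empty (μ := (volume : Measure (RN N)))
        ext y
        simp only [mem_ofPred_eq, mem_empty_iff_false, iff_false, not_and, not_not,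
          ENNReal.ofReal_eq_zero]
        intro h0
        have h1 := abs_antiPart_le K x y
        exact abs_eq_zero.1 (le_antisymm (h1.trans h0) (abs_nonneg _))
      · refine lt_of_le_of_lt (iSup_mono fun x => ?_) h
        have hset : {y | ENNReal.ofReal (symPart K x y) ≠ 0} = {y | symPart K x y ≠ 0} := by
          ext y
          have := symPart_nonneg K x y
          simp only [mem_ofPred_eq, ne_eq, ENNReal.ofReal_eq_zero, not_le]
          exact ⟨fun h => h.ne', fun h => lt_of_le_of_ne this (Ne.symm h)⟩
        rw [hset]
        have hms : MeasurableSet {y | symPart K x y ≠ 0} := by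
          have : Measurable fun y => symPart K x y :=
            (measurable_symPart hKm).comp measurable_prodMk_left
          exact (this (measurableSet_singleton 0)).compl
        refine setLIntegral_mono' hms fun y hy => ?_
        rw [ENNReal.ofReal_div_of_pos (lt_of_le_of_ne (symPart_nonneg K x y) (Ne.symm hy))]
    · exact h
  obtain ⟨k, hkm, hks, hk0, hkf, hkc⟩ := htilde
  refine ⟨k, (⨆ x : RN N, ∫⁻ y in {y | k x y ≠ 0},
      ENNReal.ofReal ((antiPart K x y) ^ 2) / k x y).toNNReal, hkm, hks, hkf, fun x => ?_⟩
  · rw [ENNReal.coe_toNNReal hkc.ne]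
    refine le_trans (le_of_eq ?_) (le_iSup (fun x => ∫⁻ y in {y | k x y ≠ 0},
      ENNReal.ofReal ((antiPart K x y) ^ 2) / k x y) x)
    have hms : MeasurableSet {y | k x y ≠ 0} :=
      (hkm.of_uncurry_left (x := x) (measurableSet_singleton 0)).compl
    rw [← lintegral_indicator hms]
    have hae : ∀ᵐ y, ¬ (k x y = 0 ∧ antiPart K x y ≠ 0) := by
      rw [ae_iff]
      simpa using hk0 x
    refine lintegral_congr_ae (hae.mono fun y hy => ?_)
    -- Where `k` vanishes the antisymmetric part vanishes almost everywhere, and `0 / 0 = 0` in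
    -- `ℝ≥0∞`, so the integral may run over all `y`.
    by_cases h0 : k x y = 0
    · have : antiPart K x y = 0 := by
        by_contra h1
        exact hy ⟨h0, h1⟩
      simp [this, h0]
    · simp [h0]

/-- Weighted Cauchy-Schwarz with an extended weight. -/
theorem ofReal_mul_abs_le (s t a : ℝ) (κ : ℝ≥0∞) :
    ENNReal.ofReal (|s| * |t| * |a|) ≤
      ENNReal.ofReal (s ^ 2) * κ + ENNReal.ofReal (t ^ 2) * (ENNReal.ofReal (a ^ 2) / κ) := by
  rcases eq_or_ne s 0 with rfl | hs
  · simp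
  rcases eq_or_ne t 0 with rfl | ht
  · simp
  rcases eq_or_ne a 0 with rfl | ha
  · simp
  have hs2 : ENNReal.ofReal (s ^ 2) ≠ 0 := (ENNReal.ofReal_pos.2 (sq_pos_of_ne_zero hs)).ne'
  have ht2 : ENNReal.ofReal (t ^ 2) ≠ 0 := (ENNReal.ofReal_pos.2 (sq_pos_of_ne_zero ht)).ne'
  have ha2 : ENNReal.ofReal (a ^ 2) ≠ 0 := (ENNReal.ofReal_pos.2 (sq_pos_of_ne_zero ha)).ne'
  rcases eq_or_ne κ ∞ with rfl | hκ
  · rw [ENNReal.mul_top hs2, top_add]; exact le_top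
  rcases eq_or_ne κ 0 with rfl | hκ0
  · rw [ENNReal.div_zero ha2, ENNReal.mul_top ht2, add_top]; exact le_top
  have hc : 0 < κ.toReal := ENNReal.toReal_pos hκ0 hκ
  rw [← ENNReal.ofReal_toReal hκ, ← ENNReal.ofReal_div_of_pos hc,
    ← ENNReal.ofReal_mul (sq_nonneg _), ← ENNReal.ofReal_mul (sq_nonneg _),
    ← ENNReal.ofReal_add (by positivity) (by positivity)]
  refine ENNReal.ofReal_le_ofReal ?_
  set c := κ.toReal
  have h1 : t ^ 2 * (a ^ 2 / c) = (|t| * |a|) ^ 2 / c := by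
    rw [mul_pow, sq_abs, sq_abs]; ring
  have h2 : s ^ 2 * c = (|s| * c) ^ 2 / c := by
    rw [mul_pow, sq_abs]; field_simp
  rw [h1, h2, ← add_div, le_div_iff₀ hc]
  nlinarith [sq_nonneg (|s| * c - |t| * |a|), abs_nonneg s, abs_nonneg t, abs_nonneg a,
    mul_nonneg (mul_nonneg (abs_nonneg s) hc.le) (mul_nonneg (abs_nonneg t) (abs_nonneg a))]

end Kernel

/-! ### Integrals over pairs of points. -/

section ProductIntegrals

variable {N : ℕ}

theorem lintegral_prod_mul_sub {a F : RN N → ℝ≥0∞} (ha : Measurable a) (hF : Measurable F) :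
    ∫⁻ p : RN N × RN N, a p.1 * F (p.2 - p.1) = (∫⁻ x, a x) * ∫⁻ z, F z := by
  rw [Measure.volume_eq_prod, lintegral_prod _ (by fun_prop), ← lintegral_mul_const _ ha]
  refine lintegral_congr fun x => ?_
  simp only
  rw [lintegral_const_mul _ (by fun_prop), lintegral_sub_right_eq_self F x]

theorem lintegral_prod_mul_sub' {a F : RN N → ℝ≥0∞} (ha : Measurable a) (hF : Measurable F) :
    ∫⁻ p : RN N × RN N, a p.1 * F (p.1 - p.2) = (∫⁻ x, a x) * ∫⁻ z, F z := by
  rw [Measure.volume_eq_prod, lintegral_prod _ (by fun_prop), ← lintegral_mul_const _ ha]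
  refine lintegral_congr fun x => ?_
  simp only
  rw [lintegral_const_mul _ (by fun_prop), lintegral_sub_left_eq_self F x]

theorem lintegral_swap (F : RN N × RN N → ℝ≥0∞) :
    ∫⁻ p : RN N × RN N, F p.swap = ∫⁻ p, F p :=
  (Measure.measurePreserving_swap (μ := (volume : Measure (RN N)))
    (ν := (volume : Measure (RN N)))).lintegral_comp_emb
      MeasurableEquiv.prodComm.measurableEmbedding F

theorem integral_swap (F : RN N × RN N → ℝ) :
    ∫ p : RN N × RN N, F p.swap = ∫ p, F p :=
  integral_prod_swap (μ := (volume : Measure (RN N))) (ν := (volume : Measure (RN N))) F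

theorem lintegral_prod_snd_mul_sub {a F : RN N → ℝ≥0∞} (ha : Measurable a) (hF : Measurable F) :
    ∫⁻ p : RN N × RN N, a p.2 * F (p.1 - p.2) = (∫⁻ x, a x) * ∫⁻ z, F z := by
  rw [← lintegral_prod_mul_sub ha hF, ← lintegral_swap]
  rfl

end ProductIntegrals

/-! ### Finite energy and its bounds by `j`. -/

section Energy

variable {N : ℕ} {K : RN N → RN N → ℝ≥0∞} {j : RN N → ℝ≥0} {Λ : ℝ≥0}

theorem seminormVSq_eq_indicator {B : Set (RN N)} (hB : MeasurableSet B) (v : RN N → ℝ) :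
    seminormVSq j B v = ∫⁻ p : RN N × RN N, {p : RN N × RN N | p.1 ∈ B ∨ p.2 ∈ B}.indicator
      (fun p => ENNReal.ofReal ((v p.1 - v p.2) ^ 2) * (j (p.1 - p.2) : ℝ≥0∞)) p := by
  rw [seminormVSq, lintegral_indicator]
  exact (measurable_fst hB).union (measurable_snd hB)

theorem seminormVSq_univ (v : RN N → ℝ) :
    seminormVSq j univ v = ∫⁻ p : RN N × RN N,
      ENNReal.ofReal ((v p.1 - v p.2) ^ 2) * (j (p.1 - p.2) : ℝ≥0∞) := by
  simp [seminormVSq]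

/-- The energy of the symmetric part of the kernel is bounded by the seminorm. -/
theorem lintegral_symPart_le (hK : KernelBounds K j Λ) (hj : Measurable j) {B : Set (RN N)}
    (hB : MeasurableSet B) {v : RN N → ℝ} (hv : Measurable v) :
    ∫⁻ p : RN N × RN N, {p : RN N × RN N | p.1 ∈ B ∨ p.2 ∈ B}.indicator
      (fun p => ENNReal.ofReal ((v p.1 - v p.2) ^ 2) * ENNReal.ofReal (symPart K p.1 p.2)) p ≤
      Λ * seminormVSq j B v := by
  set D : Set (RN N × RN N) := {p | p.1 ∈ B ∨ p.2 ∈ B} with hD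
  have hDm : MeasurableSet D := (measurable_fst hB).union (measurable_snd hB)
  set F : RN N × RN N → ℝ≥0∞ := D.indicator
    fun p => ENNReal.ofReal ((v p.1 - v p.2) ^ 2) * (j (p.1 - p.2) : ℝ≥0∞) with hF
  have hFm : Measurable F := by
    refine Measurable.indicator ?_ hDm
    have : Measurable fun p : RN N × RN N => j (p.1 - p.2) :=
      hj.comp (measurable_fst.sub measurable_snd)
    fun_prop
  have hsw : ∫⁻ p : RN N × RN N, F p.swap = seminormVSq j B v := by
    rw [lintegral_swap, seminormVSq_eq_indicator hB]
  -- The kernel `j` need not be even, so its two reflections are averaged by exchanging the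
  -- variables.
  have hadd : ∫⁻ p : RN N × RN N, (Λ / 2 : ℝ≥0) * (F p + F p.swap) = Λ * seminormVSq j B v := by
    rw [lintegral_const_mul' _ _ ENNReal.coe_ne_top, lintegral_add_left hFm, hsw,
      ← seminormVSq_eq_indicator hB, ← two_mul, ← mul_assoc]
    congr 1
    norm_cast
    field_simp
  rw [← hadd]
  refine lintegral_mono fun p => ?_
  by_cases hp : p ∈ D
  · have hps : p.swap ∈ D := hp.symm
    simp only [hF, indicator_of_mem hp, indicator_of_mem hps, Prod.fst_swap, Prod.snd_swap]
    by_cases hne : p.1 = p.2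
    · simp [hne]
    · have h1 := ENNReal.ofReal_le_ofReal (hK.symPart_le hne)
      have e : (v p.2 - v p.1) ^ 2 = (v p.1 - v p.2) ^ 2 := by ring
      rw [e, ← mul_add, mul_left_comm]
      gcongr
      refine h1.trans (le_of_eq ?_)
      have : (Λ : ℝ) * ((j (p.2 - p.1) + j (p.1 - p.2)) / 2) =
          ((Λ / 2 * (j (p.1 - p.2) + j (p.2 - p.1)) : ℝ≥0) : ℝ) := by
        push_cast; ring
      rw [this, ENNReal.ofReal_coe_nnreal]
      push_cast
      rfl
  · simp [hp]

/-- A function vanishing outside a set of finite measure, whose increments are controlled by those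
of `u` up to Lipschitz terms, has finite seminorm. -/
theorem seminormVSq_lt_top_of_increment_le (hj : Measurable j) (hj1 : scaleMass j 1 < ∞)
    {B T : Set (RN N)} (hB : MeasurableSet B) (hT : MeasurableSet T) (hTB : T ⊆ B)
    (hTfin : volume T < ∞) {u v : RN N → ℝ} (hu : Measurable u) (hu1 : seminormVSq j B u < ∞)
    (hv : ∀ x ∉ T, v x = 0) {L : ℝ}
    (h : ∀ x y, x ∈ T ∨ y ∈ T → |v x - v y| ≤ |u x - u y| + L * min 1 ‖x - y‖) :
    seminormVSq j univ v < ∞ := by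
  set D : Set (RN N × RN N) := {p | p.1 ∈ B ∨ p.2 ∈ B} with hD
  have hDm : MeasurableSet D := (measurable_fst hB).union (measurable_snd hB)
  set F : RN N × RN N → ℝ≥0∞ := D.indicator
    fun p => ENNReal.ofReal ((u p.1 - u p.2) ^ 2) * (j (p.1 - p.2) : ℝ≥0∞) with hF
  have hjm : Measurable fun p : RN N × RN N => j (p.1 - p.2) :=
    hj.comp (measurable_fst.sub measurable_snd)
  have hFm : Measurable F := Measurable.indicator (by fun_prop) hDm
  set a : RN N → ℝ≥0∞ := T.indicator 1 with ha
  have ham : Measurable a := measurable_one.indicator hT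
  set G : RN N → ℝ≥0∞ := fun z => ENNReal.ofReal (min 1 (‖z‖ / 1)) * (j z : ℝ≥0∞) with hG
  have hGm : Measurable G := by fun_prop
  have hGm' : Measurable fun p : RN N × RN N => G (p.1 - p.2) :=
    hGm.comp (measurable_fst.sub measurable_snd)
  have haint : ∫⁻ x, a x = volume T := lintegral_indicator_one hT
  have key : seminormVSq j univ v ≤ ∫⁻ p : RN N × RN N,
      (2 * F p + ENNReal.ofReal (2 * L ^ 2) *
        (a p.1 * G (p.1 - p.2) + a p.2 * G (p.1 - p.2))) := by
    rw [seminormVSq_univ]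
    refine lintegral_mono fun p => ?_
    by_cases hp : p.1 ∈ T ∨ p.2 ∈ T
    · have hpD : p ∈ D := hp.imp (fun h => hTB h) (fun h => hTB h)
      have h1 := h p.1 p.2 hp
      set m : ℝ := min 1 ‖p.1 - p.2‖ with hm
      have hm0 : 0 ≤ m := by positivity
      have hm1 : m ≤ 1 := min_le_left _ _
      have h2 : (v p.1 - v p.2) ^ 2 ≤ 2 * (u p.1 - u p.2) ^ 2 + 2 * L ^ 2 * m := by
        rw [← sq_abs (v p.1 - v p.2), ← sq_abs (u p.1 - u p.2)]
        have h3 : |v p.1 - v p.2| ^ 2 ≤ (|u p.1 - u p.2| + L * m) ^ 2 := by gcongr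
        -- As `m ≤ 1`, the first power of `m` suffices, and this is the one that `scaleMass j 1`
        -- integrates.
        have h4 : (L * m) ^ 2 ≤ L ^ 2 * m := by
          have : m ^ 2 ≤ m := by nlinarith
          rw [mul_pow]; gcongr
        nlinarith [sq_nonneg (|u p.1 - u p.2| - L * m)]
      have hone : 1 ≤ a p.1 + a p.2 := by
        rcases hp with hp | hp
        · refine le_add_right (le_of_eq ?_); simp [ha, hp]
        · refine le_add_left (le_of_eq ?_); simp [ha, hp]
      simp only [hF, indicator_of_mem hpD]
      calc ENNReal.ofReal ((v p.1 - v p.2) ^ 2) * (j (p.1 - p.2) : ℝ≥0∞)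
          ≤ ENNReal.ofReal (2 * (u p.1 - u p.2) ^ 2 + 2 * L ^ 2 * m) * (j (p.1 - p.2) : ℝ≥0∞) := by
            gcongr
        _ = 2 * (ENNReal.ofReal ((u p.1 - u p.2) ^ 2) * (j (p.1 - p.2) : ℝ≥0∞)) +
            ENNReal.ofReal (2 * L ^ 2) * (1 * G (p.1 - p.2)) := by
            rw [ENNReal.ofReal_add (by positivity) (by positivity),
              ENNReal.ofReal_mul (by norm_num), ENNReal.ofReal_mul (p := 2 * L ^ 2) (by positivity)]
            simp only [hG, div_one, hm]
            rw [ENNReal.ofReal_ofNat]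
            ring
        _ ≤ _ := by
            rw [← add_mul (a p.1)]
            gcongr
    · push Not at hp
      simp [hv _ hp.1, hv _ hp.2]
  refine key.trans_lt ?_
  rw [lintegral_add_left (hFm.const_mul _), lintegral_const_mul _ hFm,
    lintegral_const_mul _ (by fun_prop), lintegral_add_left (by fun_prop),
    lintegral_prod_mul_sub' ham hGm, lintegral_prod_snd_mul_sub ham hGm, haint,
    ← seminormVSq_eq_indicator hB]
  have hGfin : ∫⁻ z, G z < ∞ := hj1
  refine ENNReal.add_lt_top.2 ⟨ENNReal.mul_lt_top (by simp) hu1,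
    ENNReal.mul_lt_top ENNReal.ofReal_lt_top (ENNReal.add_lt_top.2 ⟨?_, ?_⟩)⟩ <;>
  exact ENNReal.mul_lt_top hTfin hGfin

end Energy

/-! ### Cutoffs and absolute convergence of the two parts of the form. -/

section Integrability

variable {N : ℕ} {K : RN N → RN N → ℝ≥0∞} {j : RN N → ℝ≥0} {Λ : ℝ≥0}

theorem integrable_of_enorm_le {α : Type*} [MeasurableSpace α] {μ : Measure α} {f : α → ℝ}
    (hf : Measurable f) {G : α → ℝ≥0∞} (h : ∀ p, ‖f p‖ₑ ≤ G p) (hG : ∫⁻ p, G p ∂μ < ∞) :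
    Integrable f μ :=
  ⟨hf.aestronglyMeasurable, (lintegral_mono h).trans_lt hG⟩

theorem memV_univ_of_bounded {v : RN N → ℝ} (hv : Measurable v) {b : ℝ} (hb : ∀ x, |v x| ≤ b)
    (h : seminormVSq j univ v < ∞) : MemV j univ v := by
  refine ⟨fun C hC _ => ?_, h⟩
  have : IsFiniteMeasure ((volume : Measure (RN N)).restrict C) :=
    ⟨by simpa using hC.measure_lt_top⟩
  exact MemLp.of_bound hv.aestronglyMeasurable b (Eventually.of_forall hb)

/-- A Lipschitz cutoff function equal to `1` near a compact subset of an open set. -/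
theorem exists_lipschitz_cutoff {S B : Set (RN N)} (hS : IsCompact S) (hB : IsOpen B)
    (hSB : S ⊆ B) : ∃ (χ : RN N → ℝ) (δ L : ℝ) (T : Set (RN N)), 0 < δ ∧ 0 ≤ L ∧ IsCompact T ∧
      T ⊆ B ∧ Continuous χ ∧ (∀ x, 0 ≤ χ x) ∧ (∀ x, χ x ≤ 1) ∧
      (∀ x ∈ Metric.cthickening δ S, χ x = 1) ∧ (∀ x ∉ T, χ x = 0) ∧
      ∀ x y, |χ x - χ y| ≤ L * min 1 ‖x - y‖ := by
  obtain ⟨δ, hδ, hδB⟩ := hS.exists_cthickening_subset_open hB hSB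
  have hδ2 : 0 < δ / 2 := by positivity
  refine ⟨fun x => thickenedIndicator hδ2 (Metric.cthickening (δ / 2) S) x, δ / 2,
    max 1 (δ / 2)⁻¹, Metric.cthickening δ S, hδ2, by positivity, hS.cthickening, hδB,
    by fun_prop, fun x => NNReal.coe_nonneg _, fun x => ?_, fun x hx => ?_, fun x hx => ?_,
    fun x y => ?_⟩
  · exact_mod_cast thickenedIndicator_le_one hδ2 _ x
  · beta_reduce
    rw [thickenedIndicator_one hδ2 _ hx, NNReal.coe_one]
  · rw [NNReal.coe_eq_zero]
    refine thickenedIndicator_zero hδ2 _ fun hmem => hx ?_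
    have := Metric.thickening_subset_cthickening _ _ hmem
    have h2 := Metric.cthickening_cthickening_subset (ε := δ / 2) (δ := δ / 2) hδ2.le hδ2.le S this
    rwa [add_halves] at h2
  · have h1 := (lipschitzWith_thickenedIndicator hδ2 (Metric.cthickening (δ / 2) S)).dist_le_mul x y
    rw [NNReal.dist_eq, dist_eq_norm, NNReal.coe_inv, Real.coe_toNNReal _ (by positivity)] at h1
    have h2 : |((thickenedIndicator hδ2 (Metric.cthickening (δ / 2) S) x : ℝ≥0) : ℝ) -
        (thickenedIndicator hδ2 (Metric.cthickening (δ / 2) S) y : ℝ≥0)| ≤ 1 := by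
      have a1 : ((thickenedIndicator hδ2 (Metric.cthickening (δ / 2) S) x : ℝ≥0) : ℝ) ≤ 1 := by
        exact_mod_cast thickenedIndicator_le_one hδ2 _ x
      have a2 : ((thickenedIndicator hδ2 (Metric.cthickening (δ / 2) S) y : ℝ≥0) : ℝ) ≤ 1 := by
        exact_mod_cast thickenedIndicator_le_one hδ2 _ y
      have b1 := NNReal.coe_nonneg (thickenedIndicator hδ2 (Metric.cthickening (δ / 2) S) x)
      have b2 := NNReal.coe_nonneg (thickenedIndicator hδ2 (Metric.cthickening (δ / 2) S) y)
      rw [abs_le]; constructor <;> linarith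
    rw [mul_min_of_nonneg _ _ (by positivity), mul_one]
    refine le_min (h2.trans (le_max_left _ _)) (h1.trans ?_)
    gcongr
    exact le_max_right _ _

/-- The product splits into the energy of `u` over pairs meeting `B` and the full energy of `φ`; on
all other pairs both values of `φ` vanish. -/
theorem integrable_symPart_form (hK : KernelBounds K j Λ) (hKm : Measurable (Function.uncurry K))
    (hj : Measurable j) {B : Set (RN N)} (hB : MeasurableSet B) {u φ : RN N → ℝ}
    (hu : Measurable u) (hu1 : seminormVSq j B u < ∞) (hφ : Measurable φ)
    (hφB : ∀ x ∉ B, φ x = 0) (hφ1 : seminormVSq j univ φ < ∞) :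
    Integrable fun p : RN N × RN N =>
      (u p.1 - u p.2) * (φ p.1 - φ p.2) * symPart K p.1 p.2 := by
  have hsm := measurable_symPart hKm
  set D : Set (RN N × RN N) := {p | p.1 ∈ B ∨ p.2 ∈ B} with hD
  have hDm : MeasurableSet D := (measurable_fst hB).union (measurable_snd hB)
  refine integrable_of_enorm_le (by fun_prop) (G := fun p => D.indicator (fun p =>
      ENNReal.ofReal ((u p.1 - u p.2) ^ 2) * ENNReal.ofReal (symPart K p.1 p.2)) p +
    {p : RN N × RN N | p.1 ∈ univ ∨ p.2 ∈ univ}.indicator (fun p =>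
      ENNReal.ofReal ((φ p.1 - φ p.2) ^ 2) * ENNReal.ofReal (symPart K p.1 p.2)) p)
    (fun p => ?_) ?_
  · by_cases hp : p ∈ D
    · have hs := symPart_nonneg K p.1 p.2
      simp only [indicator_of_mem hp, mem_univ, or_self, ofPred_true, indicator_univ]
      rw [← add_mul, ← ENNReal.ofReal_add (sq_nonneg _) (sq_nonneg _),
        ← ENNReal.ofReal_mul (by positivity), Real.enorm_eq_ofReal_abs, abs_mul, abs_of_nonneg hs]
      gcongr
      rw [abs_mul]
      nlinarith [sq_nonneg (|u p.1 - u p.2| - |φ p.1 - φ p.2|), sq_abs (u p.1 - u p.2),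
        sq_abs (φ p.1 - φ p.2), abs_nonneg (u p.1 - u p.2), abs_nonneg (φ p.1 - φ p.2)]
    · simp only [hD, mem_ofPred_eq, not_or] at hp
      simp [hφB _ hp.1, hφB _ hp.2]
  · rw [lintegral_add_left (Measurable.indicator (by fun_prop) hDm)]
    refine ENNReal.add_lt_top.2 ⟨?_, ?_⟩
    · exact (lintegral_symPart_le hK hj hB hu).trans_lt (ENNReal.mul_lt_top (by simp) hu1)
    · exact (lintegral_symPart_le hK hj MeasurableSet.univ hφ).trans_lt
        (ENNReal.mul_lt_top (by simp) hφ1)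

theorem lintegral_prod_fst_mul_le {a : RN N → ℝ≥0∞} (ha : Measurable a)
    {q : RN N × RN N → ℝ≥0∞} (hq : Measurable q) {C : ℝ≥0∞} (hC : ∀ x, ∫⁻ y, q (x, y) ≤ C) :
    ∫⁻ p : RN N × RN N, a p.1 * q p ≤ C * ∫⁻ x, a x := by
  rw [Measure.volume_eq_prod, lintegral_prod _ (by fun_prop), mul_comm, ← lintegral_mul_const _ ha]
  refine lintegral_mono fun x => ?_
  simp only
  rw [lintegral_const_mul _ (by fun_prop)]
  exact mul_le_mul' le_rfl (hC x)

theorem IsControlKernel.measurable_div {k : RN N → RN N → ℝ≥0∞} {C : ℝ≥0}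
    (hk : IsControlKernel K j k C) (hKm : Measurable (Function.uncurry K)) :
    Measurable fun p : RN N × RN N => ENNReal.ofReal ((antiPart K p.1 p.2) ^ 2) / k p.1 p.2 :=
  ((measurable_antiPart hKm).pow_const 2).ennreal_ofReal.div hk.measurable

theorem IsControlKernel.lintegral_mul_le {k : RN N → RN N → ℝ≥0∞} {C : ℝ≥0}
    (hk : IsControlKernel K j k C) (hKm : Measurable (Function.uncurry K)) {a : RN N → ℝ≥0∞}
    (ha : Measurable a) :
    ∫⁻ p : RN N × RN N, a p.1 * (ENNReal.ofReal ((antiPart K p.1 p.2) ^ 2) / k p.1 p.2) ≤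
      C * ∫⁻ x, a x :=
  lintegral_prod_fst_mul_le ha (hk.measurable_div hKm) hk.control

/-- The control kernel is dominated only as a quadratic form on functions of globally finite energy,
whereas `u` has finite energy only over pairs meeting `B`. Near the diagonal `u` is therefore
replaced by `χ u`, which has the same increments there and finite global energy. Away from it,
`|K_a| ≤ K_s` and the finite tail of `j` suffice. -/
theorem integrable_antiPart_form (hK : KernelBounds K j Λ) (hKm : Measurable (Function.uncurry K))
    (hj : Measurable j) (hjs : ∀ ρ > 0, scaleMass j ρ < ∞) {k : RN N → RN N → ℝ≥0∞} {C : ℝ≥0}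
    (hk : IsControlKernel K j k C) {B S : Set (RN N)} (hB : IsOpen B) (hS : IsCompact S)
    (hSB : S ⊆ B) {u φ : RN N → ℝ} (hu : Measurable u) (hub : ∀ x, |u x| ≤ 1)
    (hu1 : seminormVSq j B u < ∞) (hφ : Measurable φ) (hφS : ∀ x ∉ S, φ x = 0) {b : ℝ}
    (hφb : ∀ x, |φ x| ≤ b) :
    Integrable fun p : RN N × RN N => (u p.1 - u p.2) * φ p.1 * antiPart K p.1 p.2 := by
  have ham := measurable_antiPart hKm
  obtain ⟨χ, δ, L, T, hδ, hL, hT, hTB, hχ, hχ0, hχ1, hχS, hχT, hχL⟩ :=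
    exists_lipschitz_cutoff hS hB hSB
  set v : RN N → ℝ := fun x => χ x * u x with hv
  have hvm : Measurable v := hχ.measurable.mul hu
  have hvb : ∀ x, |v x| ≤ 1 := by
    intro x
    rw [hv, abs_mul, abs_of_nonneg (hχ0 x)]
    exact mul_le_one₀ (hχ1 x) (abs_nonneg _) (hub x)
  have hv1 : seminormVSq j univ v < ∞ := by
    refine seminormVSq_lt_top_of_increment_le hj (hjs 1 one_pos) hB.measurableSet hT.measurableSet
      hTB hT.measure_lt_top hu hu1 (fun x hx => by simp [hv, hχT x hx]) (L := L) fun x y _ => ?_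
    have e : v x - v y = χ x * (u x - u y) + u y * (χ x - χ y) := by simp only [hv]; ring
    rw [e]
    refine (abs_add_le _ _).trans (add_le_add ?_ ?_)
    · rw [abs_mul, abs_of_nonneg (hχ0 x)]
      exact mul_le_of_le_one_left (abs_nonneg _) (hχ1 x)
    · rw [abs_mul]
      exact (mul_le_of_le_one_left (abs_nonneg _) (hub y)).trans (hχL x y)
  have hform := hk.form_le v (memV_univ_of_bounded hvm hvb hv1)
  have hsym := (lintegral_symPart_le hK hj MeasurableSet.univ hvm).trans_lt
    (ENNReal.mul_lt_top ENNReal.coe_lt_top hv1)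
  simp only [mem_univ, or_self, ofPred_true, indicator_univ] at hsym
  set a : RN N → ℝ≥0∞ := S.indicator 1 with ha
  have ham' : Measurable a := measurable_one.indicator hS.measurableSet
  have haint : ∫⁻ x, a x = volume S := lintegral_indicator_one hS.measurableSet
  have hcm := measurable_cutKernel hj δ
  have hcm' : Measurable fun z => (cutKernel j δ z : ℝ≥0∞) := hcm.coe_nnreal_ennreal
  set G : RN N × RN N → ℝ≥0∞ := fun p => (ENNReal.ofReal ((v p.1 - v p.2) ^ 2) * k p.1 p.2 +
      a p.1 * (ENNReal.ofReal ((antiPart K p.1 p.2) ^ 2) / k p.1 p.2)) +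
    2 * Λ * (a p.1 * cutKernel j δ (p.2 - p.1) + a p.1 * cutKernel j δ (p.1 - p.2)) with hG
  have hGfin : ∫⁻ p, G p < ∞ := by
    have hkm : Measurable fun p : RN N × RN N => k p.1 p.2 := hk.measurable
    have m1 : Measurable fun p : RN N × RN N =>
        ENNReal.ofReal ((v p.1 - v p.2) ^ 2) * k p.1 p.2 := by fun_prop
    have m2 : Measurable fun p : RN N × RN N =>
        a p.1 * (ENNReal.ofReal ((antiPart K p.1 p.2) ^ 2) / k p.1 p.2) :=
      (ham'.comp measurable_fst).mul (hk.measurable_div hKm)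
    have m3 : Measurable fun p : RN N × RN N => a p.1 * (cutKernel j δ (p.2 - p.1) : ℝ≥0∞) :=
      (ham'.comp measurable_fst).mul (hcm'.comp (measurable_snd.sub measurable_fst))
    simp only [hG]
    have m12 : Measurable fun p : RN N × RN N => ENNReal.ofReal ((v p.1 - v p.2) ^ 2) * k p.1 p.2 +
        a p.1 * (ENNReal.ofReal ((antiPart K p.1 p.2) ^ 2) / k p.1 p.2) := m1.add m2
    rw [lintegral_add_left m12, lintegral_add_left m1,
      lintegral_const_mul' _ _ (ENNReal.mul_ne_top (by simp) (by simp)), lintegral_add_left m3,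
      lintegral_prod_mul_sub ham' hcm', lintegral_prod_mul_sub' ham' hcm', lintegral_cutKernel,
      haint]
    have ht : tailMass j δ < ∞ := (tailMass_le_scaleMass hδ).trans_lt (hjs δ hδ)
    have hSt : volume S * tailMass j δ < ∞ := ENNReal.mul_lt_top hS.measure_lt_top ht
    refine ENNReal.add_lt_top.2 ⟨ENNReal.add_lt_top.2 ⟨hform.trans_lt hsym, ?_⟩,
      ENNReal.mul_lt_top (ENNReal.mul_lt_top (by simp) (by simp)) (ENNReal.add_lt_top.2 ⟨hSt, hSt⟩)⟩
    refine (hk.lintegral_mul_le hKm ham').trans_lt ?_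
    rw [haint]
    exact ENNReal.mul_lt_top ENNReal.coe_lt_top hS.measure_lt_top
  -- It is enough to treat the indicator of `S`; `φ` is then a bounded factor.
  have hone : Integrable fun p : RN N × RN N =>
      (u p.1 - u p.2) * S.indicator 1 p.1 * antiPart K p.1 p.2 := by
    have hSm : Measurable (S.indicator (1 : RN N → ℝ)) := measurable_one.indicator hS.measurableSet
    refine integrable_of_enorm_le (by fun_prop) (G := G) (fun p => ?_) hGfin
    by_cases hp : p.1 ∈ S
    · have hap : a p.1 = 1 := by simp [ha, hp]
      simp only [indicator_of_mem hp, Pi.one_apply, mul_one, hG, hap, one_mul]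
      rw [Real.enorm_eq_ofReal_abs, abs_mul]
      by_cases hd : ‖p.2 - p.1‖ < δ
      · refine le_add_right ?_
        have e1 : χ p.1 = 1 := hχS _ (Metric.self_subset_cthickening S hp)
        have e2 : χ p.2 = 1 := by
          refine hχS _ (Metric.mem_cthickening_of_dist_le _ p.1 _ _ hp ?_)
          rw [dist_eq_norm]; exact hd.le
        have := ofReal_mul_abs_le (v p.1 - v p.2) 1 (antiPart K p.1 p.2) (k p.1 p.2)
        simpa [hv, e1, e2] using this
      · refine le_add_left ?_
        have hne : p.1 ≠ p.2 := by
          intro h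
          rw [h, sub_self, norm_zero] at hd
          exact hd hδ
        have c1 : cutKernel j δ (p.2 - p.1) = j (p.2 - p.1) := by
          simp [cutKernel, indicator, hd]
        have c2 : cutKernel j δ (p.1 - p.2) = j (p.1 - p.2) := by
          rw [norm_sub_rev] at hd
          simp [cutKernel, indicator, hd]
        rw [c1, c2]
        have h1 := (abs_antiPart_le K p.1 p.2).trans (hK.symPart_le hne)
        have h2 : |u p.1 - u p.2| ≤ 2 := by
          have := abs_sub (u p.1) (u p.2)
          linarith [hub p.1, hub p.2]
        have h3 : |u p.1 - u p.2| * |antiPart K p.1 p.2| ≤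
            ((2 * Λ * (j (p.2 - p.1) + j (p.1 - p.2)) : ℝ≥0) : ℝ) := by
          push_cast
          calc |u p.1 - u p.2| * |antiPart K p.1 p.2|
              ≤ 2 * (Λ * ((j (p.2 - p.1) + j (p.1 - p.2)) / 2)) := by gcongr
            _ ≤ _ := by
              have : (0 : ℝ) ≤ Λ * (j (p.2 - p.1) + j (p.1 - p.2)) := by positivity
              linarith
        refine (ENNReal.ofReal_le_ofReal h3).trans (le_of_eq ?_)
        rw [ENNReal.ofReal_coe_nnreal]
        push_cast
        rfl
    · simp [hp]
  have := hone.mul_bdd (c := b) (g := fun p : RN N × RN N => φ p.1)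
    (hφ.comp measurable_fst).aestronglyMeasurable (Eventually.of_forall fun p => hφb p.1)
  refine this.congr (Eventually.of_forall fun p => ?_)
  by_cases hp : p.1 ∈ S
  · simp [hp]; ring
  · simp [hp, hφS _ hp]

end Integrability

/-! ### A criterion for weak convergence. -/

section WeakConvergence

/-- Functions which are bounded in `L²` and converge to zero almost everywhere converge weakly to
zero. -/
theorem tendsto_integral_mul_zero {α : Type*} [MeasurableSpace α] {μ : Measure α} {F : α → ℝ}
    {D : ℕ → α → ℝ} (hF : Measurable F) (hD : ∀ n, Measurable (D n))
    (hF2 : ∫⁻ p, ENNReal.ofReal (F p ^ 2) ∂μ < ∞) {C : ℝ≥0∞} (hC : C ≠ ∞)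
    (hDC : ∀ n, ∫⁻ p, ENNReal.ofReal (D n p ^ 2) ∂μ ≤ C)
    (h0 : ∀ᵐ p ∂μ, Tendsto (fun n => D n p) atTop (𝓝 0)) :
    Tendsto (fun n => ∫ p, F p * D n p ∂μ) atTop (𝓝 0) := by
  rw [tendsto_zero_iff_enorm_tendsto_zero, ENNReal.tendsto_nhds_zero]
  intro ε hε
  obtain ⟨δ, hδ, hδC⟩ := ENNReal.exists_nnreal_pos_mul_lt hC (ENNReal.half_pos hε.ne').ne'
  have hδ' : (0 : ℝ) < δ := hδ
  -- Where `|F D| > F²/δ` one has `|F| < δ|D|`, so the product is at most `δ D²`, of uniformly small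
  -- integral. The remaining part is capped by the fixed integrable function `F²/δ`, and dominated
  -- convergence applies.
  have hlim : Tendsto (fun n => ∫⁻ p, min (ENNReal.ofReal |F p * D n p|)
      (ENNReal.ofReal (F p ^ 2 / δ)) ∂μ) atTop (𝓝 (∫⁻ _, 0 ∂μ)) := by
    refine tendsto_lintegral_of_dominated_convergence (fun p => ENNReal.ofReal (F p ^ 2 / δ))
      (fun n => ?_) (fun n => Eventually.of_forall fun p => min_le_right _ _) ?_ ?_
    · have := hD n
      fun_prop
    · simp_rw [ENNReal.ofReal_div_of_pos hδ', ENNReal.div_eq_inv_mul]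
      rw [lintegral_const_mul _ (by fun_prop)]
      exact (ENNReal.mul_lt_top (ENNReal.inv_lt_top.2 (ENNReal.ofReal_pos.2 hδ')) hF2).ne
    · filter_upwards [h0] with p hp
      have h1 : Tendsto (fun n => ENNReal.ofReal |F p * D n p|) atTop (𝓝 0) := by
        have h2 := ENNReal.tendsto_ofReal (hp.const_mul (F p)).abs
        simpa using h2
      exact tendsto_of_tendsto_of_tendsto_of_le_of_le tendsto_const_nhds h1 (fun _ => zero_le)
        (fun n => min_le_left _ _)
  rw [lintegral_zero, ENNReal.tendsto_nhds_zero] at hlim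
  filter_upwards [hlim _ (ENNReal.half_pos hε.ne')] with n hn
  calc ‖∫ p, F p * D n p ∂μ‖ₑ ≤ ∫⁻ p, ‖F p * D n p‖ₑ ∂μ := enorm_integral_le_lintegral_enorm _
    _ ≤ ∫⁻ p, (min (ENNReal.ofReal |F p * D n p|) (ENNReal.ofReal (F p ^ 2 / δ)) +
          δ * ENNReal.ofReal (D n p ^ 2)) ∂μ := by
        refine lintegral_mono fun p => ?_
        rw [Real.enorm_eq_ofReal_abs]
        rcases le_total (|F p * D n p|) (F p ^ 2 / δ) with h | h
        · rw [min_eq_left (ENNReal.ofReal_le_ofReal h)]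
          exact le_add_right le_rfl
        · refine le_add_left ?_
          rw [← ENNReal.ofReal_coe_nnreal, ← ENNReal.ofReal_mul δ.coe_nonneg]
          refine ENNReal.ofReal_le_ofReal ?_
          rw [div_le_iff₀ hδ', abs_mul, ← sq_abs] at h
          rw [abs_mul, ← sq_abs]
          rcases (abs_nonneg (F p)).eq_or_lt with hF0 | hF0
          · rw [← hF0, zero_mul]; positivity
          · have h3 : |F p| ≤ |D n p| * δ := by
              by_contra! hcon
              nlinarith
            nlinarith [abs_nonneg (D n p)]
    _ = ∫⁻ p, min (ENNReal.ofReal |F p * D n p|) (ENNReal.ofReal (F p ^ 2 / δ)) ∂μ +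
          δ * ∫⁻ p, ENNReal.ofReal (D n p ^ 2) ∂μ := by
        have := hD n
        rw [lintegral_add_left (by fun_prop), lintegral_const_mul _ (by fun_prop)]
    _ ≤ ε / 2 + ε / 2 := by
        refine add_le_add hn (le_trans ?_ hδC.le)
        gcongr
        exact hDC n
    _ = ε := ENNReal.add_halves ε

end WeakConvergence

theorem ofReal_sub_sq_le (a b : ℝ) :
    ENNReal.ofReal ((a - b) ^ 2) ≤ 2 * ENNReal.ofReal (a ^ 2) + 2 * ENNReal.ofReal (b ^ 2) := by
  have h2 : (2 : ℝ≥0∞) = ENNReal.ofReal 2 := by simp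
  rw [h2, ← ENNReal.ofReal_mul (by norm_num), ← ENNReal.ofReal_mul (by norm_num),
    ← ENNReal.ofReal_add (by positivity) (by positivity)]
  refine ENNReal.ofReal_le_ofReal ?_
  nlinarith [sq_nonneg (a + b)]

/-! ### Enlarging the class of test functions. -/

section TestFunctions

variable {N : ℕ} {K : RN N → RN N → ℝ≥0∞} {j : RN N → ℝ≥0} {Λ : ℝ≥0}

/-- Averaging translates does not increase the seminorm. -/
theorem seminormVSq_average_le (hj : Measurable j) {φ ψ : RN N → ℝ} (hφ : Measurable φ) {b : ℝ}
    (hb : ∀ x, |φ x| ≤ b) (P : Measure (RN N)) [IsProbabilityMeasure P]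
    (hψ : ∀ x, ψ x = ∫ t, φ (x - t) ∂P) : seminormVSq j univ ψ ≤ seminormVSq j univ φ := by
  have hjm : Measurable fun p : RN N × RN N => j (p.1 - p.2) :=
    hj.comp (measurable_fst.sub measurable_snd)
  set H : RN N × RN N → ℝ≥0∞ := fun p =>
    ENNReal.ofReal ((φ p.1 - φ p.2) ^ 2) * (j (p.1 - p.2) : ℝ≥0∞) with hH
  have hHm : Measurable H := by fun_prop
  have hint : ∀ x, Integrable (fun t => φ (x - t)) P := fun x =>
    Integrable.of_bound (hφ.comp (measurable_const.sub measurable_id)).aestronglyMeasurable b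
      (Eventually.of_forall fun t => hb (x - t))
  have hsq : ∀ x y, ENNReal.ofReal ((ψ x - ψ y) ^ 2) ≤
      ∫⁻ t, ENNReal.ofReal ((φ (x - t) - φ (y - t)) ^ 2) ∂P := by
    intro x y
    have hd : Integrable (fun t => φ (x - t) - φ (y - t)) P := (hint x).sub (hint y)
    have hm : Measurable fun t => φ (x - t) - φ (y - t) := by fun_prop
    have hd2 : Integrable (fun t => (φ (x - t) - φ (y - t)) ^ 2) P := by
      refine Integrable.of_bound (hm.pow_const 2).aestronglyMeasurable ((b + b) ^ 2)
        (Eventually.of_forall fun t => ?_)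
      rw [Real.norm_eq_abs, abs_of_nonneg (sq_nonneg _), ← sq_abs]
      have := abs_sub (φ (x - t)) (φ (y - t))
      gcongr
      linarith [hb (x - t), hb (y - t)]
    -- Jensen's inequality for the averaging measure.
    have hJ := (even_two.convexOn_pow (𝕜 := ℝ)).map_integral_le (μ := P)
      (f := fun t => φ (x - t) - φ (y - t)) (by fun_prop) isClosed_univ (by simp) hd hd2
    rw [hψ x, hψ y, ← integral_sub (hint x) (hint y),
      ← ofReal_integral_eq_lintegral_ofReal hd2 (Eventually.of_forall fun t => sq_nonneg _)]
    exact ENNReal.ofReal_le_ofReal hJ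
  rw [seminormVSq_univ, seminormVSq_univ]
  calc ∫⁻ p : RN N × RN N, ENNReal.ofReal ((ψ p.1 - ψ p.2) ^ 2) * (j (p.1 - p.2) : ℝ≥0∞)
      ≤ ∫⁻ p : RN N × RN N, ∫⁻ t, H (p - (t, t)) ∂P := by
        refine lintegral_mono fun p => ?_
        have e : ∀ t, H (p - (t, t)) =
            ENNReal.ofReal ((φ (p.1 - t) - φ (p.2 - t)) ^ 2) * (j (p.1 - p.2) : ℝ≥0∞) := by
          intro t
          simp [hH]
        simp_rw [e]
        rw [lintegral_mul_const _ (by fun_prop)]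
        gcongr
        exact hsq p.1 p.2
    _ = ∫⁻ t, (∫⁻ p : RN N × RN N, H (p - (t, t))) ∂P := by
        refine lintegral_lintegral_swap ?_
        refine (hHm.comp ?_).aemeasurable
        fun_prop
    _ = ∫⁻ t, (∫⁻ p : RN N × RN N, H p) ∂P := by
        -- Translation along the diagonal preserves both `j(x - y)` and the measure on pairs.
        refine lintegral_congr fun t => ?_
        have : ((volume : Measure (RN N)).prod (volume : Measure (RN N))).IsAddRightInvariant :=
          inferInstance
        exact lintegral_sub_right_eq_self (μ := (volume : Measure (RN N)).prod volume) H (t, t)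
    _ = ∫⁻ p : RN N × RN N, H p := by simp

/-- A weak solution on `B`, bounded by `1` on the whole space, with right-hand side bounded
by `G`. -/
structure IsBoundedWeakSol (K : RN N → RN N → ℝ≥0∞) (j : RN N → ℝ≥0) (B : Set (RN N)) (G : ℝ)
    (u g : RN N → ℝ) : Prop where
  measurable : Measurable u
  abs_le : ∀ x, |u x| ≤ 1
  seminorm_lt_top : seminormVSq j B u < ∞
  measurable_rhs : Measurable g
  abs_rhs_le : ∀ x, |g x| ≤ G
  eq : ∀ φ : RN N → ℝ, ContDiff ℝ ((⊤ : ℕ∞) : WithTop ℕ∞) φ → HasCompactSupport φ →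
    tsupport φ ⊆ B → bilinForm K u φ = ∫ x, g x * φ x

/-- The weak equation holds for bounded test functions of finite seminorm with compact support. -/
theorem IsBoundedWeakSol.bilinForm_eq_integral {B : Set (RN N)} {G : ℝ} {u g : RN N → ℝ}
    (hs : IsBoundedWeakSol K j B G u g) (hK : KernelBounds K j Λ)
    (hKm : Measurable (Function.uncurry K)) (hj : Measurable j)
    (hjs : ∀ ρ > 0, scaleMass j ρ < ∞) {k : RN N → RN N → ℝ≥0∞} {C : ℝ≥0}
    (hk : IsControlKernel K j k C) (hB : IsOpen B) {S : Set (RN N)} (hS : IsCompact S)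
    (hSB : S ⊆ B) {φ : RN N → ℝ} (hφ : Measurable φ) {b : ℝ} (hb : ∀ x, |φ x| ≤ b)
    (hφS : ∀ x ∉ S, φ x = 0) (hφ1 : seminormVSq j univ φ < ∞) :
    bilinForm K u φ = ∫ x, g x * φ x := by
  have hu := hs.measurable
  have hg := hs.measurable_rhs
  obtain ⟨δ, hδ, hδB⟩ := hS.exists_cthickening_subset_open hB hSB
  obtain ⟨ψ, P, hP, hψ, hψeq, hψb, hψs, hψc, hψlim⟩ := exists_mollification hφ hb hS hφS hδ
  set T := Metric.cthickening δ S with hT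
  have hTc : IsCompact T := hS.cthickening
  have hb0 : 0 ≤ b := (abs_nonneg _).trans (hb 0)
  have hψm : ∀ n, Measurable (ψ n) := fun n => (hψ n).continuous.measurable
  have hψT : ∀ n, ∀ x ∉ T, ψ n x = 0 := fun n x hx =>
    image_eq_zero_of_notMem_tsupport fun h => hx (hψs n h)
  have hφT : ∀ x ∉ T, φ x = 0 := fun x hx => hφS x fun h => hx (Metric.self_subset_cthickening S h)
  have hψ1 : ∀ n, seminormVSq j univ (ψ n) ≤ seminormVSq j univ φ := fun n =>
    have := hP n
    seminormVSq_average_le hj hφ hb (P n) (hψeq n)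
  have heqn : ∀ n, bilinForm K u (ψ n) = ∫ x, g x * ψ n x := fun n =>
    hs.eq (ψ n) (hψ n) (hψc n) ((hψs n).trans hδB)
  have hTint : Integrable (T.indicator fun _ => G * b) :=
    (integrable_indicator_iff hTc.measurableSet).2 (integrableOn_const hTc.measure_lt_top.ne)
  have lim1 : Tendsto (fun n => ∫ x, g x * ψ n x) atTop (𝓝 (∫ x, g x * φ x)) := by
    refine tendsto_integral_of_dominated_convergence (T.indicator fun _ => G * b)
      (fun n => (hg.mul (hψm n)).aestronglyMeasurable) hTint
      (fun n => Eventually.of_forall fun x => ?_) ?_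
    · by_cases hx : x ∈ T
      · rw [indicator_of_mem hx, Real.norm_eq_abs, abs_mul]
        exact mul_le_mul (hs.abs_rhs_le x) (hψb n x) (abs_nonneg _)
          ((abs_nonneg _).trans (hs.abs_rhs_le x))
      · simp [hψT n x hx, hx]
    · filter_upwards [hψlim] with x hx using hx.const_mul _
  have hψlim1 : ∀ᵐ p : RN N × RN N, Tendsto (fun n => ψ n p.1) atTop (𝓝 (φ p.1)) :=
    Measure.quasiMeasurePreserving_fst.ae hψlim
  have hψlim2 : ∀ᵐ p : RN N × RN N, Tendsto (fun n => ψ n p.2) atTop (𝓝 (φ p.2)) :=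
    Measure.quasiMeasurePreserving_snd.ae hψlim
  have ham := measurable_antiPart hKm
  have hsm := measurable_symPart hKm
  have lim2 : Tendsto (fun n => ∫ p : RN N × RN N, (u p.1 - u p.2) * ψ n p.1 * antiPart K p.1 p.2)
      atTop (𝓝 (∫ p : RN N × RN N, (u p.1 - u p.2) * φ p.1 * antiPart K p.1 p.2)) := by
    have hdom : Integrable fun p : RN N × RN N =>
        (u p.1 - u p.2) * T.indicator (fun _ => b) p.1 * antiPart K p.1 p.2 :=
      integrable_antiPart_form hK hKm hj hjs hk hB hTc hδB hu hs.abs_le hs.seminorm_lt_top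
        (measurable_const.indicator hTc.measurableSet) (fun x hx => indicator_of_notMem hx _)
        (b := b) (fun x => by
          by_cases hx : x ∈ T
          · simp [hx, abs_of_nonneg hb0]
          · simp [hx, hb0])
    refine tendsto_integral_of_dominated_convergence _ (fun n => ?_) hdom.abs
      (fun n => Eventually.of_forall fun p => ?_) ?_
    · have := hψm n
      exact Measurable.aestronglyMeasurable (by fun_prop)
    · by_cases hx : p.1 ∈ T
      · rw [indicator_of_mem hx, Real.norm_eq_abs, abs_mul, abs_mul, abs_mul, abs_mul,
          abs_of_nonneg hb0]
        gcongr
        exact hψb n p.1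
      · simp [hψT n _ hx, hx]
    · filter_upwards [hψlim1] with p hp
      exact (hp.const_mul _).mul_const _
  -- Strong convergence in energy is not needed. The mollifications have energies bounded by that of
  -- `φ` and converge almost everywhere, hence weakly once `K_s` is split into two square roots.
  have lim3 : Tendsto (fun n => ∫ p : RN N × RN N,
      (u p.1 - u p.2) * (ψ n p.1 - ψ n p.2) * symPart K p.1 p.2)
      atTop (𝓝 (∫ p : RN N × RN N, (u p.1 - u p.2) * (φ p.1 - φ p.2) * symPart K p.1 p.2)) := by
    set D : Set (RN N × RN N) := {p | p.1 ∈ B ∨ p.2 ∈ B} with hD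
    have hDm : MeasurableSet D :=
      (measurable_fst hB.measurableSet).union (measurable_snd hB.measurableSet)
    have hlimD := tendsto_integral_mul_zero (μ := (volume : Measure (RN N × RN N)))
      (F := fun p => D.indicator (fun p => (u p.1 - u p.2) * √(symPart K p.1 p.2)) p)
      (D := fun n p => ((ψ n p.1 - ψ n p.2) - (φ p.1 - φ p.2)) * √(symPart K p.1 p.2))
      (C := 4 * (Λ * seminormVSq j univ φ)) (Measurable.indicator (by fun_prop) hDm)
      (fun n => by have := hψm n; fun_prop) ?_ ?_ ?_ ?_
    · have e : ∀ n, ∫ p : RN N × RN N,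
          D.indicator (fun p => (u p.1 - u p.2) * √(symPart K p.1 p.2)) p *
            (((ψ n p.1 - ψ n p.2) - (φ p.1 - φ p.2)) * √(symPart K p.1 p.2)) =
          (∫ p : RN N × RN N, (u p.1 - u p.2) * (ψ n p.1 - ψ n p.2) * symPart K p.1 p.2) -
            ∫ p : RN N × RN N, (u p.1 - u p.2) * (φ p.1 - φ p.2) * symPart K p.1 p.2 := by
        intro n
        rw [← integral_sub
          (integrable_symPart_form hK hKm hj hB.measurableSet hu hs.seminorm_lt_top (hψm n)
            (fun x hx => hψT n x fun h => hx (hδB h)) ((hψ1 n).trans_lt hφ1))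
          (integrable_symPart_form hK hKm hj hB.measurableSet hu hs.seminorm_lt_top hφ
            (fun x hx => hφT x fun h => hx (hδB h)) hφ1)]
        refine integral_congr_ae (Eventually.of_forall fun p => ?_)
        by_cases hp : p ∈ D
        · have := Real.mul_self_sqrt (symPart_nonneg K p.1 p.2)
          simp only [indicator_of_mem hp]
          rw [← sub_mul, ← mul_sub, ← this]
          rw [Real.mul_self_sqrt (symPart_nonneg K p.1 p.2)]
          linear_combination ((u p.1 - u p.2) * ((ψ n p.1 - ψ n p.2) - (φ p.1 - φ p.2))) * this
        · simp only [hD, mem_ofPred_eq, not_or] at hp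
          simp [hψT n _ (fun h => hp.1 (hδB h)), hψT n _ (fun h => hp.2 (hδB h)),
            hφT _ (fun h => hp.1 (hδB h)), hφT _ (fun h => hp.2 (hδB h))]
      simp_rw [e] at hlimD
      simpa using hlimD.add_const
        (∫ p : RN N × RN N, (u p.1 - u p.2) * (φ p.1 - φ p.2) * symPart K p.1 p.2)
    · refine lt_of_le_of_lt (le_of_eq (lintegral_congr fun p => ?_))
        ((lintegral_symPart_le hK hj hB.measurableSet hu).trans_lt
          (ENNReal.mul_lt_top ENNReal.coe_lt_top hs.seminorm_lt_top))
      by_cases hp : p ∈ D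
      · have hp' : p ∈ {p : RN N × RN N | p.1 ∈ B ∨ p.2 ∈ B} := hp
        rw [indicator_of_mem hp, indicator_of_mem hp', mul_pow,
          Real.sq_sqrt (symPart_nonneg K p.1 p.2), ENNReal.ofReal_mul (sq_nonneg _)]
      · have hp' : p ∉ {p : RN N × RN N | p.1 ∈ B ∨ p.2 ∈ B} := hp
        simp [indicator_of_notMem hp, indicator_of_notMem hp']
    · exact ENNReal.mul_ne_top (by simp) (ENNReal.mul_ne_top (by simp) hφ1.ne)
    · intro n
      have hE : ∀ v : RN N → ℝ, Measurable v → ∫⁻ p : RN N × RN N,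
          ENNReal.ofReal ((v p.1 - v p.2) ^ 2) * ENNReal.ofReal (symPart K p.1 p.2) ≤
            Λ * seminormVSq j univ v := by
        intro v hv
        simpa using lintegral_symPart_le hK hj MeasurableSet.univ hv
      have hψn := hψm n
      calc ∫⁻ p : RN N × RN N, ENNReal.ofReal
            ((((ψ n p.1 - ψ n p.2) - (φ p.1 - φ p.2)) * √(symPart K p.1 p.2)) ^ 2)
          ≤ ∫⁻ p : RN N × RN N, (2 * (ENNReal.ofReal ((ψ n p.1 - ψ n p.2) ^ 2) *
                ENNReal.ofReal (symPart K p.1 p.2)) +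
              2 * (ENNReal.ofReal ((φ p.1 - φ p.2) ^ 2) * ENNReal.ofReal (symPart K p.1 p.2))) := by
            refine lintegral_mono fun p => ?_
            rw [mul_pow, Real.sq_sqrt (symPart_nonneg K p.1 p.2), ENNReal.ofReal_mul (sq_nonneg _),
              ← mul_assoc, ← mul_assoc, ← add_mul]
            exact mul_le_mul' (ofReal_sub_sq_le _ _) le_rfl
        _ ≤ 2 * (Λ * seminormVSq j univ φ) + 2 * (Λ * seminormVSq j univ φ) := by
            rw [lintegral_add_left (by fun_prop), lintegral_const_mul _ (by fun_prop),
              lintegral_const_mul _ (by fun_prop)]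
            gcongr
            · exact (hE _ hψn).trans (by gcongr; exact hψ1 n)
            · exact hE _ hφ
        _ = 4 * (Λ * seminormVSq j univ φ) := by
            rw [← add_mul]; norm_num
    · filter_upwards [hψlim1, hψlim2] with p h1 h2
      have := (((h1.sub h2).sub_const (φ p.1 - φ p.2)).mul_const √(symPart K p.1 p.2))
      simpa using this
  have lim4 : Tendsto (fun n => bilinForm K u (ψ n)) atTop (𝓝 (bilinForm K u φ)) :=
    (lim3.const_mul _).add lim2
  simp_rw [heqn] at lim4
  exact tendsto_nhds_unique lim4 lim1

end TestFunctions

/-! ### The truncation estimate in one variable. -/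

section LowerBound

variable {N : ℕ} {K : RN N → RN N → ℝ≥0∞} {j : RN N → ℝ≥0} {Λ : ℝ≥0}

theorem integral_le_of_lintegral_ofReal_le {α : Type*} [MeasurableSpace α] {μ : Measure α}
    {f : α → ℝ} (hf : Measurable f) (hf0 : ∀ p, 0 ≤ f p) {c : ℝ} (hc : 0 ≤ c)
    (h : ∫⁻ p, ENNReal.ofReal (f p) ∂μ ≤ ENNReal.ofReal c) : Integrable f μ ∧ ∫ p, f p ∂μ ≤ c := by
  constructor
  · refine integrable_of_enorm_le hf (G := fun p => ENNReal.ofReal (f p)) (fun p => ?_)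
      (h.trans_lt ENNReal.ofReal_lt_top)
    rw [Real.enorm_eq_ofReal (hf0 p)]
  · rw [integral_eq_lintegral_of_nonneg_ae (Eventually.of_forall hf0) hf.aestronglyMeasurable]
    exact ENNReal.toReal_le_of_le_ofReal hc h

theorem integral_add_add_sub_sub {α : Type*} [MeasurableSpace α] {μ : Measure α}
    {a b c d e : α → ℝ} (ha : Integrable a μ) (hb : Integrable b μ) (hc : Integrable c μ)
    (hd : Integrable d μ) (he : Integrable e μ) :
    ∫ p, ((a p + (b p + c p)) - (d p - e p)) ∂μ =
      (∫ p, a p ∂μ + (∫ p, b p ∂μ + ∫ p, c p ∂μ)) - (∫ p, d p ∂μ - ∫ p, e p ∂μ) := by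
  rw [← integral_add hb hc, ← integral_sub hd he]
  change ∫ p, ((a + (b + c)) - (d - e)) p ∂μ = _
  rw [integral_sub' (ha.add (hb.add hc)) (hd.sub he), integral_add' ha (hb.add hc)]
  rfl

/-- The two weights may differ. When the signs of `a` and `a'` differ, the negative part that
truncation discards only helps, because the weights are nonnegative. -/
theorem max_sub_mul_le {a a' κ κ' : ℝ} (hκ : 0 ≤ κ) (hκ' : 0 ≤ κ') :
    (max a 0 - max a' 0) * (max a 0 * κ - max a' 0 * κ') ≤
      (a - a') * (max a 0 * κ - max a' 0 * κ') := by
  rcases le_total a 0 with h | h <;> rcases le_total a' 0 with h' | h'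
  · simp [h, h']
  · simp only [max_eq_right h, max_eq_left h']
    nlinarith [mul_nonneg (mul_nonneg h' hκ') (neg_nonneg.2 h)]
  · simp only [max_eq_left h, max_eq_right h']
    nlinarith [mul_nonneg (mul_nonneg h hκ) (neg_nonneg.2 h')]
  · simp only [max_eq_left h, max_eq_left h']
    exact le_rfl

/-- The pointwise inequality behind the energy estimate for `(u - ψ)₊`. -/
theorem energy_integrand_lower_bound {a a' d s t m m' : ℝ} (hm : 0 ≤ m) (hm' : 0 ≤ m')
    (hmK : m ≤ s + t) (hmK' : m' ≤ s - t) :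
    (max a 0 - max a' 0) ^ 2 * s - |max a 0 - max a' 0| * |max a 0 + max a' 0| * |t|
      - (|d| * (max a 0 * (s + t)) + |d| * (max a' 0 * (s - t)))
      - 2 * ((max a 0 ^ 2 + max a' 0 ^ 2) * (m + m')) ≤
    (a - a' + d) * ((max a 0 - max a' 0) * s + (max a 0 + max a' 0) * t -
      (max a 0 * m - max a' 0 * m')) := by
  -- The weights are what is left of `K(x, y) = s + t` and `K(y, x) = s - t` once `m` and `m'` are
  -- removed. Nonnegativity of these remainders is all that is used of the bounds on `m`.
  have key := max_sub_mul_le (a := a) (a' := a') (κ := s + t - m) (κ' := s - t - m')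
    (by linarith) (by linarith)
  set f := max a 0 with hf
  set f' := max a' 0 with hf'
  have hf0 : 0 ≤ f := le_max_right _ _
  have hf0' : 0 ≤ f' := le_max_right _ _
  have e1 : (f - f') * s + (f + f') * t - (f * m - f' * m') =
      f * (s + t - m) - f' * (s - t - m') := by ring
  have h1 : -(|d| * (f * (s + t)) + |d| * (f' * (s - t))) ≤
      d * (f * (s + t - m) - f' * (s - t - m')) := by
    have hA0 : 0 ≤ f * (s + t - m) := mul_nonneg hf0 (by linarith)
    have hB0 : 0 ≤ f' * (s - t - m') := mul_nonneg hf0' (by linarith)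
    have hA : f * (s + t - m) ≤ f * (s + t) := mul_le_mul_of_nonneg_left (by linarith) hf0
    have hB : f' * (s - t - m') ≤ f' * (s - t) := mul_le_mul_of_nonneg_left (by linarith) hf0'
    have h2 : |f * (s + t - m) - f' * (s - t - m')| ≤ f * (s + t) + f' * (s - t) := by
      rw [abs_le]; constructor <;> linarith
    have h3 := neg_abs_le (d * (f * (s + t - m) - f' * (s - t - m')))
    rw [abs_mul] at h3
    have h4 := mul_le_mul_of_nonneg_left h2 (abs_nonneg d)
    linarith
  have h2 : -(|f - f'| * |f + f'| * |t|) ≤ (f - f') * (f + f') * t := by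
    rw [← abs_mul, ← abs_mul]; exact neg_abs_le _
  -- Removing `m` from the energy costs only a term without increments, because `m` will have finite
  -- marginals.
  have h3 : (f - f') * (f * m - f' * m') ≤ 2 * ((f ^ 2 + f' ^ 2) * (m + m')) := by
    have a1 : 0 ≤ f * f' := mul_nonneg hf0 hf0'
    have a2 : 0 ≤ (f - f') ^ 2 := sq_nonneg _
    have a3 : f * f' ≤ f ^ 2 + f' ^ 2 := by nlinarith [sq_nonneg f, sq_nonneg f']
    have b1 : (f - f') * (f * m - f' * m') = (f ^ 2 - f * f') * m + (f' ^ 2 - f * f') * m' := by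
      ring
    rw [b1]
    have c1 : (f ^ 2 - f * f') * m ≤ (f ^ 2 + f' ^ 2) * m := by
      gcongr; nlinarith [sq_nonneg f']
    have c2 : (f' ^ 2 - f * f') * m' ≤ (f ^ 2 + f' ^ 2) * m' := by
      gcongr; nlinarith [sq_nonneg f]
    have c3 : 0 ≤ (f ^ 2 + f' ^ 2) * (m + m') := by positivity
    nlinarith
  rw [e1]
  nlinarith

/-- The energy estimate for the truncation `(u - ψ)₊`, with a part `m` of the kernel singled out. -/
theorem IsBoundedWeakSol.truncation_estimate {B : Set (RN N)} {G : ℝ} {u g : RN N → ℝ}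
    (hs : IsBoundedWeakSol K j B G u g) (hK : KernelBounds K j Λ)
    (hKm : Measurable (Function.uncurry K)) (hj : Measurable j)
    (hjs : ∀ ρ > 0, scaleMass j ρ < ∞) {k : RN N → RN N → ℝ≥0∞} {C : ℝ≥0}
    (hk : IsControlKernel K j k C) (hB : IsOpen B) {S : Set (RN N)} (hS : IsCompact S)
    (hSB : S ⊆ B) {ψ : RN N → ℝ} (hψ : Measurable ψ) {L : ℝ}
    (hψL : ∀ x y, |ψ x - ψ y| ≤ L * min 1 ‖x - y‖) {P : ℝ≥0}
    (hψP : ∀ x, ∫⁻ y, ENNReal.ofReal |ψ x - ψ y| * (j (y - x) : ℝ≥0∞) ≤ P)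
    (hψS : ∀ x ∉ S, u x ≤ ψ x) {b : ℝ} (hb0 : 0 ≤ b) (hb : ∀ x, u x - ψ x ≤ b)
    {m : RN N × RN N → ℝ} (hm : Measurable m) (hm0 : ∀ p, 0 ≤ m p)
    (hmK : ∀ p, p.1 ≠ p.2 → m p ≤ (K p.1 p.2).toReal) {μ : ℝ≥0}
    (hm1 : ∀ x, ∫⁻ y, ENNReal.ofReal (m (x, y)) ≤ μ)
    (hm2 : ∀ y, ∫⁻ x, ENNReal.ofReal (m (x, y)) ≤ μ) :
    (∫ x, max (u x - ψ x) 0 * ∫ y, (u x - u y) * m (x, y))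
      - Λ * P * (∫ x, max (u x - ψ x) 0) - (2 * C + 4 * μ) * (∫ x, max (u x - ψ x) 0 ^ 2) ≤
      ∫ x, g x * max (u x - ψ x) 0 := by
  have hu := hs.measurable
  set φ : RN N → ℝ := fun x => max (u x - ψ x) 0 with hφ
  have hφm : Measurable φ := (hu.sub hψ).max measurable_const
  have hφ0 : ∀ x, 0 ≤ φ x := fun x => le_max_right _ _
  have hφb : ∀ x, |φ x| ≤ b := fun x => by
    rw [abs_of_nonneg (hφ0 x)]; exact max_le (hb x) hb0
  have hφS : ∀ x ∉ S, φ x = 0 := fun x hx => max_eq_right (by linarith [hψS x hx])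
  have hφ1 : seminormVSq j univ φ < ∞ := by
    refine seminormVSq_lt_top_of_increment_le hj (hjs 1 one_pos) hB.measurableSet hS.measurableSet
      hSB hS.measure_lt_top hu hs.seminorm_lt_top hφS (L := L) fun x y _ => ?_
    refine (abs_max_sub_max_le_abs _ _ _).trans ?_
    have e : u x - ψ x - (u y - ψ y) = (u x - u y) - (ψ x - ψ y) := by ring
    rw [e]
    exact (abs_sub _ _).trans (add_le_add_right (hψL x y) _)
  have hφint : Integrable φ := by
    refine Integrable.mono' (g := S.indicator fun _ => b) ?_ hφm.aestronglyMeasurable ?_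
    · exact (integrable_indicator_iff hS.measurableSet).2 (integrableOn_const hS.measure_lt_top.ne)
    · refine Eventually.of_forall fun x => ?_
      by_cases hx : x ∈ S
      · simpa [hx] using hφb x
      · simp [hx, hφS x hx]
  have hφ2int : Integrable fun x => φ x ^ 2 := by
    simp_rw [pow_two]
    exact hφint.mul_bdd (c := b) hφm.aestronglyMeasurable (Eventually.of_forall hφb)
  have hφl : ∫⁻ x, ENNReal.ofReal (φ x) = ENNReal.ofReal (∫ x, φ x) :=
    (ofReal_integral_eq_lintegral_ofReal hφint (Eventually.of_forall hφ0)).symm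
  have hφ2l : ∫⁻ x, ENNReal.ofReal (φ x ^ 2) = ENNReal.ofReal (∫ x, φ x ^ 2) :=
    (ofReal_integral_eq_lintegral_ofReal hφ2int (Eventually.of_forall fun x => sq_nonneg _)).symm
  have hI1 : 0 ≤ ∫ x, φ x := integral_nonneg hφ0
  have hI2 : 0 ≤ ∫ x, φ x ^ 2 := integral_nonneg fun x => sq_nonneg _
  have heq := hs.bilinForm_eq_integral hK hKm hj hjs hk hB hS hSB hφm hφb hφS hφ1
  have ham := measurable_antiPart hKm
  have hsm := measurable_symPart hKm
  have hKt := measurable_toReal_kernel hKm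
  have hms : Measurable fun p : RN N × RN N => m p.swap := hm.comp measurable_swap
  -- integrability of the three forms
  have iS : Integrable fun p : RN N × RN N =>
      (u p.1 - u p.2) * (φ p.1 - φ p.2) * symPart K p.1 p.2 :=
    integrable_symPart_form hK hKm hj hB.measurableSet hu hs.seminorm_lt_top hφm
      (fun x hx => hφS x fun h => hx (hSB h)) hφ1
  have iA : Integrable fun p : RN N × RN N => (u p.1 - u p.2) * φ p.1 * antiPart K p.1 p.2 :=
    integrable_antiPart_form hK hKm hj hjs hk hB hS hSB hu hs.abs_le hs.seminorm_lt_top hφm hφS hφb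
  have hlm1 : ∀ a : RN N → ℝ≥0∞, Measurable a →
      ∫⁻ p : RN N × RN N, a p.1 * ENNReal.ofReal (m p) ≤ μ * ∫⁻ x, a x := fun a ha =>
    lintegral_prod_fst_mul_le ha hm.ennreal_ofReal hm1
  have hlm2 : ∀ a : RN N → ℝ≥0∞, Measurable a →
      ∫⁻ p : RN N × RN N, a p.1 * ENNReal.ofReal (m p.swap) ≤ μ * ∫⁻ x, a x := fun a ha =>
    lintegral_prod_fst_mul_le ha hms.ennreal_ofReal hm2
  have iM : Integrable fun p : RN N × RN N => (u p.1 - u p.2) * φ p.1 * m p := by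
    refine integrable_of_enorm_le (by fun_prop)
      (G := fun p => 2 * (ENNReal.ofReal (φ p.1) * ENNReal.ofReal (m p))) (fun p => ?_) ?_
    · rw [← ENNReal.ofReal_mul (hφ0 _), ← ENNReal.ofReal_ofNat, ← ENNReal.ofReal_mul (by norm_num),
        Real.enorm_eq_ofReal_abs, abs_mul, abs_mul, abs_of_nonneg (hφ0 _), abs_of_nonneg (hm0 p),
        mul_assoc]
      refine ENNReal.ofReal_le_ofReal (mul_le_mul_of_nonneg_right ?_ (mul_nonneg (hφ0 _) (hm0 p)))
      have := abs_sub (u p.1) (u p.2)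
      linarith [hs.abs_le p.1, hs.abs_le p.2]
    · rw [lintegral_const_mul' _ _ (by simp)]
      refine ENNReal.mul_lt_top (by simp) ((hlm1 _ hφm.ennreal_ofReal).trans_lt ?_)
      rw [hφl]
      exact ENNReal.mul_lt_top (by simp) (by simp)
  -- symmetrization
  have iA' : Integrable fun p : RN N × RN N => (u p.1 - u p.2) * φ p.2 * antiPart K p.1 p.2 := by
    refine iA.swap.congr (Eventually.of_forall fun p => ?_)
    simp only [Function.comp_apply, Prod.fst_swap, Prod.snd_swap]
    rw [antiPart_comm K p.2 p.1]; ring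
  have eA : ∫ p : RN N × RN N, (u p.1 - u p.2) * φ p.2 * antiPart K p.1 p.2 =
      ∫ p : RN N × RN N, (u p.1 - u p.2) * φ p.1 * antiPart K p.1 p.2 := by
    rw [← integral_swap]
    refine integral_congr_ae (Eventually.of_forall fun p => ?_)
    simp only [Prod.fst_swap, Prod.snd_swap]
    rw [antiPart_comm K p.2 p.1]; ring
  have iM' : Integrable fun p : RN N × RN N => (u p.1 - u p.2) * φ p.2 * m p.swap := by
    refine iM.swap.neg.congr (Eventually.of_forall fun p => ?_)
    simp only [Pi.neg_apply, Function.comp_apply, Prod.fst_swap, Prod.snd_swap]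
    ring
  have eM : ∫ p : RN N × RN N, (u p.1 - u p.2) * φ p.2 * m p.swap =
      -∫ p : RN N × RN N, (u p.1 - u p.2) * φ p.1 * m p := by
    rw [← integral_swap, ← integral_neg]
    refine integral_congr_ae (Eventually.of_forall fun p => ?_)
    simp only [Prod.fst_swap, Prod.snd_swap, Prod.swap_swap]
    ring
  -- Symmetrization pairs `φ(x)` with `K(x, y)` and `-φ(y)` with `K(y, x)`, which is the shape to
  -- which the pointwise bound applies; the integral is twice the form minus twice the part carried
  -- by `m`.
  set X : RN N × RN N → ℝ := fun p => (u p.1 - u p.2) * ((φ p.1 - φ p.2) * symPart K p.1 p.2 +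
    (φ p.1 + φ p.2) * antiPart K p.1 p.2 - (φ p.1 * m p - φ p.2 * m p.swap)) with hX
  have iAA := iA.add iA'
  have iMM := iM.sub iM'
  have iX : Integrable X := by
    refine ((iS.add iAA).sub iMM).congr (Eventually.of_forall fun p => ?_)
    simp only [Pi.add_apply, Pi.sub_apply, hX]
    ring
  have eX : ∫ p, X p = 2 * (bilinForm K u φ - ∫ p : RN N × RN N, (u p.1 - u p.2) * φ p.1 * m p) := by
    have e1 : ∫ p, X p = ∫ p : RN N × RN N, (((u p.1 - u p.2) * (φ p.1 - φ p.2) * symPart K p.1 p.2 +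
        ((u p.1 - u p.2) * φ p.1 * antiPart K p.1 p.2 +
          (u p.1 - u p.2) * φ p.2 * antiPart K p.1 p.2)) -
        ((u p.1 - u p.2) * φ p.1 * m p - (u p.1 - u p.2) * φ p.2 * m p.swap)) := by
      refine integral_congr_ae (Eventually.of_forall fun p => ?_)
      simp only [hX]
      ring
    rw [e1, integral_add_add_sub_sub iS iA iA' iM iM', eA, eM, bilinForm]
    ring
  -- the lower bound of the symmetrized integrand
  set F₁ : RN N × RN N → ℝ := fun p => (φ p.1 - φ p.2) ^ 2 * symPart K p.1 p.2 with hF₁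
  set F₂ : RN N × RN N → ℝ := fun p =>
    |φ p.1 - φ p.2| * |φ p.1 + φ p.2| * |antiPart K p.1 p.2| with hF₂
  set F₃ : RN N × RN N → ℝ := fun p => |ψ p.1 - ψ p.2| * (φ p.1 * (K p.1 p.2).toReal) with hF₃
  set F₄ : RN N × RN N → ℝ := fun p => (φ p.1 ^ 2 + φ p.2 ^ 2) * (m p + m p.swap) with hF₄
  have mF₁ : Measurable F₁ := by fun_prop
  have mF₂ : Measurable F₂ := by fun_prop
  have mF₃ : Measurable F₃ := by fun_prop
  have mF₄ : Measurable F₄ := by fun_prop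
  have pF₁ : ∀ p, 0 ≤ F₁ p := fun p => mul_nonneg (sq_nonneg _) (symPart_nonneg K _ _)
  have pF₃ : ∀ p, 0 ≤ F₃ p := fun p =>
    mul_nonneg (abs_nonneg _) (mul_nonneg (hφ0 _) ENNReal.toReal_nonneg)
  have hXlow : ∀ p, F₁ p - F₂ p - (F₃ p + F₃ p.swap) - 2 * F₄ p ≤ X p := by
    intro p
    by_cases hne : p.1 = p.2
    · have h4 : 0 ≤ F₄ p := mul_nonneg (by positivity) (add_nonneg (hm0 _) (hm0 _))
      simp only [hF₁, hF₂, hF₃, hX, hne, Prod.fst_swap, Prod.snd_swap]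
      simpa using h4
    · have h := energy_integrand_lower_bound (a := u p.1 - ψ p.1) (a' := u p.2 - ψ p.2)
        (d := ψ p.1 - ψ p.2) (s := symPart K p.1 p.2) (t := antiPart K p.1 p.2) (hm0 p)
        (hm0 p.swap) ((hmK p hne).trans (toReal_eq_symPart_add K _ _).le) (by
          refine (hmK p.swap (Ne.symm hne)).trans ?_
          rw [Prod.fst_swap, Prod.snd_swap, toReal_eq_symPart_add, symPart_comm, antiPart_comm]
          linarith)
      have e1 : u p.1 - ψ p.1 - (u p.2 - ψ p.2) + (ψ p.1 - ψ p.2) = u p.1 - u p.2 := by ring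
      have e2 : (K p.2 p.1).toReal = symPart K p.1 p.2 - antiPart K p.1 p.2 := by
        rw [toReal_eq_symPart_add, symPart_comm, antiPart_comm]; ring
      rw [e1] at h
      simp only [hF₁, hF₂, hF₃, hF₄, hX, Prod.fst_swap, Prod.snd_swap, e2, toReal_eq_symPart_add K p.1,
        abs_sub_comm (ψ p.2)]
      exact h
  have b1 : Integrable F₁ := by
    refine integrable_of_enorm_le mF₁ (G := fun p => ENNReal.ofReal (F₁ p))
      (fun p => by rw [Real.enorm_eq_ofReal (pF₁ p)]) ?_
    have h := (lintegral_symPart_le hK hj MeasurableSet.univ hφm).trans_lt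
      (ENNReal.mul_lt_top ENNReal.coe_lt_top hφ1)
    simp only [mem_univ, or_self, ofPred_true, indicator_univ] at h
    refine lt_of_le_of_lt (le_of_eq (lintegral_congr fun p => ?_)) h
    rw [ENNReal.ofReal_mul (sq_nonneg _)]
  have l1 : ∫⁻ p, ENNReal.ofReal (F₁ p) = ENNReal.ofReal (∫ p, F₁ p) :=
    (ofReal_integral_eq_lintegral_ofReal b1 (Eventually.of_forall pF₁)).symm
  have hF₁0 : 0 ≤ ∫ p, F₁ p := integral_nonneg pF₁
  -- Weighted Cauchy–Schwarz with weight `k`. The `k`-energy of `φ` is at most the integral of `F₁`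
  -- with coefficient exactly one, so it cancels against the energy retained in the lower bound and
  -- no smallness of `K_a` is required. The `4` comes from `(φ(x) + φ(y))² ≤ 2φ(x)² + 2φ(y)²` and
  -- the symmetry of the quotient.
  have b2 : Integrable F₂ ∧ ∫ p, F₂ p ≤ (∫ p, F₁ p) + 4 * C * ∫ x, φ x ^ 2 := by
    refine integral_le_of_lintegral_ofReal_le mF₂ (fun p => by positivity) (by positivity) ?_
    have hkm : Measurable fun p : RN N × RN N => k p.1 p.2 := hk.measurable
    have hqm := hk.measurable_div hKm
    have hform := hk.form_le φ (memV_univ_of_bounded hφm hφb hφ1)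
    set q : RN N × RN N → ℝ≥0∞ := fun p =>
      ENNReal.ofReal ((antiPart K p.1 p.2) ^ 2) / k p.1 p.2 with hq
    have hqs : ∀ p : RN N × RN N, q p.swap = q p := by
      intro p
      simp only [hq, Prod.fst_swap, Prod.snd_swap]
      rw [antiPart_comm K p.2 p.1, neg_sq, hk.symm]
    have hle1 : ∫⁻ p : RN N × RN N, ENNReal.ofReal (φ p.1 ^ 2) * q p ≤
        C * ENNReal.ofReal (∫ x, φ x ^ 2) := by
      rw [← hφ2l]
      exact hk.lintegral_mul_le hKm (hφm.pow_const 2).ennreal_ofReal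
    have hle2 : ∫⁻ p : RN N × RN N, ENNReal.ofReal (φ p.2 ^ 2) * q p ≤
        C * ENNReal.ofReal (∫ x, φ x ^ 2) := by
      rw [← lintegral_swap]
      simp only [Prod.snd_swap, hqs]
      exact hle1
    have m1 : Measurable fun p : RN N × RN N =>
      ENNReal.ofReal ((φ p.1 - φ p.2) ^ 2) * k p.1 p.2 := by fun_prop
    have m2 : Measurable fun p : RN N × RN N => ENNReal.ofReal (φ p.1 ^ 2) * q p := by fun_prop
    calc ∫⁻ p, ENNReal.ofReal (F₂ p)
        ≤ ∫⁻ p : RN N × RN N, (ENNReal.ofReal ((φ p.1 - φ p.2) ^ 2) * k p.1 p.2 +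
            2 * (ENNReal.ofReal (φ p.1 ^ 2) * q p + ENNReal.ofReal (φ p.2 ^ 2) * q p)) := by
          refine lintegral_mono fun p => ?_
          refine (ofReal_mul_abs_le _ _ _ (k p.1 p.2)).trans (add_le_add_right ?_ _)
          rw [← add_mul, ← mul_assoc]
          refine mul_le_mul' ?_ le_rfl
          rw [mul_add]
          have h := ofReal_sub_sq_le (φ p.1) (-φ p.2)
          rwa [sub_neg_eq_add, neg_sq] at h
      _ = (∫⁻ p : RN N × RN N, ENNReal.ofReal ((φ p.1 - φ p.2) ^ 2) * k p.1 p.2) +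
            2 * ((∫⁻ p : RN N × RN N, ENNReal.ofReal (φ p.1 ^ 2) * q p) +
              ∫⁻ p : RN N × RN N, ENNReal.ofReal (φ p.2 ^ 2) * q p) := by
          rw [lintegral_add_left m1, lintegral_const_mul' _ _ (by simp), lintegral_add_left m2]
      _ ≤ ENNReal.ofReal (∫ p, F₁ p) + 2 * (C * ENNReal.ofReal (∫ x, φ x ^ 2) +
            C * ENNReal.ofReal (∫ x, φ x ^ 2)) := by
          refine add_le_add ?_ (mul_le_mul' le_rfl (add_le_add hle1 hle2))
          rw [← l1]
          refine hform.trans (le_of_eq (lintegral_congr fun p => ?_))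
          rw [hF₁, ENNReal.ofReal_mul (sq_nonneg _)]
      _ = ENNReal.ofReal ((∫ p, F₁ p) + 4 * C * ∫ x, φ x ^ 2) := by
          rw [ENNReal.ofReal_add hF₁0 (by positivity), ENNReal.ofReal_mul (by positivity),
            ENNReal.ofReal_mul (by norm_num), ENNReal.ofReal_coe_nnreal, ENNReal.ofReal_ofNat]
          ring
  have b3 : Integrable F₃ ∧ ∫ p, F₃ p ≤ Λ * P * ∫ x, φ x := by
    refine integral_le_of_lintegral_ofReal_le mF₃ pF₃ (by positivity) ?_
    have hjm : Measurable fun p : RN N × RN N => j (p.2 - p.1) :=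
      hj.comp (measurable_snd.sub measurable_fst)
    calc ∫⁻ p, ENNReal.ofReal (F₃ p)
        ≤ ∫⁻ p : RN N × RN N, ENNReal.ofReal (φ p.1) *
            (Λ * (ENNReal.ofReal |ψ p.1 - ψ p.2| * (j (p.2 - p.1) : ℝ≥0∞))) := by
          refine lintegral_mono fun p => ?_
          by_cases hne : p.1 = p.2
          · simp [hF₃, hne]
          · rw [← ENNReal.ofReal_coe_nnreal, ← ENNReal.ofReal_coe_nnreal,
              ← ENNReal.ofReal_mul (abs_nonneg _), ← ENNReal.ofReal_mul Λ.coe_nonneg,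
              ← ENNReal.ofReal_mul (hφ0 _)]
            refine ENNReal.ofReal_le_ofReal ?_
            have h1 := mul_le_mul_of_nonneg_left (hK.toReal_le hne)
              (mul_nonneg (abs_nonneg (ψ p.1 - ψ p.2)) (hφ0 p.1))
            simp only [hF₃]
            nlinarith
      _ ≤ (Λ * P) * ∫⁻ x, ENNReal.ofReal (φ x) := by
          refine lintegral_prod_fst_mul_le hφm.ennreal_ofReal (by fun_prop) fun x => ?_
          rw [lintegral_const_mul' _ _ (by simp)]
          exact mul_le_mul' le_rfl (hψP x)
      _ = ENNReal.ofReal (Λ * P * ∫ x, φ x) := by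
          rw [hφl, ENNReal.ofReal_mul (by positivity), ENNReal.ofReal_mul (by positivity),
            ENNReal.ofReal_coe_nnreal, ENNReal.ofReal_coe_nnreal]
  have b4 : Integrable F₄ ∧ ∫ p, F₄ p ≤ 4 * μ * ∫ x, φ x ^ 2 := by
    refine integral_le_of_lintegral_ofReal_le mF₄ (fun p => mul_nonneg (by positivity)
      (add_nonneg (hm0 _) (hm0 _))) (by positivity) ?_
    have hφ2m : Measurable fun x => ENNReal.ofReal (φ x ^ 2) := (hφm.pow_const 2).ennreal_ofReal
    have hA := hlm1 _ hφ2m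
    have hB := hlm2 _ hφ2m
    rw [hφ2l] at hA hB
    have m1 : Measurable fun p : RN N × RN N =>
        ENNReal.ofReal (φ p.1 ^ 2) * ENNReal.ofReal (m p) := by fun_prop
    have m2 : Measurable fun p : RN N × RN N =>
        ENNReal.ofReal (φ p.1 ^ 2) * ENNReal.ofReal (m p.swap) := by fun_prop
    set H : RN N × RN N → ℝ≥0∞ := fun p => ENNReal.ofReal (φ p.1 ^ 2) * ENNReal.ofReal (m p) +
      ENNReal.ofReal (φ p.1 ^ 2) * ENNReal.ofReal (m p.swap) with hH
    have hHm : Measurable H := m1.add m2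
    have hHi : ∫⁻ p, H p ≤ 2 * (μ * ENNReal.ofReal (∫ x, φ x ^ 2)) := by
      simp only [hH]
      rw [lintegral_add_left m1, two_mul]
      exact add_le_add hA hB
    calc ∫⁻ p, ENNReal.ofReal (F₄ p) = ∫⁻ p, (H p + H p.swap) := by
          refine lintegral_congr fun p => ?_
          simp only [hH, hF₄, Prod.fst_swap, Prod.swap_swap]
          rw [ENNReal.ofReal_mul (by positivity), ENNReal.ofReal_add (by positivity) (by positivity),
            ENNReal.ofReal_add (hm0 _) (hm0 _)]
          ring
      _ = (∫⁻ p, H p) + ∫⁻ p, H p := by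
          rw [lintegral_add_left hHm, lintegral_swap]
      _ ≤ 2 * (μ * ENNReal.ofReal (∫ x, φ x ^ 2)) + 2 * (μ * ENNReal.ofReal (∫ x, φ x ^ 2)) :=
          add_le_add hHi hHi
      _ = ENNReal.ofReal (4 * μ * ∫ x, φ x ^ 2) := by
          rw [ENNReal.ofReal_mul (by positivity), ENNReal.ofReal_mul (by norm_num),
            ENNReal.ofReal_coe_nnreal, ENNReal.ofReal_ofNat, ← add_mul, ← mul_assoc]
          norm_num
  have i3s : Integrable fun p : RN N × RN N => F₃ p.swap := b3.1.swap
  have e3s : ∫ p : RN N × RN N, F₃ p.swap = ∫ p, F₃ p := integral_swap F₃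
  have hfinal := integral_mono (((b1.sub b2.1).sub (b3.1.add i3s)).sub (b4.1.const_mul 2)) iX hXlow
  rw [integral_sub' ((b1.sub b2.1).sub (b3.1.add i3s)) (b4.1.const_mul 2),
    integral_sub' (b1.sub b2.1) (b3.1.add i3s), integral_sub' b1 b2.1, integral_add' b3.1 i3s, e3s,
    integral_const_mul, eX, heq] at hfinal
  have hiter : ∫ p : RN N × RN N, (u p.1 - u p.2) * φ p.1 * m p =
      ∫ x, φ x * ∫ y, (u x - u y) * m (x, y) := by
    rw [Measure.volume_eq_prod, integral_prod _ iM]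
    refine integral_congr_ae (Eventually.of_forall fun x => ?_)
    simp only
    rw [← integral_const_mul]
    refine integral_congr_ae (Eventually.of_forall fun y => ?_)
    simp only
    ring
  rw [hiter] at hfinal
  have h2 := b2.2
  have h3 := b3.2
  have h4 := b4.2
  nlinarith

end LowerBound

/-! ### Shared jumps and the doubled truncation. -/

section Doubling

variable {N : ℕ} {K : RN N → RN N → ℝ≥0∞} {j : RN N → ℝ≥0} {Λ : ℝ≥0}

/-- The common part of the jumps longer than `ρ` from `x` and from `y`. -/
def sharedKernel (j : RN N → ℝ≥0) (ρ : ℝ) (x y w : RN N) : ℝ≥0 :=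
  min (cutKernel j ρ (w - x)) (cutKernel j ρ (w - y))

theorem sharedKernel_comm (j : RN N → ℝ≥0) (ρ : ℝ) (x y w : RN N) :
    sharedKernel j ρ x y w = sharedKernel j ρ y x w := min_comm _ _

theorem sharedKernel_le_left (j : RN N → ℝ≥0) (ρ : ℝ) (x y w : RN N) :
    sharedKernel j ρ x y w ≤ cutKernel j ρ (w - x) := min_le_left _ _

theorem measurable_sharedKernel (hj : Measurable j) (ρ : ℝ) :
    Measurable fun q : (RN N × RN N) × RN N => sharedKernel j ρ q.1.1 q.1.2 q.2 :=
  ((measurable_cutKernel hj ρ).comp (measurable_snd.sub (measurable_fst.comp measurable_fst))).min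
    ((measurable_cutKernel hj ρ).comp (measurable_snd.sub (measurable_snd.comp measurable_fst)))

theorem measurable_sharedKernel_left (hj : Measurable j) (ρ : ℝ) (y : RN N) :
    Measurable fun p : RN N × RN N => sharedKernel j ρ p.1 y p.2 :=
  ((measurable_cutKernel hj ρ).comp (measurable_snd.sub measurable_fst)).min
    ((measurable_cutKernel hj ρ).comp (measurable_snd.sub measurable_const))

theorem lintegral_cutKernel_sub_right (j : RN N → ℝ≥0) (ρ : ℝ) (x : RN N) :
    ∫⁻ w, (cutKernel j ρ (w - x) : ℝ≥0∞) = tailMass j ρ := by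
  rw [lintegral_sub_right_eq_self (fun z => (cutKernel j ρ z : ℝ≥0∞)) x, lintegral_cutKernel]

theorem lintegral_cutKernel_sub_left (j : RN N → ℝ≥0) (ρ : ℝ) (w : RN N) :
    ∫⁻ x, (cutKernel j ρ (w - x) : ℝ≥0∞) = tailMass j ρ := by
  rw [lintegral_sub_left_eq_self (fun z => (cutKernel j ρ z : ℝ≥0∞)) w, lintegral_cutKernel]

theorem lintegral_sharedKernel_le {ρ : ℝ} (hρ : 0 < ρ) (x y : RN N) :
    ∫⁻ w, (sharedKernel j ρ x y w : ℝ≥0∞) ≤ scaleMass j ρ := by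
  refine le_trans ?_ (tailMass_le_scaleMass hρ)
  rw [← lintegral_cutKernel_sub_right j ρ x]
  exact lintegral_mono fun w => ENNReal.coe_le_coe.2 (sharedKernel_le_left j ρ x y w)

theorem integrable_sharedKernel (hj : Measurable j) {ρ : ℝ} (hρ : 0 < ρ)
    (hfin : scaleMass j ρ < ∞) (x y : RN N) :
    Integrable (fun w => (sharedKernel j ρ x y w : ℝ)) ∧
      ∫ w, (sharedKernel j ρ x y w : ℝ) ≤ (scaleMass j ρ).toReal := by
  have hm : Measurable fun w => sharedKernel j ρ x y w :=
    ((measurable_cutKernel hj ρ).comp (measurable_id.sub measurable_const)).min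
      ((measurable_cutKernel hj ρ).comp (measurable_id.sub measurable_const))
  have h : ∫⁻ w, ENNReal.ofReal (sharedKernel j ρ x y w : ℝ) ≤
      ENNReal.ofReal (scaleMass j ρ).toReal := by
    rw [ENNReal.ofReal_toReal hfin.ne]
    simp only [ENNReal.ofReal_coe_nnreal]
    exact lintegral_sharedKernel_le hρ x y
  exact integral_le_of_lintegral_ofReal_le (f := fun w => (sharedKernel j ρ x y w : ℝ))
    hm.coe_nnreal_real (fun _ => NNReal.coe_nonneg _) ENNReal.toReal_nonneg h

theorem le_integral_sharedKernel (hj : Measurable j) {ρ κ : ℝ} (hρ : 0 < ρ) (hκ : 0 ≤ κ)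
    (hfin : scaleMass j ρ < ∞) {x y : RN N}
    (h : ENNReal.ofReal κ * scaleMass j ρ ≤
      ∫⁻ z, ((min (cutKernel j ρ z) (cutKernel j ρ (z + (x - y))) : ℝ≥0) : ℝ≥0∞)) :
    κ * (scaleMass j ρ).toReal ≤ ∫ w, (sharedKernel j ρ x y w : ℝ) := by
  have e : ∫⁻ z, ((min (cutKernel j ρ z) (cutKernel j ρ (z + (x - y))) : ℝ≥0) : ℝ≥0∞) =
      ∫⁻ w, (sharedKernel j ρ x y w : ℝ≥0∞) := by
    rw [← lintegral_sub_right_eq_self _ x]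
    refine lintegral_congr fun w => ?_
    rw [sharedKernel, sub_add_sub_cancel]
  rw [e] at h
  have hi := (integrable_sharedKernel hj hρ hfin x y).1
  have h2 := ofReal_integral_eq_lintegral_ofReal hi (Eventually.of_forall fun _ => NNReal.coe_nonneg _)
  simp only [ENNReal.ofReal_coe_nnreal] at h2
  rw [← h2, ← ENNReal.ofReal_toReal hfin.ne, ← ENNReal.ofReal_mul hκ] at h
  exact (ENNReal.ofReal_le_ofReal_iff (integral_nonneg fun _ => NNReal.coe_nonneg _)).1 h

/-- The positive part of `u(x) - u(y) - Φ(x, y)`. -/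
def truncDiff (u : RN N → ℝ) (Φ : RN N × RN N → ℝ) (p : RN N × RN N) : ℝ :=
  max (u p.1 - u p.2 - Φ p) 0

/-- The contribution at `(x, y)` of the shared jumps starting from `x`. -/
def sharedDrift (j : RN N → ℝ≥0) (ρ c : ℝ) (u : RN N → ℝ) (p : RN N × RN N) : ℝ :=
  ∫ w, (u p.1 - u w) * (c * sharedKernel j ρ p.1 p.2 w)

theorem measurable_sharedDrift (hj : Measurable j) (ρ c : ℝ) {u : RN N → ℝ} (hu : Measurable u) :
    Measurable (sharedDrift j ρ c u) := by
  have h := measurable_sharedKernel hj ρ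
  have hm : Measurable (Function.uncurry fun (p : RN N × RN N) (w : RN N) =>
      (u p.1 - u w) * (c * (sharedKernel j ρ p.1 p.2 w : ℝ))) := by
    have h' : Measurable fun q : (RN N × RN N) × RN N =>
      (sharedKernel j ρ q.1.1 q.1.2 q.2 : ℝ) := h.coe_nnreal_real
    have : Measurable fun q : (RN N × RN N) × RN N =>
      (u q.1.1 - u q.2) * (c * (sharedKernel j ρ q.1.1 q.1.2 q.2 : ℝ)) := by fun_prop
    exact this
  exact hm.stronglyMeasurable.integral_prod_right.measurable

theorem integrable_sharedDrift_integrand (hj : Measurable j) {ρ c : ℝ} (hρ : 0 < ρ)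
    (hfin : scaleMass j ρ < ∞) {u : RN N → ℝ} (hu : Measurable u) (hub : ∀ x, |u x| ≤ 1)
    (b : ℝ) (hb : |b| ≤ 1) (x y : RN N) :
    Integrable fun w => (b - u w) * (c * (sharedKernel j ρ x y w : ℝ)) := by
  refine Integrable.bdd_mul (c := 2) ((integrable_sharedKernel hj hρ hfin x y).1.const_mul c)
    (measurable_const.sub hu).aestronglyMeasurable (Eventually.of_forall fun w => ?_)
  have := abs_sub b (u w)
  rw [Real.norm_eq_abs]
  linarith [hub w]

theorem abs_sharedDrift_le (hj : Measurable j) {ρ c : ℝ} (hρ : 0 < ρ) (hc : 0 ≤ c)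
    (hfin : scaleMass j ρ < ∞) {u : RN N → ℝ} (hub : ∀ x, |u x| ≤ 1)
    (p : RN N × RN N) : |sharedDrift j ρ c u p| ≤ 2 * (c * (scaleMass j ρ).toReal) := by
  obtain ⟨hi, hle⟩ := integrable_sharedKernel hj hρ hfin p.1 p.2
  have h : ‖∫ w, (u p.1 - u w) * (c * (sharedKernel j ρ p.1 p.2 w : ℝ))‖ ≤
      ∫ w, 2 * (c * (sharedKernel j ρ p.1 p.2 w : ℝ)) := by
    refine norm_integral_le_of_norm_le ((hi.const_mul c).const_mul 2)
      (Eventually.of_forall fun w => ?_)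
    have := abs_sub (u p.1) (u w)
    have h0 : 0 ≤ c * (sharedKernel j ρ p.1 p.2 w : ℝ) := by positivity
    rw [Real.norm_eq_abs, abs_mul, abs_of_nonneg h0]
    refine mul_le_mul_of_nonneg_right ?_ h0
    linarith [hub p.1, hub w]
  rw [integral_const_mul, integral_const_mul] at h
  exact h.trans (mul_le_mul_of_nonneg_left (mul_le_mul_of_nonneg_left hle hc) (by norm_num))

/-- The coalescence identity: the shared kernel is symmetric in the two starting points, so the
value of `u` at the common landing point cancels. The second summand is the contribution of the
variable `y`, written for `-u`. -/
theorem sharedDrift_add_swap (hj : Measurable j) {ρ c : ℝ} (hρ : 0 < ρ)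
    (hfin : scaleMass j ρ < ∞) {u : RN N → ℝ} (hu : Measurable u) (hub : ∀ x, |u x| ≤ 1)
    (p : RN N × RN N) : sharedDrift j ρ c u p + sharedDrift j ρ c (-u) p.swap =
      (u p.1 - u p.2) * (c * ∫ w, (sharedKernel j ρ p.1 p.2 w : ℝ)) := by
  have h1 := integrable_sharedDrift_integrand hj (c := c) hρ hfin hu hub (u p.1) (hub _) p.1 p.2
  have h2 := integrable_sharedDrift_integrand hj (c := c) hρ hfin (u := -u) hu.neg
    (fun x => by simpa using hub x) (-u p.2) (by simpa using hub _) p.2 p.1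
  rw [sharedDrift, sharedDrift]
  simp only [Prod.fst_swap, Prod.snd_swap, Pi.neg_apply] at h2 ⊢
  rw [← integral_add h1 h2, ← integral_const_mul, ← integral_const_mul]
  refine integral_congr_ae (Eventually.of_forall fun w => ?_)
  simp only
  rw [sharedKernel_comm j ρ p.2 p.1]
  ring

theorem IsBoundedWeakSol.neg {B : Set (RN N)} {G : ℝ} {u g : RN N → ℝ}
    (hs : IsBoundedWeakSol K j B G u g) : IsBoundedWeakSol K j B G (-u) (-g) where
  measurable := hs.measurable.neg
  abs_le x := by simpa using hs.abs_le x
  seminorm_lt_top := by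
    have e : seminormVSq j B (-u) = seminormVSq j B u := by
      unfold seminormVSq
      refine lintegral_congr fun p => ?_
      simp only [Pi.neg_apply]
      congr 2
      ring
    rw [e]; exact hs.seminorm_lt_top
  measurable_rhs := hs.measurable_rhs.neg
  abs_rhs_le x := by simpa using hs.abs_rhs_le x
  eq φ h1 h2 h3 := by
    have h := hs.eq φ h1 h2 h3
    have e1 : bilinForm K (-u) φ = -bilinForm K u φ := by
      have a1 : ∫ p : RN N × RN N, ((-u) p.1 - (-u) p.2) * (φ p.1 - φ p.2) * symPart K p.1 p.2 =
          -∫ p : RN N × RN N, (u p.1 - u p.2) * (φ p.1 - φ p.2) * symPart K p.1 p.2 := by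
        rw [← integral_neg]
        refine integral_congr_ae (Eventually.of_forall fun p => ?_)
        simp only [Pi.neg_apply]
        ring
      have a2 : ∫ p : RN N × RN N, ((-u) p.1 - (-u) p.2) * φ p.1 * antiPart K p.1 p.2 =
          -∫ p : RN N × RN N, (u p.1 - u p.2) * φ p.1 * antiPart K p.1 p.2 := by
        rw [← integral_neg]
        refine integral_congr_ae (Eventually.of_forall fun p => ?_)
        simp only [Pi.neg_apply]
        ring
      rw [bilinForm, a1, a2, bilinForm]
      ring
    rw [e1, h, ← integral_neg]
    refine integral_congr_ae (Eventually.of_forall fun x => ?_)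
    simp only [Pi.neg_apply]
    ring

theorem integral_sub_mul_sub_mul_le {α : Type*} [MeasurableSpace α] {μ : Measure α}
    {a b c d : α → ℝ} (ha : Integrable a μ) (hb : Integrable b μ) (hc : Integrable c μ)
    (hd : Integrable d μ) {s t : ℝ} (h : ∀ y, a y - s * b y - t * c y ≤ d y) :
    ∫ y, a y ∂μ - s * ∫ y, b y ∂μ - t * ∫ y, c y ∂μ ≤ ∫ y, d y ∂μ := by
  have e : ∫ y, ((a - fun y => s * b y) - fun y => t * c y) y ∂μ =
      ∫ y, a y ∂μ - s * ∫ y, b y ∂μ - t * ∫ y, c y ∂μ := by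
    rw [integral_sub' (ha.sub (hb.const_mul s)) (hc.const_mul t),
      integral_sub' ha (hb.const_mul s), integral_const_mul, integral_const_mul]
  rw [← e]
  exact integral_mono ((ha.sub (hb.const_mul s)).sub (hc.const_mul t)) hd h

theorem measurable_truncDiff {u : RN N → ℝ} (hu : Measurable u) {Φ : RN N × RN N → ℝ}
    (hΦ : Measurable Φ) : Measurable (truncDiff u Φ) := by
  unfold truncDiff
  fun_prop

theorem truncDiff_nonneg (u : RN N → ℝ) (Φ : RN N × RN N → ℝ) (p : RN N × RN N) :
    0 ≤ truncDiff u Φ p := le_max_right _ _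

theorem truncDiff_le_two {u : RN N → ℝ} (hub : ∀ x, |u x| ≤ 1) {Φ : RN N × RN N → ℝ}
    (hΦ0 : ∀ p, 0 ≤ Φ p) (p : RN N × RN N) : truncDiff u Φ p ≤ 2 := by
  refine max_le ?_ (by norm_num)
  have h1 := (abs_le.1 (hub p.1)).2
  have h2 := (abs_le.1 (hub p.2)).1
  linarith [hΦ0 p]

/-- Off `S ×ˢ S` the barrier exceeds the largest possible difference `2`, so the truncation is
bounded with compact support. -/
theorem integrable_truncDiff {S : Set (RN N)} (hS : IsCompact S) {u : RN N → ℝ}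
    (hu : Measurable u) (hub : ∀ x, |u x| ≤ 1) {Φ : RN N × RN N → ℝ} (hΦ : Measurable Φ)
    (hΦ0 : ∀ p, 0 ≤ Φ p) (hΦS : ∀ p : RN N × RN N, p.1 ∉ S ∨ p.2 ∉ S → 2 ≤ Φ p) :
    Integrable (truncDiff u Φ) := by
  have hSS : IsCompact (S ×ˢ S) := hS.prod hS
  refine Integrable.mono' (g := (S ×ˢ S).indicator fun _ => 2)
    ((integrable_indicator_iff hSS.measurableSet).2 (integrableOn_const hSS.measure_lt_top.ne))
    (measurable_truncDiff hu hΦ).aestronglyMeasurable (Eventually.of_forall fun p => ?_)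
  rw [Real.norm_eq_abs, abs_of_nonneg (truncDiff_nonneg u Φ p)]
  by_cases hp : p ∈ S ×ˢ S
  · rw [indicator_of_mem hp]
    exact truncDiff_le_two hub hΦ0 p
  · rw [indicator_of_notMem hp]
    have h := hΦS p (by rw [mem_prod, not_and_or] at hp; exact hp)
    refine max_le ?_ le_rfl
    have h1 := (abs_le.1 (hub p.1)).2
    have h2 := (abs_le.1 (hub p.2)).1
    linarith

/-- The truncation estimate in the first of the two doubled variables. -/
theorem IsBoundedWeakSol.doubling_estimate {B : Set (RN N)} {G : ℝ} {u g : RN N → ℝ}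
    (hs : IsBoundedWeakSol K j B G u g) (hK : KernelBounds K j Λ)
    (hKm : Measurable (Function.uncurry K)) (hj : Measurable j)
    (hjs : ∀ ρ > 0, scaleMass j ρ < ∞) {k : RN N → RN N → ℝ≥0∞} {C : ℝ≥0}
    (hk : IsControlKernel K j k C) (hB : IsOpen B) {S : Set (RN N)} (hS : IsCompact S)
    (hSB : S ⊆ B) {Φ : RN N × RN N → ℝ} (hΦ : Measurable Φ) (hΦ0 : ∀ p, 0 ≤ Φ p) {L : ℝ}
    (hΦL : ∀ x x' y, |Φ (x, y) - Φ (x', y)| ≤ L * min 1 ‖x - x'‖) {P : ℝ≥0}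
    (hΦP : ∀ x y, ∫⁻ w, ENNReal.ofReal |Φ (x, y) - Φ (w, y)| * (j (w - x) : ℝ≥0∞) ≤ P)
    (hΦS : ∀ p : RN N × RN N, p.1 ∉ S ∨ p.2 ∉ S → 2 ≤ Φ p) {ρ : ℝ} (hρ : 0 < ρ) :
    (∫ p, truncDiff u Φ p * sharedDrift j ρ (Λ : ℝ)⁻¹ u p) - Λ * P * (∫ p, truncDiff u Φ p)
      - (2 * C + 4 * ((Λ : ℝ)⁻¹ * (scaleMass j ρ).toReal)) * (∫ p, truncDiff u Φ p ^ 2) ≤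
      ∫ p, g p.1 * truncDiff u Φ p := by
  have hu := hs.measurable
  have hub := hs.abs_le
  have hfin := hjs ρ hρ
  have hUm := measurable_truncDiff hu hΦ
  have iU := integrable_truncDiff hS hu hub hΦ hΦ0 hΦS
  have hUb : ∀ p, ‖truncDiff u Φ p‖ ≤ 2 := fun p => by
    rw [Real.norm_eq_abs, abs_of_nonneg (truncDiff_nonneg u Φ p)]
    exact truncDiff_le_two hub hΦ0 p
  have iU2 : Integrable fun p => truncDiff u Φ p ^ 2 := by
    simp_rw [pow_two]
    exact iU.mul_bdd (c := 2) hUm.aestronglyMeasurable (Eventually.of_forall hUb)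
  have iUF : Integrable fun p => truncDiff u Φ p * sharedDrift j ρ (Λ : ℝ)⁻¹ u p :=
    iU.mul_bdd (measurable_sharedDrift hj ρ _ hu).aestronglyMeasurable
      (Eventually.of_forall fun p => abs_sharedDrift_le hj hρ (by positivity) hfin hub p)
  have iUg : Integrable fun p : RN N × RN N => g p.1 * truncDiff u Φ p :=
    iU.bdd_mul (c := G) (hs.measurable_rhs.comp measurable_fst).aestronglyMeasurable
      (Eventually.of_forall fun p => hs.abs_rhs_le p.1)
  set μ : ℝ≥0 := Λ⁻¹ * (scaleMass j ρ).toNNReal with hμ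
  have hμ' : (μ : ℝ≥0∞) = (Λ⁻¹ : ℝ≥0) * scaleMass j ρ := by
    rw [hμ, ENNReal.coe_mul, ENNReal.coe_toNNReal hfin.ne]
  have hof : ∀ t : ℝ≥0, ENNReal.ofReal ((Λ : ℝ)⁻¹ * t) = (Λ⁻¹ : ℝ≥0) * (t : ℝ≥0∞) := by
    intro t
    rw [← NNReal.coe_inv, ← NNReal.coe_mul, ENNReal.ofReal_coe_nnreal, ENNReal.coe_mul]
  have hslice : ∀ y, (∫ x, truncDiff u Φ (x, y) * sharedDrift j ρ (Λ : ℝ)⁻¹ u (x, y))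
      - Λ * P * (∫ x, truncDiff u Φ (x, y))
      - (2 * C + 4 * ((Λ : ℝ)⁻¹ * (scaleMass j ρ).toReal)) * (∫ x, truncDiff u Φ (x, y) ^ 2) ≤
      ∫ x, g x * truncDiff u Φ (x, y) := by
    intro y
    have hψ : Measurable fun x => u y + Φ (x, y) :=
      measurable_const.add (hΦ.comp measurable_prodMk_right)
    have e : ∀ x, u x - (u y + Φ (x, y)) = u x - u y - Φ (x, y) := fun x => by ring
    have h := hs.truncation_estimate hK hKm hj hjs hk hB hS hSB hψ (L := L)
      (fun x x' => by rw [add_sub_add_left_eq_sub]; exact hΦL x x' y) (P := P)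
      (fun x => by simp_rw [add_sub_add_left_eq_sub]; exact hΦP x y)
      (fun x hx => by
        have h2 := hΦS (x, y) (Or.inl hx)
        have h3 := (_root_.abs_le.1 (hub x)).2
        have h4 := (_root_.abs_le.1 (hub y)).1
        linarith) (b := 2) (by norm_num)
      (fun x => by
        have h2 := hΦ0 (x, y)
        have h3 := (_root_.abs_le.1 (hub x)).2
        have h4 := (_root_.abs_le.1 (hub y)).1
        linarith)
      -- The kernel singled out depends on the frozen point `y`; the factor `Λ⁻¹` places it below
      -- `K`.
      (m := fun p => (Λ : ℝ)⁻¹ * sharedKernel j ρ p.1 y p.2)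
      ((measurable_sharedKernel_left hj ρ y).coe_nnreal_real.const_mul _)
      (fun p => by positivity)
      (fun p hp => by
        refine le_trans ?_ (hK.le_toReal hp)
        gcongr
        exact (sharedKernel_le_left j ρ _ _ _).trans (cutKernel_le j ρ _)) (μ := μ)
      (fun x => by
        simp only [hof]
        rw [lintegral_const_mul' _ _ ENNReal.coe_ne_top, hμ']
        exact mul_le_mul' le_rfl (lintegral_sharedKernel_le hρ x y))
      (fun w => by
        simp only [hof]
        rw [lintegral_const_mul' _ _ ENNReal.coe_ne_top, hμ']
        refine mul_le_mul' le_rfl (le_trans ?_ (tailMass_le_scaleMass hρ))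
        rw [← lintegral_cutKernel_sub_left j ρ w]
        exact lintegral_mono fun x => ENNReal.coe_le_coe.2 (sharedKernel_le_left j ρ x y w))
    simp only [e] at h
    have hμr : (μ : ℝ) = (Λ : ℝ)⁻¹ * (scaleMass j ρ).toReal := by
      rw [hμ]; rfl
    rw [hμr] at h
    exact h
  -- The constants in the slice estimate do not depend on `y`, so it can be integrated.
  have hres := integral_sub_mul_sub_mul_le iUF.integral_prod_right iU.integral_prod_right
    iU2.integral_prod_right iUg.integral_prod_right hslice
  rw [← integral_prod_symm _ iUF, ← integral_prod_symm _ iU, ← integral_prod_symm _ iU2,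
    ← integral_prod_symm _ iUg] at hres
  exact hres

end Doubling

/-! ### The barrier and the decrease of oscillation. -/

section OneScale

variable {N : ℕ} {K : RN N → RN N → ℝ≥0∞} {j : RN N → ℝ≥0} {Λ : ℝ≥0}

theorem truncDiff_neg (u : RN N → ℝ) {Φ : RN N × RN N → ℝ} (hΦ : ∀ p, Φ p.swap = Φ p)
    (p : RN N × RN N) : truncDiff (-u) Φ p = truncDiff u Φ p.swap := by
  simp only [truncDiff, Pi.neg_apply, Prod.fst_swap, Prod.snd_swap, hΦ]
  congr 1
  ring

/-- The sum of the truncation estimates in both of the doubled variables. -/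
theorem IsBoundedWeakSol.symmetric_doubling_estimate {B : Set (RN N)} {G : ℝ} {u g : RN N → ℝ}
    (hs : IsBoundedWeakSol K j B G u g) (hK : KernelBounds K j Λ)
    (hKm : Measurable (Function.uncurry K)) (hj : Measurable j)
    (hjs : ∀ ρ > 0, scaleMass j ρ < ∞) {k : RN N → RN N → ℝ≥0∞} {C : ℝ≥0}
    (hk : IsControlKernel K j k C) (hB : IsOpen B) {S : Set (RN N)} (hS : IsCompact S)
    (hSB : S ⊆ B) {Φ : RN N × RN N → ℝ} (hΦ : Measurable Φ) (hΦ0 : ∀ p, 0 ≤ Φ p)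
    (hΦs : ∀ p, Φ p.swap = Φ p) {L : ℝ}
    (hΦL : ∀ x x' y, |Φ (x, y) - Φ (x', y)| ≤ L * min 1 ‖x - x'‖) {P : ℝ≥0}
    (hΦP : ∀ x y, ∫⁻ w, ENNReal.ofReal |Φ (x, y) - Φ (w, y)| * (j (w - x) : ℝ≥0∞) ≤ P)
    (hΦS : ∀ p : RN N × RN N, p.1 ∉ S ∨ p.2 ∉ S → 2 ≤ Φ p) {ρ : ℝ} (hρ : 0 < ρ) :
    (∫ p, truncDiff u Φ p * ((u p.1 - u p.2) *
        ((Λ : ℝ)⁻¹ * ∫ w, (sharedKernel j ρ p.1 p.2 w : ℝ)))) ≤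
      (2 * G + 2 * (Λ * P)) * (∫ p, truncDiff u Φ p) +
      2 * (2 * C + 4 * ((Λ : ℝ)⁻¹ * (scaleMass j ρ).toReal)) * (∫ p, truncDiff u Φ p ^ 2) := by
  have hu := hs.measurable
  have hub := hs.abs_le
  have hfin := hjs ρ hρ
  have hUm := measurable_truncDiff hu hΦ
  have iU := integrable_truncDiff hS hu hub hΦ hΦ0 hΦS
  have iUF : Integrable fun p => truncDiff u Φ p * sharedDrift j ρ (Λ : ℝ)⁻¹ u p :=
    iU.mul_bdd (measurable_sharedDrift hj ρ _ hu).aestronglyMeasurable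
      (Eventually.of_forall fun p => abs_sharedDrift_le hj hρ (by positivity) hfin hub p)
  have iUF' : Integrable fun p => truncDiff u Φ p * sharedDrift j ρ (Λ : ℝ)⁻¹ (-u) p.swap :=
    iU.mul_bdd ((measurable_sharedDrift hj ρ _ hu.neg).comp measurable_swap).aestronglyMeasurable
      (Eventually.of_forall fun p => abs_sharedDrift_le hj hρ (by positivity) hfin
        (fun x => by simpa using hub x) p.swap)
  have iUg : Integrable fun p : RN N × RN N => g p.1 * truncDiff u Φ p :=
    iU.bdd_mul (c := G) (hs.measurable_rhs.comp measurable_fst).aestronglyMeasurable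
      (Eventually.of_forall fun p => hs.abs_rhs_le p.1)
  have iUg' : Integrable fun p : RN N × RN N => (-g) p.2 * truncDiff u Φ p :=
    iU.bdd_mul (c := G) (hs.measurable_rhs.neg.comp measurable_snd).aestronglyMeasurable
      (Eventually.of_forall fun p => by simpa using hs.abs_rhs_le p.2)
  have h1 := hs.doubling_estimate hK hKm hj hjs hk hB hS hSB hΦ hΦ0 hΦL hΦP hΦS hρ
  -- The equation in the second variable is that of `-u` with the variables exchanged; symmetry of
  -- `Φ` makes the two truncations agree after the exchange.
  have h2 := hs.neg.doubling_estimate hK hKm hj hjs hk hB hS hSB hΦ hΦ0 hΦL hΦP hΦS hρ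
  simp only [truncDiff_neg u hΦs] at h2
  have s1 : ∫ p : RN N × RN N, truncDiff u Φ p.swap * sharedDrift j ρ (Λ : ℝ)⁻¹ (-u) p =
      ∫ p : RN N × RN N, truncDiff u Φ p * sharedDrift j ρ (Λ : ℝ)⁻¹ (-u) p.swap :=
    integral_swap fun p : RN N × RN N =>
      truncDiff u Φ p * sharedDrift j ρ (Λ : ℝ)⁻¹ (-u) p.swap
  have s2 : ∫ p : RN N × RN N, truncDiff u Φ p.swap = ∫ p : RN N × RN N, truncDiff u Φ p :=
    integral_swap fun p : RN N × RN N => truncDiff u Φ p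
  have s3 : ∫ p : RN N × RN N, truncDiff u Φ p.swap ^ 2 =
      ∫ p : RN N × RN N, truncDiff u Φ p ^ 2 :=
    integral_swap fun p : RN N × RN N => truncDiff u Φ p ^ 2
  have s4 : ∫ p : RN N × RN N, (-g) p.1 * truncDiff u Φ p.swap =
      ∫ p : RN N × RN N, (-g) p.2 * truncDiff u Φ p :=
    integral_swap fun p : RN N × RN N => (-g) p.2 * truncDiff u Φ p
  rw [s1, s2, s3, s4] at h2
  have e1 : ∫ p, truncDiff u Φ p * ((u p.1 - u p.2) *
        ((Λ : ℝ)⁻¹ * ∫ w, (sharedKernel j ρ p.1 p.2 w : ℝ))) =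
      (∫ p, truncDiff u Φ p * sharedDrift j ρ (Λ : ℝ)⁻¹ u p) +
        ∫ p, truncDiff u Φ p * sharedDrift j ρ (Λ : ℝ)⁻¹ (-u) p.swap := by
    rw [← integral_add iUF iUF']
    refine integral_congr_ae (Eventually.of_forall fun p => ?_)
    simp only
    rw [← mul_add, sharedDrift_add_swap hj hρ hfin hu hub]
  have e2 : (∫ p, g p.1 * truncDiff u Φ p) + (∫ p, (-g) p.2 * truncDiff u Φ p) ≤
      2 * G * ∫ p, truncDiff u Φ p := by
    rw [← integral_add iUg iUg', ← integral_const_mul]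
    refine integral_mono (iUg.add iUg') (iU.const_mul _) fun p => ?_
    simp only [Pi.neg_apply]
    rw [← add_mul]
    refine mul_le_mul_of_nonneg_right ?_ (truncDiff_nonneg u Φ p)
    linarith [(_root_.abs_le.1 (hs.abs_rhs_le p.1)).2, (_root_.abs_le.1 (hs.abs_rhs_le p.2)).1]
  rw [e1]
  linarith

/-- Where the truncation is positive it is at most `a`, so its square is at most `a` times itself.
All costs thus become multiples of one integral, the gain is a strictly larger multiple of it, and
the integral must vanish. -/
theorem IsBoundedWeakSol.truncDiff_ae_eq_zero {B : Set (RN N)} {G : ℝ} {u g : RN N → ℝ}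
    (hs : IsBoundedWeakSol K j B G u g) (hK : KernelBounds K j Λ)
    (hKm : Measurable (Function.uncurry K)) (hj : Measurable j)
    (hjs : ∀ ρ > 0, scaleMass j ρ < ∞) {k : RN N → RN N → ℝ≥0∞} {C : ℝ≥0}
    (hk : IsControlKernel K j k C) (hB : IsOpen B) {S : Set (RN N)} (hS : IsCompact S)
    (hSB : S ⊆ B) {Φ : RN N × RN N → ℝ} (hΦ : Measurable Φ) (hΦ0 : ∀ p, 0 ≤ Φ p)
    (hΦs : ∀ p, Φ p.swap = Φ p) {L : ℝ}
    (hΦL : ∀ x x' y, |Φ (x, y) - Φ (x', y)| ≤ L * min 1 ‖x - x'‖) {P : ℝ≥0}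
    (hΦP : ∀ x y, ∫⁻ w, ENNReal.ofReal |Φ (x, y) - Φ (w, y)| * (j (w - x) : ℝ≥0∞) ≤ P)
    (hΦS : ∀ p : RN N × RN N, p.1 ∉ S ∨ p.2 ∉ S → 2 ≤ Φ p) {ρ : ℝ} (hρ : 0 < ρ)
    {a e m : ℝ} (he : 0 ≤ e) (hm : 0 ≤ m)
    (hpos : ∀ᵐ p : RN N × RN N, 0 < truncDiff u Φ p → truncDiff u Φ p ≤ a ∧
      e ≤ u p.1 - u p.2 ∧ m ≤ ∫ w, (sharedKernel j ρ p.1 p.2 w : ℝ))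
    (hlarge : 2 * G + 2 * (Λ * P) + 2 * (2 * C + 4 * ((Λ : ℝ)⁻¹ * (scaleMass j ρ).toReal)) * a <
      e * ((Λ : ℝ)⁻¹ * m)) :
    ∀ᵐ p : RN N × RN N, u p.1 - u p.2 ≤ Φ p := by
  have hu := hs.measurable
  have hub := hs.abs_le
  have hfin := hjs ρ hρ
  have hUm := measurable_truncDiff hu hΦ
  have iU := integrable_truncDiff hS hu hub hΦ hΦ0 hΦS
  have iU2 : Integrable fun p => truncDiff u Φ p ^ 2 := by
    simp_rw [pow_two]
    refine iU.mul_bdd (c := 2) hUm.aestronglyMeasurable (Eventually.of_forall fun p => ?_)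
    rw [Real.norm_eq_abs, abs_of_nonneg (truncDiff_nonneg u Φ p)]
    exact truncDiff_le_two hub hΦ0 p
  have hmain := hs.symmetric_doubling_estimate hK hKm hj hjs hk hB hS hSB hΦ hΦ0 hΦs hΦL hΦP hΦS hρ
  have hsq : ∫ p, truncDiff u Φ p ^ 2 ≤ a * ∫ p, truncDiff u Φ p := by
    rw [← integral_const_mul]
    refine integral_mono_ae iU2 (iU.const_mul a) ?_
    filter_upwards [hpos] with p hp
    rcases (truncDiff_nonneg u Φ p).eq_or_lt with h | h
    · rw [← h]; simp
    · rw [pow_two]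
      exact mul_le_mul_of_nonneg_right (hp h).1 h.le
  have hgain : e * ((Λ : ℝ)⁻¹ * m) * (∫ p, truncDiff u Φ p) ≤ ∫ p, truncDiff u Φ p *
      ((u p.1 - u p.2) * ((Λ : ℝ)⁻¹ * ∫ w, (sharedKernel j ρ p.1 p.2 w : ℝ))) := by
    rw [← integral_const_mul]
    have iL : Integrable fun p => truncDiff u Φ p *
      ((u p.1 - u p.2) * ((Λ : ℝ)⁻¹ * ∫ w, (sharedKernel j ρ p.1 p.2 w : ℝ))) := by
      simp_rw [← sharedDrift_add_swap hj hρ hfin hu hub]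
      refine iU.mul_bdd (c := 2 * ((Λ : ℝ)⁻¹ * (scaleMass j ρ).toReal) +
        2 * ((Λ : ℝ)⁻¹ * (scaleMass j ρ).toReal))
        ((measurable_sharedDrift hj ρ _ hu).add
          ((measurable_sharedDrift hj ρ _ hu.neg).comp measurable_swap)).aestronglyMeasurable
        (Eventually.of_forall fun p => (norm_add_le _ _).trans (add_le_add ?_ ?_))
      · exact abs_sharedDrift_le hj hρ (by positivity) hfin hub p
      · exact abs_sharedDrift_le hj hρ (by positivity) hfin (fun x => by simpa using hub x) p.swap
    refine integral_mono_ae (iU.const_mul _) iL ?_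
    filter_upwards [hpos] with p hp
    rcases (truncDiff_nonneg u Φ p).eq_or_lt with h | h
    · rw [← h]; simp
    · obtain ⟨-, h2, h3⟩ := hp h
      rw [mul_comm]
      refine mul_le_mul_of_nonneg_left ?_ h.le
      exact mul_le_mul h2 (mul_le_mul_of_nonneg_left h3 (by positivity)) (by positivity)
        (he.trans h2)
  have hI0 : 0 ≤ ∫ p, truncDiff u Φ p := integral_nonneg (truncDiff_nonneg u Φ)
  have hI : ∫ p, truncDiff u Φ p = 0 := by
    have hc : 0 ≤ 2 * (2 * C + 4 * ((Λ : ℝ)⁻¹ * (scaleMass j ρ).toReal)) := by positivity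
    have := mul_le_mul_of_nonneg_left hsq hc
    nlinarith
  have h0 := (integral_eq_zero_iff_of_nonneg (truncDiff_nonneg u Φ) iU).1 hI
  filter_upwards [h0] with p hp
  have := le_max_left (u p.1 - u p.2 - Φ p) 0
  rw [← truncDiff, hp, Pi.zero_apply] at this
  linarith

/-- The barrier for `u(x) - u(y)`: it is large off the compact set where `ψ < 1`, and grows
with `‖x - y‖` at the scales `r` and `s`. -/
def doublingBarrier (ψ : RN N → ℝ) (b a r s : ℝ) (p : RN N × RN N) : ℝ :=
  b + 2 * ψ p.1 + 2 * ψ p.2 + a * min 1 (‖p.1 - p.2‖ / r) + 2 * min 1 (‖p.1 - p.2‖ / s)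

theorem doublingBarrier_swap (ψ : RN N → ℝ) (b a r s : ℝ) (p : RN N × RN N) :
    doublingBarrier ψ b a r s p.swap = doublingBarrier ψ b a r s p := by
  simp only [doublingBarrier, Prod.fst_swap, Prod.snd_swap, norm_sub_rev p.2 p.1]
  ring

theorem measurable_doublingBarrier {ψ : RN N → ℝ} (hψ : Measurable ψ) (b a r s : ℝ) :
    Measurable (doublingBarrier ψ b a r s) := by
  unfold doublingBarrier
  fun_prop

theorem abs_min_one_div_sub_le {r : ℝ} (hr : 0 < r) (x w y : RN N) :
    |min 1 (‖x - y‖ / r) - min 1 (‖w - y‖ / r)| ≤ min 1 (‖x - w‖ / r) := by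
  have h1 : 0 ≤ min 1 (‖x - y‖ / r) := le_min zero_le_one (by positivity)
  have h2 : 0 ≤ min 1 (‖w - y‖ / r) := le_min zero_le_one (by positivity)
  have h3 : min 1 (‖x - y‖ / r) ≤ 1 := min_le_left _ _
  have h4 : min 1 (‖w - y‖ / r) ≤ 1 := min_le_left _ _
  refine le_min (abs_le.2 ⟨by linarith, by linarith⟩) ?_
  refine (abs_min_sub_min_le_max _ _ _ _).trans (max_le (by simp; positivity) ?_)
  rw [← sub_div, abs_div, abs_of_pos hr]
  gcongr
  refine (abs_norm_sub_norm_le _ _).trans (le_of_eq ?_)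
  rw [sub_sub_sub_cancel_right]

theorem abs_doublingBarrier_sub_le {ψ : RN N → ℝ} {L : ℝ}
    (hψL : ∀ x y, |ψ x - ψ y| ≤ L * min 1 ‖x - y‖) {b a r s : ℝ} (ha : 0 ≤ a) (hr : 0 < r)
    (hs : 0 < s) (x w y : RN N) :
    |doublingBarrier ψ b a r s (x, y) - doublingBarrier ψ b a r s (w, y)| ≤
      2 * L * min 1 (‖x - w‖ / 1) + a * min 1 (‖x - w‖ / r) + 2 * min 1 (‖x - w‖ / s) := by
  have e : doublingBarrier ψ b a r s (x, y) - doublingBarrier ψ b a r s (w, y) =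
      2 * (ψ x - ψ w) + a * (min 1 (‖x - y‖ / r) - min 1 (‖w - y‖ / r)) +
        2 * (min 1 (‖x - y‖ / s) - min 1 (‖w - y‖ / s)) := by
    simp only [doublingBarrier]
    ring
  rw [e]
  refine (abs_add_three _ _ _).trans ?_
  rw [abs_mul, abs_mul, abs_mul, abs_of_nonneg ha, abs_two, div_one, mul_assoc]
  gcongr
  · exact hψL x w
  · exact abs_min_one_div_sub_le hr x w y
  · exact abs_min_one_div_sub_le hs x w y

theorem min_one_div_le {t : ℝ} (ht : 0 ≤ t) (r : ℝ) :
    min 1 (t / r) ≤ max 1 r⁻¹ * min 1 t := by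
  rcases le_total 1 t with h | h
  · rw [min_eq_left h, mul_one]
    exact (min_le_left _ _).trans (le_max_left _ _)
  · rw [min_eq_right h, div_eq_inv_mul]
    exact (min_le_right _ _).trans (mul_le_mul_of_nonneg_right (le_max_right _ _) ht)

theorem lintegral_doublingBarrier_le (hj : Measurable j) {ψ : RN N → ℝ} {L : ℝ} (hL : 0 ≤ L)
    (hψL : ∀ x y, |ψ x - ψ y| ≤ L * min 1 ‖x - y‖) {b a r s : ℝ} (ha : 0 ≤ a) (hr : 0 < r)
    (hs : 0 < s) (x y : RN N) :
    ∫⁻ w, ENNReal.ofReal |doublingBarrier ψ b a r s (x, y) - doublingBarrier ψ b a r s (w, y)| *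
        (j (w - x) : ℝ≥0∞) ≤
      ENNReal.ofReal (2 * L) * scaleMass j 1 + ENNReal.ofReal a * scaleMass j r +
        ENNReal.ofReal 2 * scaleMass j s := by
  have hsm : ∀ t, ∫⁻ w, ENNReal.ofReal (min 1 (‖x - w‖ / t)) * (j (w - x) : ℝ≥0∞) =
      scaleMass j t := fun t => by
    rw [scaleMass, ← lintegral_sub_right_eq_self
      (fun z => ENNReal.ofReal (min 1 (‖z‖ / t)) * (j z : ℝ≥0∞)) x]
    exact lintegral_congr fun w => by rw [norm_sub_rev]
  have hjx : Measurable fun w => (j (w - x) : ℝ≥0∞) :=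
    (hj.comp (measurable_id.sub measurable_const)).coe_nnreal_ennreal
  have hmt : ∀ t, Measurable fun w => ENNReal.ofReal (min 1 (‖x - w‖ / t)) *
      (j (w - x) : ℝ≥0∞) := fun t => by
    refine Measurable.mul ?_ hjx
    fun_prop
  rw [← hsm 1, ← hsm r, ← hsm s, ← lintegral_const_mul _ (hmt 1), ← lintegral_const_mul _ (hmt r),
    ← lintegral_const_mul _ (hmt s), ← lintegral_add_left ((hmt 1).const_mul _),
    ← lintegral_add_right _ ((hmt s).const_mul _)]
  refine lintegral_mono fun w => ?_
  have h0 : ∀ t : ℝ, 0 < t → 0 ≤ min 1 (‖x - w‖ / t) := fun t ht =>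
    le_min zero_le_one (by positivity)
  simp only [← mul_assoc]
  rw [← add_mul, ← add_mul, ← ENNReal.ofReal_mul (by positivity), ← ENNReal.ofReal_mul ha,
    ← ENNReal.ofReal_mul (by norm_num),
    ← ENNReal.ofReal_add (mul_nonneg (by positivity) (h0 1 one_pos)) (mul_nonneg ha (h0 r hr)),
    ← ENNReal.ofReal_add (add_nonneg (mul_nonneg (by positivity) (h0 1 one_pos))
      (mul_nonneg ha (h0 r hr))) (mul_nonneg (by norm_num) (h0 s hs))]
  exact mul_le_mul' (ENNReal.ofReal_le_ofReal
    (abs_doublingBarrier_sub_le hψL ha hr hs x w y)) le_rfl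

/-- All solutions of the class satisfy `u(x) - u(y) ≤ M + 2ψ(x) + 2ψ(y)` at distance `≤ r`. -/
def OscBound (K : RN N → RN N → ℝ≥0∞) (j : RN N → ℝ≥0) (B : Set (RN N)) (G : ℝ) (ψ : RN N → ℝ)
    (M r : ℝ) : Prop :=
  ∀ u g, IsBoundedWeakSol K j B G u g →
    ∀ᵐ p : RN N × RN N, ‖p.1 - p.2‖ ≤ r → u p.1 - u p.2 ≤ M + 2 * ψ p.1 + 2 * ψ p.2

theorem OscBound.mono {B : Set (RN N)} {G : ℝ} {ψ : RN N → ℝ} {M M' r : ℝ}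
    (h : OscBound K j B G ψ M r) (hM : M ≤ M') : OscBound K j B G ψ M' r := by
  intro u g hs
  filter_upwards [h u g hs] with p hp hpr
  linarith [hp hpr]

/-- Starting point of the iteration. -/
theorem oscBound_two {B : Set (RN N)} {G : ℝ} {ψ : RN N → ℝ} (hψ0 : ∀ x, 0 ≤ ψ x) (r : ℝ) :
    OscBound K j B G ψ 2 r := by
  intro u g hs
  refine Eventually.of_forall fun p _ => ?_
  linarith [(abs_le.1 (hs.abs_le p.1)).2, (abs_le.1 (hs.abs_le p.2)).1, hψ0 p.1, hψ0 p.2]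

/-- The order of quantifiers is essential: the decrement is fixed before `M` and `r`, so finitely
many applications suffice. The barrier has two scales. Its term at scale `r` confines positivity to
the region where the old bound holds. There the old bound exceeds the base level `M - a` of the
barrier by `a` only, so the term at scale `θρ` confines positivity further, to distances at which
jumps coalesce. -/
theorem OscBound.improve {B : Set (RN N)} {G : ℝ} (hG : 0 ≤ G) (hK : KernelBounds K j Λ)
    (hΛ : 0 < Λ) (hKm : Measurable (Function.uncurry K)) (hj : Measurable j)
    (hjs : ∀ ρ > 0, scaleMass j ρ < ∞) {k : RN N → RN N → ℝ≥0∞} {C : ℝ≥0}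
    (hk : IsControlKernel K j k C) (hB : IsOpen B) {S : Set (RN N)} (hS : IsCompact S)
    (hSB : S ⊆ B) {ψ : RN N → ℝ} (hψ : Measurable ψ) (hψ0 : ∀ x, 0 ≤ ψ x)
    (hψ1 : ∀ x ∉ S, 1 ≤ ψ x) {L : ℝ} (hL : 0 ≤ L)
    (hψL : ∀ x y, |ψ x - ψ y| ≤ L * min 1 ‖x - y‖) {θ κ : ℝ} (hθ : 0 < θ) (hθ1 : θ ≤ 1)
    (hκ : 0 < κ)
    (hscale : ∀ ρ₀ > 0, ∀ L : ℝ≥0, ∃ ρ, 0 < ρ ∧ ρ < ρ₀ ∧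
      (L : ℝ≥0∞) ≤ scaleMass j ρ ∧ ∀ x : RN N, ‖x‖ ≤ θ * ρ →
        ENNReal.ofReal κ * scaleMass j ρ ≤
          ∫⁻ z, ((min (cutKernel j ρ z) (cutKernel j ρ (z + x)) : ℝ≥0) : ℝ≥0∞))
    {ε : ℝ} (hε : 0 < ε) : ∃ a > 0, ∀ M ≥ ε, ∀ r > 0, OscBound K j B G ψ M r →
      ∃ r' > 0, OscBound K j B G ψ (M - a / 2) r' := by
  have hΛ' : (0 : ℝ) < Λ := by exact_mod_cast hΛ
  -- `a Q S(ρ)` collects the costs proportional to `S(ρ)`: the barrier term at scale `θρ`, and the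
  -- removal of the shared kernel from the energy. The gain will be `2q S(ρ)`, so half of it covers
  -- these.
  set Q : ℝ := 2 * Λ / θ + 8 / Λ with hQ
  have hQ0 : 0 < Q := by positivity
  set q : ℝ := ε * κ / (4 * Λ) with hq
  have hq0 : 0 < q := by positivity
  refine ⟨min (ε / 2) (q / Q), by positivity, fun M hM r hr hosc => ?_⟩
  set a : ℝ := min (ε / 2) (q / Q) with ha
  have ha0 : 0 < a := by positivity
  have haε : a ≤ ε / 2 := min_le_left _ _
  have haQ : a * Q ≤ q := (le_div_iff₀ hQ0).1 (min_le_right _ _)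
  set s₁ : ℝ := (scaleMass j 1).toReal with hs₁
  set sr : ℝ := (scaleMass j r).toReal with hsr
  set D : ℝ := 4 * Λ * L * s₁ + 4 * Λ * sr + 2 * G + 4 * C * a with hD
  have hD0 : 0 ≤ D := by positivity
  -- The scale `ρ` is chosen after `r`: the costs collected in `D`, among them that of the barrier
  -- at scale `r`, are fixed by now, and the other half of the gain must exceed them.
  obtain ⟨ρ, hρ, hρr, hLρ, hshare⟩ := hscale r hr (D / q + 1).toNNReal
  set s : ℝ := (scaleMass j ρ).toReal with hs
  have hfin := hjs ρ hρ
  have hDs : D < q * s := by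
    have h1 : ENNReal.ofReal (D / q + 1) ≤ scaleMass j ρ := hLρ
    have h2 := (ENNReal.ofReal_le_iff_le_toReal hfin.ne).1 h1
    have h3 : D / q < s := by linarith
    rwa [div_lt_iff₀ hq0, mul_comm] at h3
  have hθρ : 0 < θ * ρ := by positivity
  have hθρr : θ * ρ ≤ r := by nlinarith
  have hMa : 0 ≤ M - a := by linarith
  -- Within this distance each of the two barrier terms is at most `a/4`, so the level `M - a` rises
  -- only to `M - a/2`.
  refine ⟨min (θ * ρ / 4) (a * r / 8), by positivity, fun u g hsol => ?_⟩
  set Φ := doublingBarrier ψ (M - a) a (θ * ρ) r with hΦ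
  have hmin0 : ∀ (p : RN N × RN N) (t : ℝ), 0 < t → 0 ≤ min 1 (‖p.1 - p.2‖ / t) :=
    fun p t ht => le_min zero_le_one (by positivity)
  have hΦge : ∀ p : RN N × RN N, M - a + 2 * ψ p.1 + 2 * ψ p.2 ≤ Φ p := fun p => by
    have h1 := mul_nonneg ha0.le (hmin0 p (θ * ρ) hθρ)
    have h2 := hmin0 p r hr
    rw [hΦ, doublingBarrier]
    linarith
  have hP : ∀ x y, ∫⁻ w, ENNReal.ofReal |Φ (x, y) - Φ (w, y)| * (j (w - x) : ℝ≥0∞) ≤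
      ((2 * L * s₁ + a * (s / θ) + 2 * sr).toNNReal : ℝ≥0) := fun x y => by
    refine (lintegral_doublingBarrier_le hj hL hψL ha0.le hθρ hr x y).trans ?_
    have h1 : scaleMass j (θ * ρ) ≤ ENNReal.ofReal (s / θ) := by
      refine (scaleMass_mul_le hθ hθ1 hρ).trans (le_of_eq ?_)
      rw [div_eq_inv_mul, ENNReal.ofReal_mul (by positivity), ENNReal.ofReal_toReal hfin.ne]
    change _ ≤ ENNReal.ofReal _
    rw [ENNReal.ofReal_add (by positivity) (by positivity),
      ENNReal.ofReal_add (by positivity) (by positivity), ENNReal.ofReal_mul (p := 2 * L) (by positivity),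
      ENNReal.ofReal_mul ha0.le, ENNReal.ofReal_mul (p := 2) (q := sr) (by positivity),
      ENNReal.ofReal_toReal (hjs 1 one_pos).ne, ENNReal.ofReal_toReal (hjs r hr).ne]
    gcongr
  have hpos : ∀ᵐ p : RN N × RN N, 0 < truncDiff u Φ p → truncDiff u Φ p ≤ a ∧
      ε / 2 ≤ u p.1 - u p.2 ∧ κ * s ≤ ∫ w, (sharedKernel j ρ p.1 p.2 w : ℝ) := by
    filter_upwards [hosc u g hsol] with p hp hU
    have hU' : 0 < u p.1 - u p.2 - Φ p := by
      by_contra h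
      exact hU.ne' (max_eq_right (not_lt.1 h))
    have hle : u p.1 - u p.2 ≤ 2 := by
      linarith [(abs_le.1 (hsol.abs_le p.1)).2, (abs_le.1 (hsol.abs_le p.2)).1]
    -- Otherwise the last barrier term alone equals `2`.
    have hr1 : ‖p.1 - p.2‖ ≤ r := by
      by_contra h
      have h1 : (1 : ℝ) ≤ ‖p.1 - p.2‖ / r := (one_le_div hr).2 (not_le.1 h).le
      have h2 := mul_nonneg ha0.le (hmin0 p (θ * ρ) hθρ)
      rw [hΦ, doublingBarrier, min_eq_left h1] at hU'
      linarith [hψ0 p.1, hψ0 p.2]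
    -- Otherwise the barrier is already at least the old bound.
    have hd : ‖p.1 - p.2‖ ≤ θ * ρ := by
      by_contra h
      have h1 : (1 : ℝ) ≤ ‖p.1 - p.2‖ / (θ * ρ) := (one_le_div hθρ).2 (not_le.1 h).le
      have h2 := hmin0 p r hr
      rw [hΦ, doublingBarrier, min_eq_left h1] at hU'
      linarith [hp hr1]
    refine ⟨?_, ?_, le_integral_sharedKernel hj hρ hκ.le hfin (hshare _ hd)⟩
    · exact max_le (by linarith [hp hr1, hΦge p]) ha0.le
    · linarith [hΦge p, hψ0 p.1, hψ0 p.2]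
  have hΦLip : ∀ x x' y, |Φ (x, y) - Φ (x', y)| ≤
      (2 * L + a * max 1 (θ * ρ)⁻¹ + 2 * max 1 r⁻¹) * min 1 ‖x - x'‖ := fun x x' y => by
    refine (abs_doublingBarrier_sub_le hψL ha0.le hθρ hr x x' y).trans ?_
    rw [add_mul, add_mul, div_one, mul_assoc a, mul_assoc 2 (max 1 r⁻¹)]
    gcongr
    · exact min_one_div_le (norm_nonneg _) _
    · exact min_one_div_le (norm_nonneg _) _
  have hlarge : 2 * G + 2 * (Λ * ((2 * L * s₁ + a * (s / θ) + 2 * sr).toNNReal : ℝ≥0)) +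
      2 * (2 * C + 4 * ((Λ : ℝ)⁻¹ * (scaleMass j ρ).toReal)) * a <
      ε / 2 * ((Λ : ℝ)⁻¹ * (κ * s)) := by
    rw [Real.coe_toNNReal _ (by positivity), ← hs]
    have e1 : ε / 2 * ((Λ : ℝ)⁻¹ * (κ * s)) = 2 * q * s := by
      rw [hq]; field_simp; ring
    have e2 : 2 * G + 2 * (Λ * (2 * L * s₁ + a * (s / θ) + 2 * sr)) +
        2 * (2 * C + 4 * ((Λ : ℝ)⁻¹ * s)) * a = D + a * Q * s := by
      rw [hD, hQ]; field_simp; ring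
    have h3 : a * Q * s ≤ q * s := mul_le_mul_of_nonneg_right haQ ENNReal.toReal_nonneg
    rw [e1, e2]
    linarith
  have hres := hsol.truncDiff_ae_eq_zero hK hKm hj hjs hk hB hS hSB
    (measurable_doublingBarrier hψ _ _ _ _)
    (fun p => by linarith [hΦge p, hψ0 p.1, hψ0 p.2]) (doublingBarrier_swap ψ _ _ _ _) hΦLip hP
    (fun p hp => by
      rcases hp with hp | hp
      · linarith [hΦge p, hψ0 p.2, hψ1 _ hp]
      · linarith [hΦge p, hψ0 p.1, hψ1 _ hp]) hρ (by positivity) (by positivity) hpos hlarge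
  filter_upwards [hres] with p hp hpr
  have h1 : min 1 (‖p.1 - p.2‖ / (θ * ρ)) ≤ 1 / 4 := by
    refine (min_le_right _ _).trans ((div_le_iff₀ hθρ).2 ?_)
    linarith [hpr.trans (min_le_left _ _)]
  have h2 : min 1 (‖p.1 - p.2‖ / r) ≤ a / 8 := by
    refine (min_le_right _ _).trans ((div_le_iff₀ hr).2 ?_)
    linarith [hpr.trans (min_le_right _ _)]
  have h3 : a * min 1 (‖p.1 - p.2‖ / (θ * ρ)) ≤ a * (1 / 4) := mul_le_mul_of_nonneg_left h1 ha0.le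
  rw [doublingBarrier] at hp
  linarith

/-- Equicontinuity, in the almost everywhere sense, of the bounded solutions in `B`. -/
theorem exists_ae_oscillation_le {B A : Set (RN N)} {G : ℝ} (hG : 0 ≤ G)
    (hK : KernelBounds K j Λ) (hΛ : 0 < Λ) (hKm : Measurable (Function.uncurry K))
    (hj : Measurable j) {k : RN N → RN N → ℝ≥0∞} {C : ℝ≥0} (hk : IsControlKernel K j k C)
    {γ : ℝ} (hγ0 : 0 < γ) (hγ1 : γ < 1) (hA1 : CondA1 γ j) (hA2 : CondA2 j) {R₀ : ℝ}
    (hR₀ : 0 < R₀) (hA3 : CondA31 R₀ j ∨ CondA32 R₀ j) (hB : IsOpen B) (hAB : CompactlyIn A B)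
    {ε : ℝ} (hε : 0 < ε) : ∃ δ > 0, ∀ u g, IsBoundedWeakSol K j B G u g →
      ∀ᵐ p : RN N × RN N, p.1 ∈ A → p.2 ∈ A → ‖p.1 - p.2‖ ≤ δ → |u p.1 - u p.2| ≤ ε := by
  have hjs : ∀ ρ > 0, scaleMass j ρ < ∞ := fun ρ hρ => scaleMass_lt_top hγ0 hγ1 hA1 hρ
  obtain ⟨θ, κ, hθ, hθ1, hκ, hscale⟩ := exists_coalescing_scale hj hγ0 hγ1 hA1 hA2 hR₀ hA3
  obtain ⟨χ, δ₀, L, S, hδ₀, hL, hS, hSB, hχc, hχ0, hχ1, hχA, hχS, hχL⟩ :=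
    exists_lipschitz_cutoff hAB.1 hB hAB.2
  have hψL : ∀ x y, |(1 - χ x) - (1 - χ y)| ≤ L * min 1 ‖x - y‖ := fun x y => by
    rw [sub_sub_sub_cancel_left, abs_sub_comm]
    exact hχL x y
  -- The penalty `1 - χ` equals `1` off the compact set `S`, as the truncation requires, and
  -- vanishes on `A`, so it disappears from the final bound.
  obtain ⟨a, ha, hstep⟩ := OscBound.improve (ψ := fun x => 1 - χ x) hG hK hΛ hKm hj hjs hk hB hS hSB
    (measurable_const.sub hχc.measurable) (fun x => sub_nonneg.2 (hχ1 x))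
    (fun x hx => by simp [hχS x hx]) hL hψL hθ hθ1 hκ hscale hε
  -- The maximum stops the iteration at `ε`, below which the improvement step is not available.
  have hiter : ∀ n : ℕ, ∃ r > 0,
      OscBound K j B G (fun x => 1 - χ x) (max ε (2 - n * (a / 2))) r := by
    intro n
    induction n with
    | zero =>
      exact ⟨1, one_pos, (oscBound_two (fun x => sub_nonneg.2 (hχ1 x)) 1).mono (by simp)⟩
    | succ n ih =>
      obtain ⟨r, hr, hosc⟩ := ih
      rcases le_total (2 - n * (a / 2)) ε with h | h
      · refine ⟨r, hr, hosc.mono ?_⟩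
        rw [max_eq_left h]
        exact le_max_left _ _
      · rw [max_eq_right h] at hosc
        obtain ⟨r', hr', hosc'⟩ := hstep _ h r hr hosc
        refine ⟨r', hr', hosc'.mono (le_max_of_le_right ?_)⟩
        push_cast
        linarith
  obtain ⟨n, hn⟩ := exists_nat_ge (2 / (a / 2))
  rw [div_le_iff₀ (by positivity)] at hn
  obtain ⟨r, hr, hosc⟩ := hiter n
  rw [max_eq_left (by linarith)] at hosc
  have hψA : ∀ x ∈ A, 1 - χ x = 0 := fun x hx => by
    rw [hχA x (Metric.self_subset_cthickening _ (subset_closure hx)), sub_self]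
  refine ⟨r, hr, fun u g hs => ?_⟩
  have hneg := hosc _ _ hs.neg
  filter_upwards [hosc u g hs, hneg] with p h1 h2 hp1 hp2 hpr
  have h1' := h1 hpr
  have h2' := h2 hpr
  simp only [hψA _ hp1, hψA _ hp2, Pi.neg_apply] at h1' h2'
  exact abs_le.2 ⟨by linarith, by linarith⟩

end OneScale

/-! ### Interaction with the values far away. -/

section Localization

variable {N : ℕ} {K : RN N → RN N → ℝ≥0∞} {j : RN N → ℝ≥0} {Λ : ℝ≥0}

theorem bilinForm_congr_ae (K : RN N → RN N → ℝ≥0∞) {u v : RN N → ℝ} (h : u =ᵐ[volume] v)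
    (φ : RN N → ℝ) : bilinForm K u φ = bilinForm K v φ := by
  have h1 : ∀ᵐ p : RN N × RN N, u p.1 = v p.1 := Measure.quasiMeasurePreserving_fst.ae h
  have h2 : ∀ᵐ p : RN N × RN N, u p.2 = v p.2 := Measure.quasiMeasurePreserving_snd.ae h
  unfold bilinForm
  congr 1
  · congr 1
    refine integral_congr_ae ?_
    filter_upwards [h1, h2] with p hp1 hp2
    rw [hp1, hp2]
  · refine integral_congr_ae ?_
    filter_upwards [h1, h2] with p hp1 hp2
    rw [hp1, hp2]

theorem seminormVSq_congr_ae (B : Set (RN N)) {u v : RN N → ℝ} (h : u =ᵐ[volume] v) :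
    seminormVSq j B u = seminormVSq j B v := by
  have h1 : ∀ᵐ p : RN N × RN N, u p.1 = v p.1 := Measure.quasiMeasurePreserving_fst.ae h
  have h2 : ∀ᵐ p : RN N × RN N, u p.2 = v p.2 := Measure.quasiMeasurePreserving_snd.ae h
  refine lintegral_congr_ae (ae_restrict_of_ae ?_)
  filter_upwards [h1, h2] with p hp1 hp2
  rw [hp1, hp2]

theorem bilinForm_const_mul_add (K : RN N → RN N → ℝ≥0∞) {u t φ : RN N → ℝ} (c : ℝ)
    (hu : Integrable fun p : RN N × RN N => (u p.1 - u p.2) * (φ p.1 - φ p.2) * symPart K p.1 p.2)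
    (hu' : Integrable fun p : RN N × RN N => (u p.1 - u p.2) * φ p.1 * antiPart K p.1 p.2)
    (ht : Integrable fun p : RN N × RN N => (t p.1 - t p.2) * (φ p.1 - φ p.2) * symPart K p.1 p.2)
    (ht' : Integrable fun p : RN N × RN N => (t p.1 - t p.2) * φ p.1 * antiPart K p.1 p.2) :
    bilinForm K (fun x => c * u x + t x) φ = c * bilinForm K u φ + bilinForm K t φ := by
  have e1 : ∫ p : RN N × RN N, (c * u p.1 + t p.1 - (c * u p.2 + t p.2)) * (φ p.1 - φ p.2) *
      symPart K p.1 p.2 =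
      c * (∫ p : RN N × RN N, (u p.1 - u p.2) * (φ p.1 - φ p.2) * symPart K p.1 p.2) +
        ∫ p : RN N × RN N, (t p.1 - t p.2) * (φ p.1 - φ p.2) * symPart K p.1 p.2 := by
    rw [← integral_const_mul, ← integral_add (hu.const_mul c) ht]
    refine integral_congr_ae (Eventually.of_forall fun p => ?_)
    simp only
    ring
  have e2 : ∫ p : RN N × RN N, (c * u p.1 + t p.1 - (c * u p.2 + t p.2)) * φ p.1 *
      antiPart K p.1 p.2 =
      c * (∫ p : RN N × RN N, (u p.1 - u p.2) * φ p.1 * antiPart K p.1 p.2) +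
        ∫ p : RN N × RN N, (t p.1 - t p.2) * φ p.1 * antiPart K p.1 p.2 := by
    rw [← integral_const_mul, ← integral_add (hu'.const_mul c) ht']
    refine integral_congr_ae (Eventually.of_forall fun p => ?_)
    simp only
    ring
  simp only [bilinForm, e1, e2]
  ring

theorem seminormVSq_lt_top_of_contDiff (hj : Measurable j) (hj1 : scaleMass j 1 < ∞)
    {φ : RN N → ℝ} (hφ : ContDiff ℝ ((⊤ : ℕ∞) : WithTop ℕ∞) φ) (hφc : HasCompactSupport φ) :
    seminormVSq j univ φ < ∞ := by
  obtain ⟨L, hL⟩ := hφ.lipschitzWith_of_hasCompactSupport hφc (by simp)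
  obtain ⟨b, hb⟩ := hφc.exists_bound_of_continuous hφ.continuous
  refine seminormVSq_lt_top_of_increment_le hj hj1 MeasurableSet.univ
    hφc.isCompact.measurableSet (subset_univ _) hφc.isCompact.measure_lt_top
    (u := fun _ => 0) measurable_const (by simp [seminormVSq])
    (fun x hx => image_eq_zero_of_notMem_tsupport hx) (L := max L (2 * b)) fun x y _ => ?_
  rw [sub_self, abs_zero, zero_add]
  rcases le_total 1 ‖x - y‖ with h | h
  · rw [min_eq_left h, mul_one]
    refine le_trans ?_ (le_max_right _ _)
    have h1 := hb x
    have h2 := hb y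
    rw [Real.norm_eq_abs] at h1 h2
    linarith [abs_sub (φ x) (φ y)]
  · rw [min_eq_right h]
    have := hL.dist_le_mul x y
    rw [Real.dist_eq, dist_eq_norm] at this
    exact this.trans (mul_le_mul_of_nonneg_right (le_max_left _ _) (norm_nonneg _))

/-- Since `j` need not be even, the far-field terms involve both `j(x - y)` and `j(y - x)`. The
energy does not distinguish them, so one estimate serves for both. -/
theorem seminormVSq_neg (j : RN N → ℝ≥0) (B : Set (RN N)) (hB : MeasurableSet B) (u : RN N → ℝ) :
    seminormVSq (fun z => j (-z)) B u = seminormVSq j B u := by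
  rw [seminormVSq_eq_indicator hB, seminormVSq_eq_indicator hB, ← lintegral_swap]
  refine lintegral_congr fun p => ?_
  simp only [indicator, mem_ofPred_eq, Prod.fst_swap, Prod.snd_swap, neg_sub]
  have : (u p.2 - u p.1) ^ 2 = (u p.1 - u p.2) ^ 2 := by ring
  rw [this]
  split_ifs with h1 h2 h2 <;> first | rfl | exact absurd (Or.symm ‹_›) ‹_›

theorem tailMass_neg (j : RN N → ℝ≥0) (r : ℝ) : tailMass (fun z => j (-z)) r = tailMass j r := by
  rw [← lintegral_cutKernel, ← lintegral_cutKernel,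
    ← lintegral_neg_eq_self fun z => (cutKernel j r z : ℝ≥0∞)]
  refine lintegral_congr fun z => ?_
  simp [cutKernel, indicator]

/-- The interaction of a function vanishing off `D` with the values of `u` at distance at
least `d`. -/
theorem lintegral_cross_lt_top (hj : Measurable j) {d : ℝ} (hjd : tailMass j d < ∞)
    {Ω D : Set (RN N)} (hΩ : MeasurableSet Ω) (hD : MeasurableSet D) (hDΩ : D ⊆ Ω)
    (hDfin : volume D < ∞) {u : RN N → ℝ} (hu : Measurable u) (hus : seminormVSq j Ω u < ∞)
    (huD : ∫⁻ x in D, ‖u x‖ₑ < ∞) :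
    ∫⁻ p : RN N × RN N, D.indicator 1 p.1 * (‖u p.2‖ₑ * (cutKernel j d (p.1 - p.2) : ℝ≥0∞)) < ∞ := by
  have hcm : Measurable fun z => (cutKernel j d z : ℝ≥0∞) :=
    (measurable_cutKernel hj d).coe_nnreal_ennreal
  set a : RN N → ℝ≥0∞ := D.indicator fun x => 1 + ‖u x‖ₑ with ha
  have ham : Measurable a := (measurable_const.add hu.enorm).indicator hD
  set E : RN N × RN N → ℝ≥0∞ := {p : RN N × RN N | p.1 ∈ Ω ∨ p.2 ∈ Ω}.indicator
      (fun p => ENNReal.ofReal ((u p.1 - u p.2) ^ 2) * (j (p.1 - p.2) : ℝ≥0∞)) with hE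
  have hle : ∀ p : RN N × RN N,
      D.indicator 1 p.1 * (‖u p.2‖ₑ * (cutKernel j d (p.1 - p.2) : ℝ≥0∞)) ≤
        a p.1 * (cutKernel j d (p.1 - p.2) : ℝ≥0∞) + E p := by
    intro p
    by_cases hp : p.1 ∈ D
    · have hp' : p ∈ {p : RN N × RN N | p.1 ∈ Ω ∨ p.2 ∈ Ω} := Or.inl (hDΩ hp)
      rw [ha, hE, indicator_of_mem hp, indicator_of_mem hp, indicator_of_mem hp', Pi.one_apply,
        one_mul]
      -- The tail condition concerns `j(y - x)` only, so it cannot be used here. Instead `|s| ≤ 1 +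
      -- s²`, applied to the increment, lets the finite energy of `u` control its far values.
      have h1 : ‖u p.2‖ₑ ≤ 1 + ‖u p.1‖ₑ + ENNReal.ofReal ((u p.1 - u p.2) ^ 2) := by
        rw [Real.enorm_eq_ofReal_abs, Real.enorm_eq_ofReal_abs, ← ENNReal.ofReal_one,
          ← ENNReal.ofReal_add zero_le_one (abs_nonneg _),
          ← ENNReal.ofReal_add (by positivity) (sq_nonneg _)]
        refine ENNReal.ofReal_le_ofReal ?_
        have h2 : |u p.2| ≤ |u p.1| + |u p.1 - u p.2| := by
          have := abs_sub_abs_le_abs_sub (u p.2) (u p.1)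
          rw [abs_sub_comm] at this
          linarith
        have h3 := sq_abs (u p.1 - u p.2)
        nlinarith [sq_nonneg (|u p.1 - u p.2| - 1), abs_nonneg (u p.1 - u p.2)]
      calc ‖u p.2‖ₑ * (cutKernel j d (p.1 - p.2) : ℝ≥0∞)
          ≤ (1 + ‖u p.1‖ₑ + ENNReal.ofReal ((u p.1 - u p.2) ^ 2)) *
            (cutKernel j d (p.1 - p.2) : ℝ≥0∞) := mul_le_mul' h1 le_rfl
        _ ≤ _ := by
          rw [add_mul]
          exact add_le_add le_rfl
            (mul_le_mul' le_rfl (ENNReal.coe_le_coe.2 (cutKernel_le j d _)))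
    · rw [indicator_of_notMem hp, zero_mul]
      exact zero_le
  have hm1 : Measurable fun p : RN N × RN N => a p.1 * (cutKernel j d (p.1 - p.2) : ℝ≥0∞) :=
    (ham.comp measurable_fst).mul (hcm.comp (measurable_fst.sub measurable_snd))
  refine (lintegral_mono hle).trans_lt ?_
  rw [lintegral_add_left hm1, lintegral_prod_mul_sub' ham hcm, lintegral_cutKernel,
    ← seminormVSq_eq_indicator hΩ]
  refine ENNReal.add_lt_top.2 ⟨ENNReal.mul_lt_top ?_ hjd, hus⟩
  rw [ha, lintegral_indicator hD, lintegral_add_left measurable_const, lintegral_const, one_mul,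
    Measure.restrict_apply_univ]
  exact ENNReal.add_lt_top.2 ⟨hDfin, huD⟩

/-- The products of a bounded function supported in `D` with a function supported at distance
at least `d` from `D`, weighted by a kernel comparable with `j`, are integrable. -/
theorem integrable_cross (hj : Measurable j) {d : ℝ} (hjd : tailMass j d < ∞)
    {Ω D : Set (RN N)} (hΩ : MeasurableSet Ω) (hD : MeasurableSet D) (hDΩ : D ⊆ Ω)
    (hDfin : volume D < ∞) {u : RN N → ℝ} (hu : Measurable u) (hus : seminormVSq j Ω u < ∞)
    (huD : ∫⁻ x in D, ‖u x‖ₑ < ∞) {φ : RN N → ℝ} (hφ : Measurable φ) {b : ℝ≥0}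
    (hφb : ∀ x, ‖φ x‖ₑ ≤ b) (hφD : ∀ x ∉ D, φ x = 0) {t : RN N → ℝ} (ht : Measurable t)
    (htu : ∀ y, ‖t y‖ₑ ≤ ‖u y‖ₑ) (htd : ∀ x ∈ D, ∀ y, ‖x - y‖ < d → t y = 0)
    {m : RN N × RN N → ℝ} (hm : Measurable m) (hmj : ∀ p : RN N × RN N, p.1 ≠ p.2 →
      |m p| ≤ Λ * (j (p.1 - p.2) + j (p.2 - p.1))) (hd : 0 < d) :
    Integrable fun p : RN N × RN N => t p.2 * φ p.1 * m p := by
  have hI := lintegral_cross_lt_top hj hjd hΩ hD hDΩ hDfin hu hus huD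
  have hj' : Measurable fun z => j (-z) := hj.comp measurable_neg
  have hI' := lintegral_cross_lt_top hj' (by rwa [tailMass_neg]) hΩ hD hDΩ hDfin hu
    (by rwa [seminormVSq_neg j Ω hΩ]) huD
  have hms : ∀ {i : RN N → ℝ≥0}, Measurable i → Measurable fun p : RN N × RN N =>
      D.indicator 1 p.1 * (‖u p.2‖ₑ * (cutKernel i d (p.1 - p.2) : ℝ≥0∞)) := fun hi =>
    ((measurable_one.indicator hD).comp measurable_fst).mul ((hu.enorm.comp measurable_snd).mul
      ((measurable_cutKernel hi d).coe_nnreal_ennreal.comp (measurable_fst.sub measurable_snd)))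
  refine integrable_of_enorm_le (by fun_prop) (G := fun p => (b * Λ : ℝ≥0∞) *
    (D.indicator 1 p.1 * (‖u p.2‖ₑ * (cutKernel j d (p.1 - p.2) : ℝ≥0∞)) +
      D.indicator 1 p.1 * (‖u p.2‖ₑ * (cutKernel (fun z => j (-z)) d (p.1 - p.2) : ℝ≥0∞))))
    (fun p => ?_) ?_
  · by_cases hp : p.1 ∈ D
    swap
    · simp [hφD _ hp]
    by_cases hpd : ‖p.1 - p.2‖ < d
    · simp [htd _ hp _ hpd]
    have hne : p.1 ≠ p.2 := by
      intro h
      rw [h, sub_self, norm_zero] at hpd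
      exact hpd hd
    have hmem : p.1 - p.2 ∈ (Metric.ball (0 : RN N) d)ᶜ := by simpa using hpd
    have hm' : ‖m p‖ₑ ≤ Λ * ((j (p.1 - p.2) : ℝ≥0∞) + j (-(p.1 - p.2))) := by
      rw [Real.enorm_eq_ofReal_abs, neg_sub]
      refine (ENNReal.ofReal_le_ofReal (hmj p hne)).trans (le_of_eq ?_)
      rw [← NNReal.coe_add, ← NNReal.coe_mul, ENNReal.ofReal_coe_nnreal]
      push_cast
      rfl
    simp only [cutKernel, indicator_of_mem hp, indicator_of_mem hmem, Pi.one_apply, one_mul,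
      enorm_mul]
    calc ‖t p.2‖ₑ * ‖φ p.1‖ₑ * ‖m p‖ₑ
        ≤ ‖u p.2‖ₑ * b * (Λ * ((j (p.1 - p.2) : ℝ≥0∞) + j (-(p.1 - p.2)))) :=
          mul_le_mul' (mul_le_mul' (htu _) (hφb _)) hm'
      _ = _ := by ring
  · rw [lintegral_const_mul' _ _ (ENNReal.mul_ne_top ENNReal.coe_ne_top ENNReal.coe_ne_top),
      lintegral_add_left (hms hj)]
    exact ENNReal.mul_lt_top (ENNReal.mul_lt_top ENNReal.coe_lt_top ENNReal.coe_lt_top)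
      (ENNReal.add_lt_top.2 ⟨hI, hI'⟩)

/-- Off the support of `t` the bilinear form acts as a function. -/
theorem bilinForm_of_disjoint {t φ : RN N → ℝ} (hφt : ∀ x, t x * φ x = 0)
    (hKi : Integrable fun p : RN N × RN N => t p.2 * φ p.1 * (K p.1 p.2).toReal)
    (hai : Integrable fun p : RN N × RN N => t p.2 * φ p.1 * antiPart K p.1 p.2) :
    bilinForm K t φ = -∫ x, (∫ y, t y * (K x y).toReal) * φ x := by
  have e : ∀ (p : RN N × RN N) (c : ℝ), (t p.1 - t p.2) * φ p.1 * c = -(t p.2 * φ p.1 * c) :=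
    fun p c => by
      have := hφt p.1
      linear_combination c * this
  rw [bilinForm_eq K t φ (by simp only [e]; exact hKi.neg) (by simp only [e]; exact hai.neg)]
  simp only [e]
  rw [integral_neg, Measure.volume_eq_prod, integral_prod _ hKi]
  congr 1
  refine integral_congr_ae (Eventually.of_forall fun x => ?_)
  simp only
  rw [← integral_mul_const]
  refine integral_congr_ae (Eventually.of_forall fun y => ?_)
  simp only
  ring

/-- Expanding the product leaves two cross terms, which are exchanged by swapping the variables. -/
theorem integrable_symPart_form_of_disjoint {t φ : RN N → ℝ} (hφt : ∀ x, t x * φ x = 0)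
    (hsi : Integrable fun p : RN N × RN N => t p.2 * φ p.1 * symPart K p.1 p.2) :
    Integrable fun p : RN N × RN N =>
      (t p.1 - t p.2) * (φ p.1 - φ p.2) * symPart K p.1 p.2 := by
  have h2 : Integrable fun p : RN N × RN N => t p.1 * φ p.2 * symPart K p.2 p.1 := hsi.swap
  refine (hsi.add h2).neg.congr (Eventually.of_forall fun p => ?_)
  simp only [Pi.neg_apply, Pi.add_apply, symPart_comm K p.2 p.1]
  linear_combination (-symPart K p.1 p.2) * (hφt p.1 + hφt p.2)

end Localization

/-! ### Normalization and localization of weak solutions. -/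

section Reduction

variable {N : ℕ} {K : RN N → RN N → ℝ≥0∞} {j : RN N → ℝ≥0} {Λ : ℝ≥0}

/-- Truncation at height `c`. -/
def clamp (c t : ℝ) : ℝ := max (-c) (min c t)

theorem abs_clamp_le {c : ℝ} (hc : 0 ≤ c) (t : ℝ) : |clamp c t| ≤ c :=
  abs_le.2 ⟨le_max_left _ _, max_le (by linarith) (min_le_left _ _)⟩

theorem clamp_of_abs_le {c t : ℝ} (h : |t| ≤ c) : clamp c t = t := by
  rw [clamp, min_eq_right (abs_le.1 h).2, max_eq_right (abs_le.1 h).1]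

theorem abs_clamp_sub_le (c s t : ℝ) : |clamp c s - clamp c t| ≤ |s - t| := by
  refine (abs_max_sub_max_le_max _ _ _ _).trans (max_le (by simp) ?_)
  exact (abs_min_sub_min_le_max _ _ _ _).trans (max_le (by simp) le_rfl)

theorem measurable_clamp (c : ℝ) : Measurable (clamp c) := by
  unfold clamp
  fun_prop

theorem aestronglyMeasurable_of_memLpLoc {p : ℝ≥0∞} {u : RN N → ℝ} (hu : MemLpLoc p univ u) :
    AEStronglyMeasurable u volume := by
  have h : (⋃ n : ℕ, Metric.closedBall (0 : RN N) n) = univ := by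
    refine eq_univ_of_forall fun x => mem_iUnion.2 ?_
    obtain ⟨n, hn⟩ := exists_nat_ge ‖x‖
    exact ⟨n, by simpa using hn⟩
  rw [← Measure.restrict_univ (μ := volume), ← h, aestronglyMeasurable_iUnion_iff]
  exact fun n => (hu _ (isCompact_closedBall _ _) (subset_univ _)).aestronglyMeasurable

theorem CompactlyIn.exists_le_norm_sub {A B : Set (RN N)} (h : CompactlyIn A B) (hB : IsOpen B) :
    ∃ d > 0, ∀ x ∈ A, ∀ y, ‖x - y‖ < d → y ∈ B := by
  obtain ⟨d, hd, hdB⟩ := h.1.exists_cthickening_subset_open hB h.2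
  refine ⟨d, hd, fun x hx y hxy => hdB ?_⟩
  refine Metric.mem_cthickening_of_dist_le y x d _ (subset_closure hx) ?_
  rw [dist_comm, dist_eq_norm]
  exact hxy.le

theorem CompactlyIn.volume_lt_top {A B : Set (RN N)} (h : CompactlyIn A B) : volume A < ∞ :=
  (measure_mono subset_closure).trans_lt h.1.measure_lt_top

/-- The truncation to `B` of a function of finite seminorm has finite seminorm over sets compactly
contained in `B`. -/
theorem seminormVSq_truncation_lt_top (hj : Measurable j) {d : ℝ} (hjd : tailMass j d < ∞)
    {Ω B D : Set (RN N)} (hΩ : MeasurableSet Ω) (hBΩ : B ⊆ Ω) (hD : MeasurableSet D)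
    (hDfin : volume D < ∞) (hDB : ∀ x ∈ D, ∀ y, ‖x - y‖ < d → y ∈ B) (hd : 0 < d) {u : RN N → ℝ}
    (hus : seminormVSq j Ω u < ∞) {H : ℝ} (hH : 0 < H) :
    seminormVSq j D (B.indicator fun x => clamp 1 (u x / H)) < ∞ := by
  have hcm : Measurable fun z => (cutKernel j d z : ℝ≥0∞) :=
    (measurable_cutKernel hj d).coe_nnreal_ennreal
  set E : RN N × RN N → ℝ≥0∞ := {p : RN N × RN N | p.1 ∈ Ω ∨ p.2 ∈ Ω}.indicator
      (fun p => ENNReal.ofReal ((u p.1 - u p.2) ^ 2) * (j (p.1 - p.2) : ℝ≥0∞)) with hE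
  have h1m : Measurable (D.indicator (1 : RN N → ℝ≥0∞)) := measurable_one.indicator hD
  have hm1 : Measurable fun p : RN N × RN N =>
      D.indicator (1 : RN N → ℝ≥0∞) p.1 * (cutKernel j d (p.1 - p.2) : ℝ≥0∞) :=
    (h1m.comp measurable_fst).mul (hcm.comp (measurable_fst.sub measurable_snd))
  have hm2 : Measurable fun p : RN N × RN N =>
      D.indicator (1 : RN N → ℝ≥0∞) p.2 * (cutKernel j d (p.1 - p.2) : ℝ≥0∞) :=
    (h1m.comp measurable_snd).mul (hcm.comp (measurable_fst.sub measurable_snd))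
  have hm12 : Measurable fun p : RN N × RN N =>
      D.indicator (1 : RN N → ℝ≥0∞) p.1 * (cutKernel j d (p.1 - p.2) : ℝ≥0∞) +
        D.indicator (1 : RN N → ℝ≥0∞) p.2 * (cutKernel j d (p.1 - p.2) : ℝ≥0∞) := hm1.add hm2
  have hDsub : D ⊆ B := fun x hx => hDB x hx x (by simpa using hd)
  rw [seminormVSq_eq_indicator hD]
  have hle : ∀ p : RN N × RN N, {p : RN N × RN N | p.1 ∈ D ∨ p.2 ∈ D}.indicator
      (fun p => ENNReal.ofReal ((B.indicator (fun x => clamp 1 (u x / H)) p.1 -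
        B.indicator (fun x => clamp 1 (u x / H)) p.2) ^ 2) * (j (p.1 - p.2) : ℝ≥0∞)) p ≤
      D.indicator (1 : RN N → ℝ≥0∞) p.1 * (cutKernel j d (p.1 - p.2) : ℝ≥0∞) +
        D.indicator (1 : RN N → ℝ≥0∞) p.2 * (cutKernel j d (p.1 - p.2) : ℝ≥0∞) +
        ENNReal.ofReal ((H⁻¹) ^ 2) * E p := by
    intro p
    by_cases hp : p ∈ {p : RN N × RN N | p.1 ∈ D ∨ p.2 ∈ D}
    swap
    · rw [indicator_of_notMem hp]; exact zero_le
    rw [indicator_of_mem hp]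
    -- Inside `B` truncation decreases increments. A pair that meets `D` and leaves `B` is at least
    -- `d` apart, where increments bounded by `1` and the finite tail of `j` suffice.
    by_cases hB : p.1 ∈ B ∧ p.2 ∈ B
    · have hp' : p ∈ {p : RN N × RN N | p.1 ∈ Ω ∨ p.2 ∈ Ω} := Or.inl (hBΩ hB.1)
      refine le_trans ?_ le_add_self
      rw [indicator_of_mem hB.1, indicator_of_mem hB.2, hE, indicator_of_mem hp', ← mul_assoc,
        ← ENNReal.ofReal_mul (by positivity)]
      refine mul_le_mul' (ENNReal.ofReal_le_ofReal ?_) le_rfl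
      rw [← mul_pow, ← sq_abs]
      refine (pow_le_pow_left₀ (abs_nonneg _) (abs_clamp_sub_le _ _ _) 2).trans (le_of_eq ?_)
      rw [sq_abs]
      congr 1
      ring
    · have hmem : p.1 - p.2 ∈ (Metric.ball (0 : RN N) d)ᶜ := by
        intro h
        rw [mem_ball_zero_iff] at h
        rcases hp with hp | hp
        · exact hB ⟨hDsub hp, hDB _ hp _ h⟩
        · rw [norm_sub_rev] at h
          exact hB ⟨hDB _ hp _ h, hDsub hp⟩
      have hcut : cutKernel j d (p.1 - p.2) = j (p.1 - p.2) := indicator_of_mem hmem _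
      have hsq : (B.indicator (fun x => clamp 1 (u x / H)) p.1 -
          B.indicator (fun x => clamp 1 (u x / H)) p.2) ^ 2 ≤ 1 := by
        rw [sq_le_one_iff_abs_le_one]
        rw [not_and_or] at hB
        rcases hB with h | h
        · rw [indicator_of_notMem h, zero_sub, abs_neg]
          by_cases h2 : p.2 ∈ B
          · rw [indicator_of_mem h2]; exact abs_clamp_le zero_le_one _
          · rw [indicator_of_notMem h2]; simp
        · rw [indicator_of_notMem h, sub_zero]
          by_cases h2 : p.1 ∈ B
          · rw [indicator_of_mem h2]; exact abs_clamp_le zero_le_one _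
          · rw [indicator_of_notMem h2]; simp
      have h1 : (1 : ℝ≥0∞) ≤ D.indicator (1 : RN N → ℝ≥0∞) p.1 + D.indicator 1 p.2 := by
        rcases hp with hp | hp
        · rw [indicator_of_mem hp]; exact le_self_add
        · rw [indicator_of_mem hp]; exact le_add_self
      refine le_trans ?_ le_self_add
      rw [← add_mul, hcut]
      exact mul_le_mul' ((ENNReal.ofReal_le_one.2 hsq).trans h1) le_rfl
  refine (lintegral_mono hle).trans_lt ?_
  rw [lintegral_add_left hm12, lintegral_add_left hm1, lintegral_prod_mul_sub' h1m hcm,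
    lintegral_prod_snd_mul_sub h1m hcm, lintegral_cutKernel,
    lintegral_const_mul' _ _ ENNReal.ofReal_ne_top, ← seminormVSq_eq_indicator hΩ,
    lintegral_indicator_one hD]
  exact ENNReal.add_lt_top.2 ⟨ENNReal.add_lt_top.2 ⟨ENNReal.mul_lt_top hDfin hjd,
    ENNReal.mul_lt_top hDfin hjd⟩, ENNReal.mul_lt_top ENNReal.ofReal_lt_top hus⟩

theorem enorm_le_of_abs_le {x c : ℝ} (h : |x| ≤ c) : ‖x‖ₑ ≤ ENNReal.ofReal c := by
  rw [Real.enorm_eq_ofReal_abs]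
  exact ENNReal.ofReal_le_ofReal h

/-- The far field of a function vanishing on `B`. -/
theorem abs_integral_mul_kernel_le (hK : KernelBounds K j Λ) {B : Set (RN N)}
    (hB : MeasurableSet B) {u : RN N → ℝ} {x : RN N} (hx : x ∈ B) {H : ℝ} (hH : 0 ≤ H)
    (h : ∫⁻ y in Bᶜ, ‖u y‖ₑ * (j (y - x) : ℝ≥0∞) ≤ ENNReal.ofReal H) :
    |∫ y, Bᶜ.indicator u y * (K x y).toReal| ≤ Λ * H := by
  have h1 : ‖∫ y, Bᶜ.indicator u y * (K x y).toReal‖ₑ ≤ ENNReal.ofReal (Λ * H) := by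
    refine (enorm_integral_le_lintegral_enorm _).trans ?_
    rw [ENNReal.ofReal_mul NNReal.zero_le_coe, ENNReal.ofReal_coe_nnreal]
    refine le_trans ?_ (mul_le_mul' le_rfl h)
    rw [← lintegral_indicator hB.compl, ← lintegral_const_mul' _ _ ENNReal.coe_ne_top]
    refine lintegral_mono fun y => ?_
    by_cases hy : y ∈ Bᶜ
    · have hxy : x ≠ y := fun h => hy (h ▸ hx)
      rw [indicator_of_mem hy, indicator_of_mem hy, enorm_mul]
      have h2 : ‖(K x y).toReal‖ₑ ≤ Λ * (j (y - x) : ℝ≥0∞) := by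
        refine (enorm_le_of_abs_le (c := Λ * j (y - x)) ?_).trans (le_of_eq ?_)
        · rw [abs_of_nonneg ENNReal.toReal_nonneg]
          exact hK.toReal_le hxy
        · rw [← NNReal.coe_mul, ENNReal.ofReal_coe_nnreal, ENNReal.coe_mul]
      calc ‖u y‖ₑ * ‖(K x y).toReal‖ₑ ≤ ‖u y‖ₑ * (Λ * (j (y - x) : ℝ≥0∞)) := mul_le_mul' le_rfl h2
        _ = _ := by ring
    · simp [indicator_of_notMem hy]
  rw [Real.enorm_eq_ofReal_abs] at h1
  exact (ENNReal.ofReal_le_ofReal_iff (by positivity)).1 h1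

/-- Normalization and localization of a weak solution: the values far away enter the right-hand
side. -/
theorem exists_isBoundedWeakSol (hK : KernelBounds K j Λ)
    (hKm : Measurable (Function.uncurry K)) (hj : Measurable j)
    (hjs : ∀ ρ > 0, scaleMass j ρ < ∞) {k : RN N → RN N → ℝ≥0∞} {C : ℝ≥0}
    (hk : IsControlKernel K j k C) {Ω B D : Set (RN N)} (hΩ : IsOpen Ω) (hB : IsOpen B)
    (hD : IsOpen D) (hDB : CompactlyIn D B) (hBΩ : B ⊆ Ω) {W f u : RN N → ℝ} {w H : ℝ}
    (hH : 0 < H) (hw0 : 0 ≤ w) (hWm : AEStronglyMeasurable W (volume.restrict D))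
    (hfm : AEStronglyMeasurable f (volume.restrict D))
    (hW : ∀ᵐ x ∂volume.restrict D, |W x| ≤ w) (hf : ∀ᵐ x ∂volume.restrict D, |f x| ≤ H)
    (hu : ∀ᵐ x ∂volume.restrict B, |u x| ≤ H)
    (htail : ∀ᵐ x ∂volume.restrict D,
      ∫⁻ y in Bᶜ, ‖u y‖ₑ * (j (y - x) : ℝ≥0∞) ≤ ENNReal.ofReal H)
    (hs : IsWeakSol K j Ω W f u) :
    ∃ v g, IsBoundedWeakSol K j D (w + 1 + Λ) v g ∧ ∀ᵐ x ∂volume.restrict D, u x = H * v x := by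
  obtain ⟨d, hd, hdB⟩ := hDB.exists_le_norm_sub hB
  have hDsub : D ⊆ B := fun x hx => hdB x hx x (by simpa using hd)
  have hDfin : volume D < ∞ := hDB.volume_lt_top
  have hjd : tailMass j d < ∞ := (tailMass_le_scaleMass hd).trans_lt (hjs d hd)
  have hum := aestronglyMeasurable_of_memLpLoc hs.1.1
  set u₁ := hum.mk u with hu₁
  have hu₁m : Measurable u₁ := hum.stronglyMeasurable_mk.measurable
  have huu₁ : u =ᵐ[volume] u₁ := hum.ae_eq_mk
  have hus : seminormVSq j Ω u₁ < ∞ := by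
    rw [← seminormVSq_congr_ae Ω huu₁]
    exact hs.1.2
  -- The truncation does nothing almost everywhere in `B`; it makes the bound by `1` hold at every
  -- point.
  set v : RN N → ℝ := B.indicator fun x => clamp 1 (u₁ x / H) with hv
  have hvm : Measurable v := ((measurable_clamp 1).comp (hu₁m.div_const H)).indicator hB.measurableSet
  have hvb : ∀ x, |v x| ≤ 1 := fun x => by
    by_cases hx : x ∈ B
    · rw [hv, indicator_of_mem hx]; exact abs_clamp_le zero_le_one _
    · rw [hv, indicator_of_notMem hx]; simp
  have hvs : seminormVSq j D v < ∞ := seminormVSq_truncation_lt_top hj hjd hΩ.measurableSet hBΩ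
    hD.measurableSet hDfin hdB hd hus hH
  -- The far part vanishes at distance less than `d` from `D`, so tested against functions supported
  -- in `D` it acts as an ordinary right-hand side.
  set t : RN N → ℝ := Bᶜ.indicator u₁ with ht
  have htm : Measurable t := hu₁m.indicator hB.measurableSet.compl
  have hub : ∀ᵐ x, x ∈ B → |u₁ x| ≤ H := by
    filter_upwards [(ae_restrict_iff' hB.measurableSet).1 hu, huu₁] with x hx hx' hxB
    rw [← hx']
    exact hx hxB
  have hvu : ∀ᵐ x, x ∈ B → u₁ x = H * v x := by
    filter_upwards [hub] with x hx hxB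
    rw [hv, indicator_of_mem hxB, clamp_of_abs_le, mul_div_cancel₀ _ hH.ne']
    rw [abs_div, abs_of_pos hH]
    exact (div_le_one hH).2 (hx hxB)
  have hdecomp : u =ᵐ[volume] fun x => H * v x + t x := by
    filter_upwards [huu₁, hvu] with x h1 h2
    by_cases hx : x ∈ B
    · rw [h1, h2 hx, ht, indicator_of_notMem (by simpa using hx), add_zero]
    · rw [h1, ht, indicator_of_mem (by simpa using hx), hv, indicator_of_notMem hx, mul_zero,
        zero_add]
  set h : RN N → ℝ := fun x => ∫ y, t y * (K x y).toReal with hh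
  have hhm : Measurable h := by
    have : Measurable (Function.uncurry fun (x y : RN N) => t y * (K x y).toReal) :=
      (htm.comp measurable_snd).mul (measurable_toReal_kernel hKm)
    exact this.stronglyMeasurable.integral_prod_right.measurable
  -- The three summands bound, after division by `H`, the potential term, the source and the far
  -- field.
  set G : ℝ := w + 1 + Λ with hG
  have hG0 : 0 ≤ G := by positivity
  -- Again the truncation is inactive almost everywhere in `D`; outside `D` the values of `g` never
  -- meet a test function.
  set g : RN N → ℝ := fun x =>
    clamp G ((hWm.mk W x * (H * v x) + hfm.mk f x + h x) / H) with hg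
  have hgm : Measurable g := (measurable_clamp G).comp
    ((((hWm.stronglyMeasurable_mk.measurable.mul (hvm.const_mul H)).add
      hfm.stronglyMeasurable_mk.measurable).add hhm).div_const H)
  have hgeq : ∀ᵐ x ∂volume.restrict D, W x * u x + f x = H * g x - h x := by
    have h1 : ∀ᵐ x ∂volume.restrict D, u x = H * v x := by
      rw [ae_restrict_iff' hD.measurableSet]
      filter_upwards [huu₁, hvu] with x h1 h2 hx
      rw [h1, h2 (hDsub hx)]
    have h2 : ∀ᵐ x ∂volume.restrict D, |h x| ≤ Λ * H := by
      filter_upwards [htail, ae_restrict_mem hD.measurableSet] with x hx hxD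
      refine abs_integral_mul_kernel_le hK hB.measurableSet (hDsub hxD) hH.le ?_
      refine le_trans (le_of_eq ?_) hx
      refine lintegral_congr_ae (ae_restrict_of_ae ?_)
      filter_upwards [huu₁] with y hy
      rw [hy]
    filter_upwards [hWm.ae_eq_mk, hfm.ae_eq_mk, hW, hf, h1, h2] with x e1 e2 hWx hfx hux hhx
    rw [hg]
    simp only
    rw [← e1, ← e2, clamp_of_abs_le, mul_div_cancel₀ _ hH.ne', hux]
    · ring
    · rw [abs_div, abs_of_pos hH, div_le_iff₀ hH]
      have h3 : |W x * (H * v x)| ≤ w * (H * 1) := by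
        rw [abs_mul, abs_mul, abs_of_pos hH]
        gcongr
        exact hvb x
      calc |W x * (H * v x) + f x + h x| ≤ |W x * (H * v x)| + |f x| + |h x| := abs_add_three _ _ _
        _ ≤ w * (H * 1) + H + Λ * H := by gcongr
        _ = G * H := by rw [hG]; ring
  refine ⟨v, g, ⟨hvm, hvb, hvs, hgm, fun x => abs_clamp_le hG0 _, fun φ hφ hφc hφD => ?_⟩, ?_⟩
  swap
  · rw [ae_restrict_iff' hD.measurableSet]
    filter_upwards [huu₁, hvu] with x h1 h2 hx
    rw [h1, h2 (hDsub hx)]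
  have hφm : Measurable φ := hφ.continuous.measurable
  have hφ0 : ∀ x ∉ D, φ x = 0 := fun x hx => image_eq_zero_of_notMem_tsupport fun h => hx (hφD h)
  obtain ⟨b, hb⟩ := hφc.exists_bound_of_continuous hφ.continuous
  have hb' : ∀ x, ‖φ x‖ₑ ≤ (b.toNNReal : ℝ≥0) := fun x => enorm_le_of_abs_le (hb x)
  have hφt : ∀ x, t x * φ x = 0 := fun x => by
    by_cases hx : x ∈ B
    · rw [ht, indicator_of_notMem (by simpa using hx), zero_mul]
    · rw [hφ0 x fun h => hx (hDsub h), mul_zero]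
  have huD : ∫⁻ x in D, ‖u₁ x‖ₑ < ∞ := by
    refine (setLIntegral_mono_ae' (g := fun _ => ENNReal.ofReal H) hD.measurableSet ?_).trans_lt ?_
    · filter_upwards [hub] with x hx hxD using enorm_le_of_abs_le (hx (hDsub hxD))
    · rw [lintegral_const, Measure.restrict_apply_univ]
      exact ENNReal.mul_lt_top ENNReal.ofReal_lt_top hDfin
  have hcross : ∀ m : RN N × RN N → ℝ, Measurable m → (∀ p : RN N × RN N, p.1 ≠ p.2 →
      |m p| ≤ Λ * (j (p.1 - p.2) + j (p.2 - p.1))) →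
      Integrable fun p : RN N × RN N => t p.2 * φ p.1 * m p := fun m hm hmj =>
    integrable_cross hj hjd hΩ.measurableSet hD.measurableSet (hDsub.trans hBΩ) hDfin hu₁m hus huD
      hφm hb' hφ0 htm (fun y => by
        by_cases hy : y ∈ Bᶜ
        · rw [ht, indicator_of_mem hy]
        · rw [ht, indicator_of_notMem hy]; simp)
      (fun x hx y hxy => by
        rw [ht, indicator_of_notMem (by simpa using hdB x hx y hxy)]) hm hmj hd
  have hsym : ∀ p : RN N × RN N, p.1 ≠ p.2 →
      symPart K p.1 p.2 ≤ Λ * (j (p.1 - p.2) + j (p.2 - p.1)) := fun p hp => by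
    refine (hK.symPart_le hp).trans ?_
    have h1 : (0 : ℝ) ≤ j (p.1 - p.2) := NNReal.coe_nonneg _
    have h2 : (0 : ℝ) ≤ j (p.2 - p.1) := NNReal.coe_nonneg _
    gcongr
    linarith
  have hiK := hcross _ (measurable_toReal_kernel hKm) fun p hp => by
    rw [abs_of_nonneg ENNReal.toReal_nonneg]
    refine (hK.toReal_le hp).trans ?_
    gcongr
    exact le_add_of_nonneg_left (NNReal.coe_nonneg _)
  have hia := hcross _ (measurable_antiPart hKm) fun p hp =>
    (abs_antiPart_le K _ _).trans (hsym p hp)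
  have his := hcross _ (measurable_symPart hKm) fun p hp => by
    rw [abs_of_nonneg (symPart_nonneg K _ _)]
    exact hsym p hp
  have hta : Integrable fun p : RN N × RN N => (t p.1 - t p.2) * φ p.1 * antiPart K p.1 p.2 := by
    refine hia.neg.congr (Eventually.of_forall fun p => ?_)
    simp only [Pi.neg_apply]
    linear_combination (-antiPart K p.1 p.2) * hφt p.1
  have hform := hs.2 φ hφ hφc (hφD.trans (hDsub.trans hBΩ))
  rw [bilinForm_congr_ae K hdecomp, bilinForm_const_mul_add K H
    (integrable_symPart_form hK hKm hj hD.measurableSet hvm hvs hφm hφ0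
      (seminormVSq_lt_top_of_contDiff hj (hjs 1 one_pos) hφ hφc))
    (integrable_antiPart_form hK hKm hj hjs hk hD hφc.isCompact hφD hvm hvb hvs hφm
      (fun x hx => image_eq_zero_of_notMem_tsupport hx) hb)
    (integrable_symPart_form_of_disjoint hφt his) hta,
    bilinForm_of_disjoint hφt hiK hia] at hform
  have hφi : Integrable φ := hφ.continuous.integrable_of_hasCompactSupport hφc
  have hgφ : Integrable fun x => g x * φ x :=
    hφi.bdd_mul (c := G) hgm.aestronglyMeasurable (Eventually.of_forall fun x => abs_clamp_le hG0 _)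
  have hhφ : Integrable fun x => h x * φ x := by
    have h1 : Integrable fun x => ∫ y, t y * φ x * (K x y).toReal := hiK.integral_prod_left
    refine h1.congr (Eventually.of_forall fun x => ?_)
    simp only [hh]
    rw [← integral_mul_const]
    refine integral_congr_ae (Eventually.of_forall fun y => ?_)
    simp only
    ring
  have hrhs : ∫ x in Ω, (W x * u x + f x) * φ x = H * (∫ x, g x * φ x) - ∫ x, h x * φ x := by
    rw [setIntegral_eq_integral_of_forall_compl_eq_zero fun x hx => by
        rw [hφ0 x fun h => hx (hBΩ (hDsub h)), mul_zero],
      ← integral_const_mul, ← integral_sub (hgφ.const_mul H) hhφ]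
    refine integral_congr_ae ?_
    filter_upwards [(ae_restrict_iff' hD.measurableSet).1 hgeq] with x hx
    by_cases hxD : x ∈ D
    · rw [hx hxD]; ring
    · rw [hφ0 x hxD]; ring
  rw [hrhs] at hform
  have : H * bilinForm K v φ = H * ∫ x, g x * φ x := by linarith
  exact mul_left_cancel₀ hH.ne' this

end Reduction

/-! ### From oscillation up to null sets to continuous representatives and moduli. -/

section Representatives

variable {N : ℕ}

/-- `u` oscillates by at most `ε` at distance at most `δ` in `A`, up to null sets. -/
def AEOscLE (A : Set (RN N)) (u : RN N → ℝ) (ε δ : ℝ) : Prop :=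
  ∀ᵐ p : RN N × RN N, p.1 ∈ A → p.2 ∈ A → ‖p.1 - p.2‖ ≤ δ → |u p.1 - u p.2| ≤ ε

theorem AEOscLE.congr_ae {A : Set (RN N)} (hA : MeasurableSet A) {u v : RN N → ℝ} {ε δ : ℝ}
    (h : AEOscLE A u ε δ) (huv : v =ᵐ[volume.restrict A] u) : AEOscLE A v ε δ := by
  have h' := (ae_restrict_iff' hA).1 huv
  have h1 : ∀ᵐ p : RN N × RN N, p.1 ∈ A → v p.1 = u p.1 :=
    Measure.quasiMeasurePreserving_fst.ae h'
  have h2 : ∀ᵐ p : RN N × RN N, p.2 ∈ A → v p.2 = u p.2 :=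
    Measure.quasiMeasurePreserving_snd.ae h'
  filter_upwards [h, h1, h2] with p hp hp1 hp2 hA1 hA2 hd
  rw [hp1 hA1, hp2 hA2]
  exact hp hA1 hA2 hd

theorem AEOscLE.const_mul {A : Set (RN N)} {u : RN N → ℝ} {ε δ : ℝ}
    (h : AEOscLE A u ε δ) {c : ℝ} (hc : 0 ≤ c) : AEOscLE A (fun x => c * u x) (c * ε) δ := by
  filter_upwards [h] with p hp hA1 hA2 hd
  rw [← mul_sub, abs_mul, abs_of_nonneg hc]
  exact mul_le_mul_of_nonneg_left (hp hA1 hA2 hd) hc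

/-- Pairs violating the bound form an open set by continuity, and an open null set is empty. -/
theorem AEOscLE.forall_of_continuousOn {A : Set (RN N)} (hA : IsOpen A) {v : RN N → ℝ} {ε δ : ℝ}
    (h : AEOscLE A v ε δ) (hv : ContinuousOn v A) {x y : RN N} (hx : x ∈ A) (hy : y ∈ A)
    (hxy : ‖x - y‖ < δ) : |v x - v y| ≤ ε := by
  set O : Set (RN N × RN N) := (A ×ˢ A) ∩ {p | ‖p.1 - p.2‖ < δ} with hO
  have hOo : IsOpen O := (hA.prod hA).inter (isOpen_lt (by fun_prop) continuous_const)
  have hF : ContinuousOn (fun p : RN N × RN N => |v p.1 - v p.2|) O := by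
    have h1 : ContinuousOn (fun p : RN N × RN N => v p.1) O :=
      hv.comp continuousOn_fst fun p hp => hp.1.1
    have h2 : ContinuousOn (fun p : RN N × RN N => v p.2) O :=
      hv.comp continuousOn_snd fun p hp => hp.1.2
    exact (h1.sub h2).abs
  have hU := hF.isOpen_inter_preimage hOo (isOpen_Ioi (a := ε))
  have hnull : volume (O ∩ (fun p : RN N × RN N => |v p.1 - v p.2|) ⁻¹' Ioi ε) = 0 := by
    refine measure_mono_null (fun p hp => ?_) (ae_iff.1 h)
    intro hcon
    exact not_lt.2 (hcon hp.1.1.1 hp.1.1.2 (le_of_lt hp.1.2)) hp.2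
  have hempty := (hU.measure_eq_zero_iff volume).1 hnull
  by_contra hcon
  exact (hempty ▸ (⟨⟨⟨hx, hy⟩, hxy⟩, not_le.1 hcon⟩ :
    (x, y) ∈ O ∩ (fun p : RN N × RN N => |v p.1 - v p.2|) ⁻¹' Ioi ε) : (x, y) ∈ (∅ : Set _))

/-- The points at which `u` is approximately continuous in the uniform sense. -/
def essContSet (u : RN N → ℝ) : Set (RN N) :=
  {x | ∀ ε > 0, ∃ r > 0, ∀ᵐ y, y ∈ Metric.ball x r → |u x - u y| ≤ ε}

/-- Fubini turns the bound for almost every pair into one for almost every `y` at almost every `x`;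
countably many values of `ε` are enough. -/
theorem ae_mem_essContSet {A : Set (RN N)} (hA : IsOpen A) {u : RN N → ℝ}
    (h : ∀ ε > 0, ∃ δ > 0, AEOscLE A u ε δ) : ∀ᵐ x, x ∈ A → x ∈ essContSet u := by
  have h1 : ∀ n : ℕ, ∀ᵐ x, x ∈ A →
      ∃ r > 0, ∀ᵐ y, y ∈ Metric.ball x r → |u x - u y| ≤ 1 / (n + 1 : ℝ) := by
    intro n
    obtain ⟨δ, hδ, hosc⟩ := h (1 / (n + 1 : ℝ)) (by positivity)
    filter_upwards [Measure.ae_ae_of_ae_prod hosc] with x hx hxA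
    obtain ⟨r, hr, hrA⟩ := Metric.isOpen_iff.1 hA x hxA
    refine ⟨min r δ, lt_min hr hδ, ?_⟩
    filter_upwards [hx] with y hy hyr
    refine hy hxA (hrA (Metric.ball_subset_ball (min_le_left _ _) hyr)) ?_
    rw [Metric.mem_ball, dist_comm, dist_eq_norm] at hyr
    exact hyr.le.trans (min_le_right _ _)
  filter_upwards [ae_all_iff.2 h1] with x hx hxA ε hε
  obtain ⟨n, hn⟩ := exists_nat_one_div_lt hε
  obtain ⟨r, hr, hy⟩ := hx n hxA
  refine ⟨r, hr, ?_⟩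
  filter_upwards [hy] with y hy hyr using (hy hyr).trans hn.le

/-- Pairs near `(x, y)` fill a set of positive measure, so one of them satisfies all three
almost-everywhere bounds and links `u x` to `u y`. -/
theorem abs_sub_le_of_mem_essContSet {A : Set (RN N)} (hA : IsOpen A) {u : RN N → ℝ} {ε δ : ℝ}
    (hε : 0 < ε) (h : AEOscLE A u ε δ) {x y : RN N} (hx : x ∈ essContSet u)
    (hy : y ∈ essContSet u) (hxA : x ∈ A) (hyA : y ∈ A) (hxy : ‖x - y‖ < δ) :
    |u x - u y| ≤ 3 * ε := by
  obtain ⟨r, hr, hxr⟩ := hx ε hε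
  obtain ⟨s, hs, hys⟩ := hy ε hε
  set O : Set (RN N × RN N) :=
    ((Metric.ball x r ∩ A) ×ˢ (Metric.ball y s ∩ A)) ∩ {p | ‖p.1 - p.2‖ < δ} with hO
  have hOo : IsOpen O := ((Metric.isOpen_ball.inter hA).prod (Metric.isOpen_ball.inter hA)).inter
    (isOpen_lt (by fun_prop) continuous_const)
  have hne : O.Nonempty :=
    ⟨(x, y), ⟨⟨Metric.mem_ball_self hr, hxA⟩, ⟨Metric.mem_ball_self hs, hyA⟩⟩, hxy⟩
  have hpos : volume O ≠ 0 := (hOo.measure_pos volume hne).ne'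
  have h1 : ∀ᵐ p : RN N × RN N, p.1 ∈ Metric.ball x r → |u x - u p.1| ≤ ε :=
    Measure.quasiMeasurePreserving_fst.ae hxr
  have h2 : ∀ᵐ p : RN N × RN N, p.2 ∈ Metric.ball y s → |u y - u p.2| ≤ ε :=
    Measure.quasiMeasurePreserving_snd.ae hys
  have hae : ∀ᵐ p : RN N × RN N, p ∈ O → |u x - u y| ≤ 3 * ε := by
    filter_upwards [h, h1, h2] with p hp hp1 hp2 hpO
    have e1 := abs_le.1 (hp hpO.1.1.2 hpO.1.2.2 (le_of_lt hpO.2))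
    have e2 := abs_le.1 (hp1 hpO.1.1.1)
    have e3 := abs_le.1 (hp2 hpO.1.2.1)
    exact abs_le.2 ⟨by linarith, by linarith⟩
  by_contra hcon
  refine hpos (measure_mono_null (fun p hp => ?_) (ae_iff.1 hae))
  exact fun h => hcon (h hp)

/-- The good points have full measure in `Ω` and hence are dense there. On them `u` is locally
uniformly continuous, so it extends by taking limits. -/
theorem exists_isContRep {Ω : Set (RN N)} (hΩ : IsOpen Ω) {u : RN N → ℝ}
    (h : ∀ x ∈ Ω, ∃ A, IsOpen A ∧ x ∈ A ∧ A ⊆ Ω ∧ ∀ ε > 0, ∃ δ > 0, AEOscLE A u ε δ) :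
    ∃ v, IsContRep Ω u v := by
  set E := essContSet u with hE
  have hnull : volume (Ω \ E) = 0 := by
    refine measure_null_of_locally_null _ fun x hx => ?_
    obtain ⟨A, hA, hxA, -, hosc⟩ := h x hx.1
    refine ⟨(Ω \ E) ∩ A, inter_mem_nhdsWithin _ (hA.mem_nhds hxA), ?_⟩
    refine measure_mono_null (fun y hy => ?_) (ae_iff.1 (ae_mem_essContSet hA hosc))
    exact fun hcon => hy.1.2 (hcon hy.2)
  have hcl : Ω ⊆ closure E := by
    intro x hx
    obtain ⟨A, hA, hxA, hAΩ, -⟩ := h x hx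
    rw [mem_closure_iff]
    intro O hO hxO
    by_contra hcon
    have hsub : O ∩ A ⊆ Ω \ E := fun y hy => ⟨hAΩ hy.2, fun hyE => hcon ⟨y, hy.1, hyE⟩⟩
    exact ((hO.inter hA).measure_pos volume ⟨x, hxO, hxA⟩).ne' (measure_mono_null hsub hnull)
  have hlim : ∀ x ∈ Ω, ∃ y, Tendsto u (𝓝[E] x) (𝓝 y) := by
    intro x hx
    obtain ⟨A, hA, hxA, -, hosc⟩ := h x hx
    have hne : (𝓝[E] x).NeBot := mem_closure_iff_nhdsWithin_neBot.1 (hcl hx)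
    refine CompleteSpace.complete (Metric.cauchy_iff.2 ⟨hne.map u, fun ε hε => ?_⟩)
    obtain ⟨δ, hδ, hδosc⟩ := hosc (ε / 4) (by positivity)
    refine ⟨u '' (E ∩ (A ∩ Metric.ball x (δ / 2))), image_mem_map (inter_mem_nhdsWithin _
      (inter_mem (hA.mem_nhds hxA) (Metric.ball_mem_nhds x (by positivity)))), ?_⟩
    rintro _ ⟨y, ⟨hyE, hyA, hyb⟩, rfl⟩ _ ⟨z, ⟨hzE, hzA, hzb⟩, rfl⟩
    rw [Real.dist_eq]
    have hyz : ‖y - z‖ < δ := by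
      rw [← dist_eq_norm]
      rw [Metric.mem_ball] at hyb hzb
      linarith [dist_triangle_right y z x]
    have := abs_sub_le_of_mem_essContSet hA (by positivity) hδosc hyE hzE hyA hzA hyz
    linarith
  refine ⟨extendFrom E u, continuousOn_extendFrom hcl hlim, ?_⟩
  have hmem : ∀ᵐ x, x ∉ Ω \ E := measure_eq_zero_iff_ae_notMem.1 hnull
  refine (ae_restrict_iff' hΩ.measurableSet).2 ?_
  filter_upwards [hmem] with x hx hxΩ
  have hxE : x ∈ E := by
    by_contra hcon
    exact hx ⟨hxΩ, hcon⟩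
  obtain ⟨y, hy⟩ := hlim x hxΩ
  rw [extendFrom_eq (hcl hxΩ) hy]
  -- At a good point `x` the limit within `E` sees the value at `x` itself.
  exact tendsto_nhds_unique (hy.mono_left (pure_le_nhdsWithin hxE)) (tendsto_pure_nhds u x)

/-- A modulus of continuity assembled from countably many scales. -/
theorem exists_modulus {δ : ℕ → ℝ} (hδ : ∀ n, 0 < δ n) :
    ∃ η : ℝ≥0 → ℝ≥0, Monotone η ∧ Continuous η ∧ η 0 = 0 ∧ ∀ (t : ℝ≥0) (b H : ℝ), 0 ≤ H →
      (t = 0 → b ≤ 0) → b ≤ 2 * H → (∀ n, (t : ℝ) < δ n → b ≤ H * (1 / 2) ^ n) → b ≤ η t * H := by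
  -- The cap `(1/2) ^ n` ensures that every positive `t` exceeds some `d n`; no monotonicity of `δ`
  -- is needed.
  set d : ℕ → ℝ := fun n => min (δ n) ((1 / 2) ^ n) with hd
  have hd0 : ∀ n, 0 < d n := fun n => lt_min (hδ n) (by positivity)
  set F : ℕ → ℝ≥0 → ℝ := fun n t => 4 * (1 / 2) ^ n * min 1 ((t : ℝ) / d n) with hF
  have hmin0 : ∀ n (t : ℝ≥0), 0 ≤ min 1 ((t : ℝ) / d n) := fun n t =>
    le_min zero_le_one (div_nonneg t.2 (hd0 n).le)
  have hF0 : ∀ n t, 0 ≤ F n t := fun n t => mul_nonneg (by positivity) (hmin0 n t)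
  have hFle : ∀ n t, F n t ≤ 4 * (1 / 2) ^ n := fun n t =>
    mul_le_of_le_one_right (by positivity) (min_le_left _ _)
  have hsum : Summable fun n : ℕ => 4 * (1 / 2 : ℝ) ^ n := summable_geometric_two.mul_left 4
  have hFs : ∀ t, Summable fun n => F n t := fun t =>
    Summable.of_nonneg_of_le (fun n => hF0 n t) (fun n => hFle n t) hsum
  have hFc : ∀ n, Continuous (F n) := fun n =>
    continuous_const.mul (continuous_const.min (NNReal.continuous_coe.div_const _))
  refine ⟨fun t => (∑' n, F n t).toNNReal, fun s t hst => Real.toNNReal_le_toNNReal ?_,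
    continuous_real_toNNReal.comp (continuous_tsum hFc hsum fun n t => ?_), ?_, ?_⟩
  · refine (hFs s).tsum_le_tsum (fun n => ?_) (hFs t)
    refine mul_le_mul_of_nonneg_left (min_le_min le_rfl ?_) (by positivity)
    exact div_le_div_of_nonneg_right (NNReal.coe_le_coe.2 hst) (hd0 n).le
  · rw [Real.norm_of_nonneg (hF0 n t)]
    exact hFle n t
  · simp [hF]
  · intro t b H hH hb0 hb1 hb
    rw [Real.coe_toNNReal _ (tsum_nonneg fun n => hF0 n t)]
    rcases eq_or_ne t 0 with rfl | ht
    · exact (hb0 rfl).trans (mul_nonneg (tsum_nonneg fun n => hF0 n 0) hH)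
    have ht' : (0 : ℝ) < t := lt_of_le_of_ne t.2 fun h => ht (NNReal.coe_eq_zero.1 h.symm)
    have hex : ∃ n, d n ≤ t := by
      obtain ⟨n, hn⟩ := exists_pow_lt_of_lt_one ht' (by norm_num : (1 / 2 : ℝ) < 1)
      exact ⟨n, (min_le_right _ _).trans hn.le⟩
    classical
    have hle : ∀ n, d n ≤ t → 4 * (1 / 2) ^ n ≤ ∑' n, F n t := fun n hn => by
      refine le_trans (le_of_eq ?_) ((hFs t).le_tsum n fun m _ => hF0 m t)
      rw [hF]
      simp only
      rw [min_eq_left ((one_le_div (hd0 n)).2 hn), mul_one]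
    have h1 := hle _ (Nat.find_spec hex)
    refine le_trans ?_ (mul_le_mul_of_nonneg_right h1 hH)
    -- If the first index with `d n ≤ t` is `0`, the saturated term `4` covers the trivial bound
    -- `2H`. If it is `n + 1`, then `t < δ n` gives `H (1/2) ^ n`, and the saturated term `4 (1/2) ^
    -- (n + 1)` is twice the factor needed.
    rcases hn : Nat.find hex with _ | n
    · simp only [pow_zero]
      linarith
    · have h2 : ¬ d n ≤ t := Nat.find_min hex (by omega)
      have h3 := hb n ((not_le.1 h2).trans_le (min_le_left _ _))
      rw [pow_succ]
      nlinarith [mul_nonneg hH (pow_nonneg (by norm_num : (0 : ℝ) ≤ 1 / 2) n)]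

theorem MemLpLoc.memLp_restrict {p : ℝ≥0∞} {Ω A : Set (RN N)} {u : RN N → ℝ}
    (hu : MemLpLoc p Ω u) (hA : CompactlyIn A Ω) : MemLp u p (volume.restrict A) :=
  (hu _ hA.1 hA.2).mono_measure (Measure.restrict_mono subset_closure le_rfl)

theorem CompactlyIn.trans_subset {A B C : Set (RN N)} (h : CompactlyIn A B) (hBC : B ⊆ C) :
    CompactlyIn A C := ⟨h.1, h.2.trans hBC⟩

theorem CompactlyIn.subset {A B : Set (RN N)} (h : CompactlyIn A B) : A ⊆ B :=
  subset_closure.trans h.2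

theorem ae_abs_le_of_eLpNorm_le {μ : Measure (RN N)} {u : RN N → ℝ} {H : ℝ} (hH : 0 ≤ H)
    (h : eLpNorm u ∞ μ ≤ ENNReal.ofReal H) : ∀ᵐ x ∂μ, |u x| ≤ H := by
  rw [eLpNorm_exponent_top] at h
  filter_upwards [ae_le_eLpNormEssSup (f := u) (μ := μ)] with x hx
  have := hx.trans h
  rw [Real.enorm_eq_ofReal_abs] at this
  exact (ENNReal.ofReal_le_ofReal_iff hH).1 this

variable {K : RN N → RN N → ℝ≥0∞} {j : RN N → ℝ≥0}

/-- The interior oscillation estimate, up to null sets, for weak solutions. -/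
theorem exists_aeOscLE_of_isWeakSol (hKm : Measurable (Function.uncurry K)) (hj : Measurable j)
    (hK : CondK K j) (hKas : CondKas K ∨ CondKasTilde K j) {γ : ℝ} (hγ0 : 0 < γ) (hγ1 : γ < 1)
    (hA1 : CondA1 γ j) (hA2 : CondA2 j) {R₀ : ℝ} (hR₀ : 0 < R₀)
    (hA3 : CondA31 R₀ j ∨ CondA32 R₀ j) {Ω A D B : Set (RN N)} (hΩ : IsOpen Ω) (hA : IsOpen A)
    (hD : IsOpen D) (hB : IsOpen B) (hAD : CompactlyIn A D) (hDB : CompactlyIn D B)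
    (hBΩ : CompactlyIn B Ω) {W : RN N → ℝ} (hW : MemLpLoc ∞ Ω W) {ε : ℝ} (hε : 0 < ε) :
    ∃ δ > 0, ∀ f u : RN N → ℝ, MemLpLoc ∞ Ω f → IsWeakSol K j Ω W f u → ∀ H > 0,
      eLpNorm u ∞ (volume.restrict B) + eLpNorm f ∞ (volume.restrict D) + tailTerm j u D B ≤
        ENNReal.ofReal H → AEOscLE A u (H * ε) δ := by
  obtain ⟨Λ, hΛ1, hΛ⟩ := hK
  have hjs : ∀ ρ > 0, scaleMass j ρ < ∞ := fun ρ hρ => scaleMass_lt_top hγ0 hγ1 hA1 hρ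
  obtain ⟨k, C, hk⟩ := exists_isControlKernel hKm hKas
  have hDΩ : CompactlyIn D Ω := hDB.trans_subset hBΩ.subset
  have hWD := hW.memLp_restrict hDΩ
  set w : ℝ := (eLpNorm W ∞ (volume.restrict D)).toReal with hw
  have hw0 : 0 ≤ w := ENNReal.toReal_nonneg
  -- The class of normalized solutions depends on `W` only through its bound `w`, so `δ` is fixed
  -- before `f`, `u` and `H`.
  obtain ⟨δ, hδ, hosc⟩ := exists_ae_oscillation_le (G := w + 1 + Λ) (by positivity) hΛ
    (zero_lt_one.trans_le hΛ1) hKm hj hk hγ0 hγ1 hA1 hA2 hR₀ hA3 hD hAD hε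
  refine ⟨δ, hδ, fun f u hf hs H hH hle => ?_⟩
  have hu' : eLpNorm u ∞ (volume.restrict B) ≤ ENNReal.ofReal H :=
    (le_self_add.trans le_self_add).trans hle
  have hf' : eLpNorm f ∞ (volume.restrict D) ≤ ENNReal.ofReal H :=
    (le_add_self.trans le_self_add).trans hle
  have ht' : tailTerm j u D B ≤ ENNReal.ofReal H := le_add_self.trans hle
  obtain ⟨v, g, hvg, huv⟩ := exists_isBoundedWeakSol hΛ hKm hj hjs hk hΩ hB hD hDB hBΩ.subset hH hw0
    hWD.aestronglyMeasurable (hf.memLp_restrict hDΩ).aestronglyMeasurable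
    (ae_abs_le_of_eLpNorm_le hw0 (by rw [hw, ENNReal.ofReal_toReal hWD.eLpNorm_ne_top]))
    (ae_abs_le_of_eLpNorm_le hH.le hf') (ae_abs_le_of_eLpNorm_le hH.le hu')
    ((ENNReal.ae_le_essSup _).mono fun x hx => hx.trans ht') hs
  have h1 : AEOscLE A v ε δ := hosc v g hvg
  exact (h1.const_mul hH.le).congr_ae hA.measurableSet
    (ae_restrict_of_ae_restrict_of_subset hAD.subset huv)

theorem setLIntegral_compl_le_of_ball_subset {B : Set (RN N)} {x : RN N} {d : ℝ}
    (h : ∀ y, ‖x - y‖ < d → y ∈ B) (F : RN N → ℝ≥0∞) :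
    ∫⁻ y in Bᶜ, F y ≤ ∫⁻ y in (Metric.ball x d)ᶜ, F y := by
  refine lintegral_mono_set (compl_subset_compl.2 fun y hy => h y ?_)
  rwa [Metric.mem_ball, dist_comm, dist_eq_norm] at hy

theorem tailTerm_lt_top {Ω D B : Set (RN N)} (hD : IsOpen D) (hB : IsOpen B)
    (hDB : CompactlyIn D B) (hBΩ : B ⊆ Ω) {u : RN N → ℝ} (hu : BoundedTail j Ω u) :
    tailTerm j u D B < ∞ := by
  obtain ⟨d, hd, hdB⟩ := hDB.exists_le_norm_sub hB
  refine lt_of_le_of_lt ?_ (hu d hd (closure D) hDB.1 (hDB.2.trans hBΩ))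
  refine le_trans (essSup_mono_ae ?_)
    (essSup_mono_measure' (Measure.restrict_mono subset_closure le_rfl))
  filter_upwards [ae_restrict_mem hD.measurableSet] with x hx
  exact setLIntegral_compl_le_of_ball_subset (hdB x hx) _

theorem setLIntegral_ball_compl_le (hj : Measurable j) (u : RN N → ℝ) (x : RN N) (r : ℝ) :
    ∫⁻ y in (Metric.ball x r)ᶜ, ‖u y‖ₑ * (j (y - x) : ℝ≥0∞) ≤ eLpNorm u ∞ volume * tailMass j r := by
  have h1 : ∀ᵐ y, ‖u y‖ₑ ≤ eLpNorm u ∞ volume := by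
    rw [eLpNorm_exponent_top]
    exact ae_le_eLpNormEssSup
  have hm : Measurable fun w => (cutKernel j r (w - x) : ℝ≥0∞) :=
    ((measurable_cutKernel hj r).comp (measurable_id.sub measurable_const)).coe_nnreal_ennreal
  rw [← lintegral_indicator Metric.isOpen_ball.measurableSet.compl,
    ← lintegral_cutKernel_sub_right j r x, ← lintegral_const_mul _ hm]
  refine lintegral_mono_ae ?_
  filter_upwards [h1] with y hy
  by_cases hyr : y ∈ (Metric.ball x r)ᶜ
  · have hmem : y - x ∈ (Metric.ball (0 : RN N) r)ᶜ := by
      rwa [mem_compl_iff, mem_ball_zero_iff, ← dist_eq_norm]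
    rw [indicator_of_mem hyr, cutKernel, indicator_of_mem hmem]
    exact mul_le_mul' hy le_rfl
  · rw [indicator_of_notMem hyr]
    exact zero_le

theorem boundedTail_of_memLp_top (hj : Measurable j) (htail : ∀ r > 0, tailMass j r < ∞)
    {Ω : Set (RN N)} {u : RN N → ℝ} (hu : MemLp u ∞ volume) : BoundedTail j Ω u := by
  intro r hr S _ _
  refine lt_of_le_of_lt (essSup_le_of_ae_le _
    (Eventually.of_forall fun x => setLIntegral_ball_compl_le hj u x r)) ?_
  exact ENNReal.mul_lt_top hu.eLpNorm_lt_top (htail r hr)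

theorem tailTerm_le (hj : Measurable j) {D B : Set (RN N)} (hD : IsOpen D) {d : ℝ}
    (hdB : ∀ x ∈ D, ∀ y, ‖x - y‖ < d → y ∈ B) (u : RN N → ℝ) :
    tailTerm j u D B ≤ eLpNorm u ∞ volume * tailMass j d := by
  refine essSup_le_of_ae_le _ ?_
  filter_upwards [ae_restrict_mem hD.measurableSet] with x hx
  exact (setLIntegral_compl_le_of_ball_subset (hdB x hx) _).trans
    (setLIntegral_ball_compl_le hj u x d)

theorem memLpLoc_of_memLp {p : ℝ≥0∞} {u : RN N → ℝ} (hu : MemLp u p volume) (Ω : Set (RN N)) :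
    MemLpLoc p Ω u := fun _ _ _ => hu.restrict _

end Representatives

/-! ### Continuity and the modulus for weak solutions. -/

section Main

variable {N : ℕ} {K : RN N → RN N → ℝ≥0∞} {j : RN N → ℝ≥0}

/-- Continuity is local, so it suffices to run the estimate on three nested neighbourhoods of each
point; the size of the data may enter the radius here. -/
theorem exists_isContRep_of_isWeakSol (hKm : Measurable (Function.uncurry K)) (hj : Measurable j)
    (hK : CondK K j) (hKas : CondKas K ∨ CondKasTilde K j) {γ : ℝ} (hγ0 : 0 < γ) (hγ1 : γ < 1)
    (hA1 : CondA1 γ j) (hA2 : CondA2 j) {R₀ : ℝ} (hR₀ : 0 < R₀)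
    (hA3 : CondA31 R₀ j ∨ CondA32 R₀ j) {Ω : Set (RN N)} (hΩ : IsOpen Ω) {W f u : RN N → ℝ}
    (hW : MemLpLoc ∞ Ω W) (hf : MemLpLoc ∞ Ω f) (hs : IsWeakSol K j Ω W f u)
    (hu : MemLpLoc ∞ Ω u) (ht : BoundedTail j Ω u) : ∃ v, IsContRep Ω u v := by
  refine exists_isContRep hΩ fun x hx => ?_
  obtain ⟨B, hB, hxB, hBΩ, hBc⟩ := exists_open_between_and_isCompact_closure
    (isCompact_singleton (x := x)) hΩ (singleton_subset_iff.2 hx)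
  obtain ⟨D, hD, hxD, hDB, hDc⟩ := exists_open_between_and_isCompact_closure
    (isCompact_singleton (x := x)) hB hxB
  obtain ⟨A, hA, hxA, hAD, hAc⟩ := exists_open_between_and_isCompact_closure
    (isCompact_singleton (x := x)) hD hxD
  have hBΩ' : CompactlyIn B Ω := ⟨hBc, hBΩ⟩
  have hDB' : CompactlyIn D B := ⟨hDc, hDB⟩
  have hAD' : CompactlyIn A D := ⟨hAc, hAD⟩
  have hDΩ := hDB'.trans_subset hBΩ'.subset
  refine ⟨A, hA, singleton_subset_iff.1 hxA,
    hAD'.subset.trans hDΩ.subset, fun ε hε => ?_⟩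
  set T := eLpNorm u ∞ (volume.restrict B) + eLpNorm f ∞ (volume.restrict D) + tailTerm j u D B
  have hT : T < ∞ := ENNReal.add_lt_top.2 ⟨ENNReal.add_lt_top.2
    ⟨(hu.memLp_restrict hBΩ').eLpNorm_lt_top, (hf.memLp_restrict hDΩ).eLpNorm_lt_top⟩,
    tailTerm_lt_top hD hB hDB' hBΩ'.subset ht⟩
  -- Adding `1` keeps the normalizing constant positive when the data vanish.
  have hH : 0 < T.toReal + 1 := by positivity
  obtain ⟨δ, hδ, h⟩ := exists_aeOscLE_of_isWeakSol hKm hj hK hKas hγ0 hγ1 hA1 hA2 hR₀ hA3 hΩ hA hD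
    hB hAD' hDB' hBΩ' hW (ε := ε / (T.toReal + 1)) (by positivity)
  refine ⟨δ, hδ, ?_⟩
  have h1 := h f u hf hs _ hH (by
    rw [ENNReal.ofReal_add ENNReal.toReal_nonneg zero_le_one, ENNReal.ofReal_toReal hT.ne]
    exact le_self_add)
  rwa [mul_div_cancel₀ _ hH.ne'] at h1

/-- A modulus of continuity for all weak solutions with locally bounded values and bounded tail. -/
theorem exists_modulus_of_isWeakSol (hKm : Measurable (Function.uncurry K)) (hj : Measurable j)
    (hK : CondK K j) (hKas : CondKas K ∨ CondKasTilde K j) {γ : ℝ} (hγ0 : 0 < γ) (hγ1 : γ < 1)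
    (hA1 : CondA1 γ j) (hA2 : CondA2 j) {R₀ : ℝ} (hR₀ : 0 < R₀)
    (hA3 : CondA31 R₀ j ∨ CondA32 R₀ j) {Ω A D B : Set (RN N)} (hΩ : IsOpen Ω) (hA : IsOpen A)
    (hD : IsOpen D) (hB : IsOpen B) (hAD : CompactlyIn A D) (hDB : CompactlyIn D B)
    (hBΩ : CompactlyIn B Ω) {W : RN N → ℝ} (hW : MemLpLoc ∞ Ω W) :
    ∃ η : ℝ≥0 → ℝ≥0, Monotone η ∧ Continuous η ∧ η 0 = 0 ∧
      ∀ f u v : RN N → ℝ, MemLpLoc ∞ Ω f → IsWeakSol K j Ω W f u → MemLpLoc ∞ Ω u →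
        BoundedTail j Ω u → IsContRep Ω u v → ∀ x ∈ A, ∀ y ∈ A,
          ‖v x - v y‖ₑ ≤ (η (nndist x y) : ℝ≥0∞) *
            (eLpNorm u ∞ (volume.restrict B) + eLpNorm f ∞ (volume.restrict D) +
              tailTerm j u D B) := by
  have hscale : ∀ n : ℕ, (0 : ℝ) < (1 / 2) ^ n := fun n => by positivity
  choose δ hδ hosc using fun n => exists_aeOscLE_of_isWeakSol hKm hj hK hKas hγ0 hγ1 hA1 hA2 hR₀
    hA3 hΩ hA hD hB hAD hDB hBΩ hW (hscale n)
  obtain ⟨η, hηm, hηc, hη0, hη⟩ := exists_modulus hδ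
  refine ⟨η, hηm, hηc, hη0, fun f u v hf hs hu ht hv x hx y hy => ?_⟩
  have hDΩ := hDB.trans_subset hBΩ.subset
  have hAB : A ⊆ B := hAD.subset.trans hDB.subset
  have hAΩ : A ⊆ Ω := hAB.trans hBΩ.subset
  set T := eLpNorm u ∞ (volume.restrict B) + eLpNorm f ∞ (volume.restrict D) + tailTerm j u D B
    with hTdef
  have hT : T < ∞ := ENNReal.add_lt_top.2 ⟨ENNReal.add_lt_top.2
    ⟨(hu.memLp_restrict hBΩ).eLpNorm_lt_top, (hf.memLp_restrict hDΩ).eLpNorm_lt_top⟩,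
    tailTerm_lt_top hD hB hDB hBΩ.subset ht⟩
  have hvA : ContinuousOn v A := hv.1.mono hAΩ
  have hvu : v =ᵐ[volume.restrict A] u := ae_restrict_of_ae_restrict_of_subset hAΩ hv.2
  have key : ∀ H > 0, T ≤ ENNReal.ofReal H → |v x - v y| ≤ η (nndist x y) * H := by
    intro H hH hTH
    refine hη _ _ H hH.le (fun h0 => ?_) ?_ fun n hn => ?_
    · rw [nndist_eq_zero.1 h0, sub_self, abs_zero]
    · have hub := ae_abs_le_of_eLpNorm_le hH.le ((le_self_add.trans le_self_add).trans hTH)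
      have hubA := (ae_restrict_iff' hA.measurableSet).1 (ae_restrict_of_ae_restrict_of_subset hAB hub)
      have h1 : ∀ᵐ p : RN N × RN N, p.1 ∈ A → |u p.1| ≤ H :=
        Measure.quasiMeasurePreserving_fst.ae hubA
      have h2 : ∀ᵐ p : RN N × RN N, p.2 ∈ A → |u p.2| ≤ H :=
        Measure.quasiMeasurePreserving_snd.ae hubA
      have h3 : AEOscLE A u (2 * H) (‖x - y‖ + 1) := by
        filter_upwards [h1, h2] with p hp1 hp2 hA1 hA2 _
        have := abs_sub (u p.1) (u p.2)
        linarith [hp1 hA1, hp2 hA2]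
      exact (h3.congr_ae hA.measurableSet hvu).forall_of_continuousOn hA hvA hx hy (by linarith)
    · rw [coe_nndist, dist_eq_norm] at hn
      exact ((hosc n f u hf hs H hH hTH).congr_ae hA.measurableSet hvu).forall_of_continuousOn hA hvA
        hx hy hn
  -- `T` may be zero, so it is reached as a limit of admissible normalizations `H > T`.
  have hfinal : |v x - v y| ≤ η (nndist x y) * T.toReal := by
    have hcont : Tendsto (fun e : ℝ => (η (nndist x y) : ℝ) * (T.toReal + e)) (𝓝[>] 0)
        (𝓝 (η (nndist x y) * (T.toReal + 0))) :=
      (Continuous.tendsto (by fun_prop) 0).mono_left nhdsWithin_le_nhds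
    rw [add_zero] at hcont
    refine ge_of_tendsto hcont ?_
    filter_upwards [self_mem_nhdsWithin] with e he
    have he' : (0 : ℝ) < e := he
    refine key _ (by positivity) ?_
    rw [ENNReal.ofReal_add ENNReal.toReal_nonneg he'.le, ENNReal.ofReal_toReal hT.ne]
    exact le_self_add
  refine (enorm_le_of_abs_le hfinal).trans (le_of_eq ?_)
  rw [ENNReal.ofReal_mul NNReal.zero_le_coe, ENNReal.ofReal_coe_nnreal, ENNReal.ofReal_toReal hT.ne]

end Main

end

theorem theorem1p2 (N : ℕ) (K : RN N → RN N → ℝ≥0∞) (j : RN N → ℝ≥0)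
    (hKmeas : Measurable (Function.uncurry K)) (hjmeas : Measurable j)
    (hK : CondK K j) (hKas : CondKas K ∨ CondKasTilde K j)
    (γ : ℝ) (hγ0 : 0 < γ) (hγ1 : γ < 1) (hA1 : CondA1 γ j) (hA2 : CondA2 j)
    (R₀ : ℝ) (hR₀ : 0 < R₀) (hA3 : CondA31 R₀ j ∨ CondA32 R₀ j)
    (Ω : Set (RN N)) (hΩ : IsOpen Ω) (W : RN N → ℝ) (hW : MemLpLoc ∞ Ω W) :
    -- globally bounded solutions
    ((∀ f u : RN N → ℝ, MemLpLoc ∞ Ω f → IsWeakSol K j Ω W f u → MemLp u ∞ volume →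
        ∃ v, IsContRep Ω u v) ∧
      (∀ A B : Set (RN N), IsOpen A → IsOpen B → CompactlyIn A B → CompactlyIn B Ω →
        ∃ η : ℝ≥0 → ℝ≥0, Monotone η ∧ Continuous η ∧ η 0 = 0 ∧
          ∀ f u v : RN N → ℝ, MemLpLoc ∞ Ω f → IsWeakSol K j Ω W f u → MemLp u ∞ volume →
            IsContRep Ω u v → ∀ x ∈ A, ∀ y ∈ A,
              ‖v x - v y‖ₑ ≤ (η (nndist x y) : ℝ≥0∞) *
                (eLpNorm u ∞ volume + eLpNorm f ∞ (volume.restrict B)))) ∧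
    -- general form: locally bounded solutions with bounded tail
    ((∀ f u : RN N → ℝ, MemLpLoc ∞ Ω f → IsWeakSol K j Ω W f u → MemLpLoc ∞ Ω u →
        BoundedTail j Ω u → ∃ v, IsContRep Ω u v) ∧
      (∀ A B' B : Set (RN N), IsOpen A → IsOpen B' → IsOpen B →
        CompactlyIn A B' → CompactlyIn B' B → CompactlyIn B Ω →
        ∃ η : ℝ≥0 → ℝ≥0, Monotone η ∧ Continuous η ∧ η 0 = 0 ∧
          ∀ f u v : RN N → ℝ, MemLpLoc ∞ Ω f → IsWeakSol K j Ω W f u → MemLpLoc ∞ Ω u →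
            BoundedTail j Ω u → IsContRep Ω u v → ∀ x ∈ A, ∀ y ∈ A,
              ‖v x - v y‖ₑ ≤ (η (nndist x y) : ℝ≥0∞) *
                (eLpNorm u ∞ (volume.restrict B) + eLpNorm f ∞ (volume.restrict B') +
                  tailTerm j u B' B))) := by
  have htail : ∀ r > 0, tailMass j r < ∞ := fun r hr => tailMass_lt_top hγ0 hγ1 hA1 hr
  refine ⟨⟨fun f u hf hs hu => ?_, fun A B hA hB hAB hBΩ => ?_⟩,
    ⟨fun f u hf hs hu ht => ?_, fun A B' B hA hB' hB hAB' hB'B hBΩ => ?_⟩⟩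
  · exact exists_isContRep_of_isWeakSol hKmeas hjmeas hK hKas hγ0 hγ1 hA1 hA2 hR₀ hA3 hΩ hW hf hs
      (memLpLoc_of_memLp hu Ω) (boundedTail_of_memLp_top hjmeas htail hu)
  -- The general estimate needs one more set than is given: `B` keeps the source, and an
  -- intermediate `E` takes over the local norm of `u`.
  · obtain ⟨E, hE, hBE, hEΩ, hEc⟩ := exists_open_between_and_isCompact_closure hBΩ.1 hΩ hBΩ.2
    have hBE' : CompactlyIn B E := ⟨hBΩ.1, hBE⟩
    obtain ⟨d, hd, hdE⟩ := hBE'.exists_le_norm_sub hE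
    obtain ⟨η, hηm, hηc, hη0, hη⟩ := exists_modulus_of_isWeakSol hKmeas hjmeas hK hKas hγ0 hγ1 hA1
      hA2 hR₀ hA3 hΩ hA hB hE hAB hBE' ⟨hEc, hEΩ⟩ hW
    -- The tail beyond `E` is at most the global norm times `tailMass j d`, since points of `B` are
    -- at distance at least `d` from the complement of `E`.
    set c : ℝ≥0 := 1 + (tailMass j d).toNNReal with hc
    refine ⟨fun t => c * η t, fun s t hst => mul_le_mul' le_rfl (hηm hst), continuous_const.mul hηc,
      by simp [hη0], fun f u v hf hs hu hv x hx y hy => ?_⟩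
    refine (hη f u v hf hs (memLpLoc_of_memLp hu Ω) (boundedTail_of_memLp_top hjmeas htail hu) hv x hx y
      hy).trans ?_
    rw [ENNReal.coe_mul, mul_comm (c : ℝ≥0∞), mul_assoc]
    refine mul_le_mul' le_rfl ?_
    rw [hc, ENNReal.coe_add, ENNReal.coe_toNNReal (htail d hd).ne, ENNReal.coe_one, add_mul, one_mul]
    refine add_le_add (add_le_add (eLpNorm_restrict_le _ _ _ _) le_rfl) ?_
    refine (tailTerm_le hjmeas hB hdE u).trans ?_
    rw [mul_comm]
    exact mul_le_mul' le_rfl le_self_add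
  · exact exists_isContRep_of_isWeakSol hKmeas hjmeas hK hKas hγ0 hγ1 hA1 hA2 hR₀ hA3 hΩ hW hf hs
      hu ht
  · exact exists_modulus_of_isWeakSol hKmeas hjmeas hK hKas hγ0 hγ1 hA1 hA2 hR₀ hA3 hΩ hA hB' hB
      hAB' hB'B hBΩ hW
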